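/- Let $M$ be a smooth connected Riemannian manifold without boundary (Hausdorff, second countable), with Riemannian volume measure $\mu$, and write $\|\cdot\|_q$ for the $L^q(M,\mu)$-norm; for a tensor field $T$ put $\|T\|_q=\||T|\|_q$, where $|\cdot|$ is the pointwise norm induced by the metric. Let $\nabla u$ be the gradient of $u$, $\nabla^2u(X,Y)=(\nabla_X\nabla u,Y)$ its Hessian ($\nabla_X$ being the Levi-Civita connection), $\nabla^\dagger=-\operatorname{div}$ the formal adjoint of the gradient, $\Delta u=\nabla^\dagger\nabla u$, and $\Delta_pu=\nabla^\dagger(|\nabla u|^{p-2}\nabla u)$ the $p$-Laplacian (so that $\Delta_2=\Delta$). Assume that $M$ is geodesically complete, i.e. that every geodesic extends to a geodesic defined on all of $\mathbb R$. Let $p\in[2,\infty)$ and $u\in L^p(M)\cap C^\infty(M)$. Then $$\|\nabla u\|_p^p\le\|u\,\Delta_pu\|_1\in[0,\infty],$$ and for all $a_1,a_2,a_3,b_1,b_2,b_3\in[1,\infty]$ with $1/a_1+1/a_2+1/a_3=1=1/b_1+1/b_2+1/b_3$ one has $$\|\nabla u\|_p^p\le\|u\|_{a_1}\,\|\nabla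 u\|_{(p-2)a_3}^{p-2}\,\|\Delta u\|_{a_2}+(p-2)\,\|u\|_{b_1}\,\|\nabla u\|_{(p-2)b_3}^{p-2}\,\|\nabla^2u\|_{b_2}\in[0,\infty].$$ Here $0\cdot\infty=0$, and for $p=2$ the factor $\|\nabla u\|_{(p-2)a}^{p-2}$ stands for $\||\nabla u|^{p-2}\|_a=\|1\|_a$ (which equals $1$ if $a=\infty$ and $\mu(M)^{1/a}$ if $a<\infty$). -/

import Mathlib

open MeasureTheory Bundle
open scoped Manifold ContDiff ENNReal

namespace Riem

noncomputable section

/-- The model space of `m`-dimensional manifolds. -/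
abbrev Model (m : ℕ) : Type := EuclideanSpace ℝ (Fin m)

/-- The tangent space of the `m`-manifold `M` at `x`. -/
abbrev Tan (m : ℕ) {M : Type*} [TopologicalSpace M] [ChartedSpace (Model m) M] (x : M) : Type :=
  TangentSpace (𝓡 m) x

instance {m : ℕ} {M : Type*} [TopologicalSpace M] [ChartedSpace (Model m) M] (x : M) :
    FiniteDimensional ℝ (Tan m x) :=
  inferInstanceAs (FiniteDimensional ℝ (Model m))

variable {m : ℕ} {M : Type*} [TopologicalSpace M] [ChartedSpace (Model m) M]

/-- The partial derivative `∂ᵢ f` at the point `y` of `ℝᵐ`. -/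
def partialDeriv (i : Fin m) (f : Model m → ℝ) (y : Model m) : ℝ :=
  fderiv ℝ f y (EuclideanSpace.single i 1)

/-- The coordinate vector `∂ᵢ` of the chart around `x₀`, at the point with coordinates `y`. -/
def coordVector (x₀ : M) (i : Fin m) (y : Model m) : Tan m ((extChartAt (𝓡 m) x₀).symm y) :=
  mfderiv 𝓘(ℝ, Model m) (𝓡 m) (extChartAt (𝓡 m) x₀).symm y (EuclideanSpace.single i (1 : ℝ))

/-- The `i`-th component of the tangent vector `v` at `x` in the chart around `x₀`. -/
def component (x₀ : M) (i : Fin m) {x : M} (v : Tan m x) : ℝ :=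
  let w : Model m := mfderiv (𝓡 m) 𝓘(ℝ, Model m) (extChartAt (𝓡 m) x₀) x v
  w i

variable [RiemannianBundle (fun x : M ↦ Tan m x)]

/-- The matrix `(gᵢⱼ)` of the metric in the chart around `x₀`, at the point with
coordinates `y`. -/
def gram (x₀ : M) (y : Model m) : Matrix (Fin m) (Fin m) ℝ :=
  Matrix.of fun i j ↦ inner ℝ (coordVector x₀ i y) (coordVector x₀ j y)

/-- The Riemannian volume density `√det (gᵢⱼ)` in the chart around `x₀`. -/
def density (x₀ : M) (y : Model m) : ℝ := √(gram x₀ y).det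

/-- The Riemannian volume measure on the domain of the chart around `x₀`
(extended by zero to all of `M`). -/
def chartVolume [MeasurableSpace M] (m : ℕ) [ChartedSpace (Model m) M]
    [RiemannianBundle (fun x : M ↦ Tan m x)] (x₀ : M) : Measure M :=
  (((volume : Measure (Model m)).restrict (extChartAt (𝓡 m) x₀).target).withDensity
    fun y ↦ ENNReal.ofReal (density x₀ y)).map (extChartAt (𝓡 m) x₀).symm

/-- The Riemannian volume measure. The measures `chartVolume m x₀` agree on overlaps of charts,
and their supremum is the measure which restricts to each of them. -/
def vol (m : ℕ) (M : Type*) [TopologicalSpace M] [MeasurableSpace M] [ChartedSpace (Model m) M]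
    [RiemannianBundle (fun x : M ↦ Tan m x)] : Measure M :=
  ⨆ x₀ : M, chartVolume m x₀

/-- The Christoffel symbol
`Γᵏᵢⱼ = ½ ∑ₗ gᵏˡ (∂ᵢ gⱼₗ + ∂ⱼ gᵢₗ - ∂ₗ gᵢⱼ)` of the Levi-Civita connection,
in the chart around `x₀`. -/
def christoffel (x₀ : M) (k i j : Fin m) (y : Model m) : ℝ :=
  (1 / 2) * ∑ l, (gram x₀ y)⁻¹ k l *
    (partialDeriv i (fun z ↦ gram x₀ z j l) y + partialDeriv j (fun z ↦ gram x₀ z i l) y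
      - partialDeriv l (fun z ↦ gram x₀ z i j) y)

/-- `γ : ℝ → M` is a geodesic: it is smooth and satisfies the geodesic equation
`c̈ᵏ + ∑ᵢⱼ Γᵏᵢⱼ(c) ċⁱ ċʲ = 0` in charts. -/
def IsGeodesic (m : ℕ) [ChartedSpace (Model m) M] [RiemannianBundle (fun x : M ↦ Tan m x)]
    (γ : ℝ → M) : Prop :=
  ContMDiff 𝓘(ℝ, ℝ) (𝓡 m) ∞ γ ∧
    ∀ (x₀ : M) (t : ℝ), γ t ∈ (extChartAt (𝓡 m) x₀).source → ∀ k : Fin m,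
      deriv (deriv fun s ↦ extChartAt (𝓡 m) x₀ (γ s) k) t
        + ∑ i, ∑ j, christoffel x₀ k i j (extChartAt (𝓡 m) x₀ (γ t))
            * deriv (fun s ↦ extChartAt (𝓡 m) x₀ (γ s) i) t
            * deriv (fun s ↦ extChartAt (𝓡 m) x₀ (γ s) j) t = 0

/-- Geodesic completeness: for every point `x` and every initial velocity `v` at `x`
(given by its components in the chart around `x`) there is a geodesic defined on all of `ℝ`
which starts at `x` with velocity `v`. -/
def GeodesicallyComplete (m : ℕ) (M : Type*) [TopologicalSpace M] [ChartedSpace (Model m) M]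
    [RiemannianBundle (fun x : M ↦ Tan m x)] : Prop :=
  ∀ (x : M) (v : Model m), ∃ γ : ℝ → M, IsGeodesic m γ ∧ γ 0 = x ∧
    HasDerivAt (fun s ↦ extChartAt (𝓡 m) x (γ s)) v 0

/-- The gradient `∇u`: `(∇u, v) = du(v)`. -/
def grad (u : M → ℝ) (x : M) : Tan m x :=
  haveI : CompleteSpace (Tan m x) := FiniteDimensional.complete ℝ _
  (InnerProductSpace.toDual ℝ (Tan m x)).symm (mfderiv (𝓡 m) 𝓘(ℝ, ℝ) u x : Tan m x →L[ℝ] ℝ)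

/-- The covariant derivative `∇_v X` at `x` for the Levi-Civita connection: its `k`-th component
in the chart around `x` is `∑ᵢ vⁱ ∂ᵢ Xᵏ + ∑ᵢⱼ Γᵏᵢⱼ vⁱ Xʲ`. -/
def covDeriv (X : ∀ x : M, Tan m x) (x : M) (v : Tan m x) : Tan m x :=
  let φ := extChartAt (𝓡 m) x
  let w : Model m := WithLp.toLp 2 fun k : Fin m ↦
    ∑ i, component x i v * partialDeriv i (fun z ↦ component x k (X (φ.symm z))) (φ x)
      + ∑ i, ∑ j, christoffel x k i j (φ x) * component x i v * component x j (X x)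
  -- `Tan m x` is the model space, identified through the chart around `x`
  (w : Tan m x)

/-- The Hessian `∇²u(v, w) = (∇_v ∇u, w)`. -/
def hessian (u : M → ℝ) (x : M) (v w : Tan m x) : ℝ :=
  inner ℝ (covDeriv (fun y ↦ grad u y) x v) w

/-- The norm `|∇²u|` at `x` which the metric induces on `T*ₓM ⊗ T*ₓM`. -/
def hessianNorm (m : ℕ) [ChartedSpace (Model m) M] [RiemannianBundle (fun x : M ↦ Tan m x)]
    (u : M → ℝ) (x : M) : ℝ :=
  let e := stdOrthonormalBasis ℝ (Tan m x)
  √(∑ i, ∑ j, hessian u x (e i) (e j) ^ 2)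

/-- The norm `|∇u|` at `x`. -/
def gradNorm (m : ℕ) [ChartedSpace (Model m) M] [RiemannianBundle (fun x : M ↦ Tan m x)]
    (u : M → ℝ) (x : M) : ℝ :=
  ‖(grad u x : Tan m x)‖

/-- The divergence `(√det g)⁻¹ ∑ᵢ ∂ᵢ(√det g · Xⁱ)` of a vector field, at `x` in the chart
around `x`. The formal adjoint `∇†` of the gradient is `-divergence`. -/
def divergence (X : ∀ x : M, Tan m x) (x : M) : ℝ :=
  let φ := extChartAt (𝓡 m) x
  (density x (φ x))⁻¹ *
    ∑ i, partialDeriv i (fun z ↦ density x z * component x i (X (φ.symm z))) (φ x)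

/-- The Laplace-Beltrami operator `Δu = ∇†∇u` (a nonnegative operator). -/
def laplacian (m : ℕ) [ChartedSpace (Model m) M] [RiemannianBundle (fun x : M ↦ Tan m x)]
    (u : M → ℝ) (x : M) : ℝ :=
  -divergence (fun y ↦ (grad u y : Tan m y)) x

/-- The `p`-Laplacian `Δₚu = ∇†(|∇u|^(p-2) ∇u)`. -/
def pLaplacian (m : ℕ) [ChartedSpace (Model m) M] [RiemannianBundle (fun x : M ↦ Tan m x)]
    (p : ℝ) (u : M → ℝ) (x : M) : ℝ :=
  -divergence (fun y ↦ (gradNorm m u y ^ (p - 2) • grad u y : Tan m y)) x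

/-- The factor `‖∇u‖_{(p-2)a}^{p-2}`. At `p = 2`, where `(p - 2)a` is no exponent, it stands for
`‖|∇u|^{p-2}‖_a = ‖1‖_a` (to which it is also equal when `p > 2`). -/
def gradFactor (m : ℕ) [ChartedSpace (Model m) M] [RiemannianBundle (fun x : M ↦ Tan m x)]
    [MeasurableSpace M] (p : ℝ) (a : ℝ≥0∞) (u : M → ℝ) : ℝ≥0∞ :=
  if p = 2 then eLpNorm (fun _ : M ↦ (1 : ℝ)) a (vol m M)
  else eLpNorm (gradNorm m u) (ENNReal.ofReal (p - 2) * a) (vol m M) ^ (p - 2)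

end

end Riem

/-! The estimate is an integration by parts against a cutoff. Write g = |∇u| and let c be a function
with 0 ≤ c ≤ 1, equal to 1 on the ball of radius R about a point, vanishing outside the ball of
radius 2R, with slope at most 1/R. For X = c^p u g^(p-2) ∇u the Leibniz rule gives div X = (c g)^p -
c^p u Δ_p u + p c^(p-1) u g^(p-2) (∇c, ∇u). The last term is at most (p/R) |u| (c g)^(p-1) ≤ (p/R)
(|u|^p + (c g)^p) in absolute value; the p-th power of c is what lets (c g)^p be absorbed on the
left (`divergence_cutoff_smul_ge`). Since ∫ div X = 0, (1 - p/R) ∫ (c g)^p ≤ ‖u Δ_p u‖₁ + (p/R)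
‖u‖_p^p, and Fatou's lemma for R → ∞ gives the first bound (`eLpNorm_gradNorm_rpow_le`). The second
follows from it by Hölder's inequality and Δ_p u = g^(p-2) Δu - (p-2) g^(p-4) ∇²u(∇u, ∇u), valid
where ∇u ≠ 0; where ∇u = 0 and p > 2, Δ_p u = 0 (`abs_pLaplacian_sub_le`).

Completeness enters only through the compact support of c, that is, through the Hopf-Rinow theorem
(`isCompact_setOf_rdist_le`). If an ultrafilter on a closed ball about x had no limit, the limit
f(y) of the distances from y to its points would be a positive 1-Lipschitz function which, from
every point, decreases at unit rate along some short geodesic. A curve along which f decreases at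
unit rate has no corner (`velocity_eq_of_le_rdist`), so one complete geodesic γ from x follows the
descent for ever, and f(γ t) = f(x) - t contradicts positivity. This needs two local facts: nearby
points are joined by a geodesic (`exists_solution_to`), and short geodesics minimise energy
(`exists_energy_le`).

Neither c nor g^(p-2) ∇u need be C^1, so the divergence theorem is proved for compactly supported
locally Lipschitz fields, by Rademacher's theorem and a partition of unity
(`LocLipField.integral_divergence`). The divergence at a point is defined in the chart around that
point; the Piola identity (`trace_fderiv_transform`) makes it computable in any one chart. -/

namespace Riem

open Set Metric Filter Topology
open scoped NNReal

set_option maxSynthPendingDepth 3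
set_option linter.unusedSectionVars false

/-! ### Metrics on open subsets of a vector space: speed, first variation, local bounds. -/

section LocalTheory

variable {E : Type*} [NormedAddCommGroup E] [NormedSpace ℝ E]

/-- A metric `G` on an open subset `U` of a vector space, together with the Christoffel form `Γ`
of its Levi-Civita connection, characterised by the Koszul identity. -/
structure LocalMetric (U : Set E) (G : E → E →L[ℝ] E →L[ℝ] ℝ) (Γ : E → E →L[ℝ] E →L[ℝ] E) :
    Prop where
  isOpen : IsOpen U
  contDiffOn_metric : ContDiffOn ℝ 2 G U
  contDiffOn_christoffel : ContDiffOn ℝ 1 Γ U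
  symm : ∀ y ∈ U, ∀ v w, G y v w = G y w v
  pos : ∀ y ∈ U, ∀ v, v ≠ 0 → 0 < G y v v
  koszul : ∀ y ∈ U, ∀ v w z,
    2 * G y (Γ y v w) z = fderiv ℝ G y v w z + fderiv ℝ G y w v z - fderiv ℝ G y z v w

/-- `c` (with velocity `c'`) solves the geodesic equation of `Γ` at time `t`. -/
def SolvesAt (Γ : E → E →L[ℝ] E →L[ℝ] E) (c c' : ℝ → E) (t : ℝ) : Prop :=
  HasDerivAt c (c' t) t ∧ HasDerivAt c' (-Γ (c t) (c' t) (c' t)) t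

/-- Rescaling time maps solutions of the geodesic equation to solutions. -/
theorem SolvesAt.comp_mul {Γ : E → E →L[ℝ] E →L[ℝ] E} {c c' : ℝ → E} {a t : ℝ}
    (h : SolvesAt Γ c c' (a * t)) :
    SolvesAt Γ (fun s ↦ c (a * s)) (fun s ↦ a • c' (a * s)) t := by
  have hm : HasDerivAt (fun s : ℝ ↦ a * s) a t := by simpa using (hasDerivAt_id t).const_mul a
  refine ⟨h.1.scomp t hm, ?_⟩
  refine ((h.2.scomp t hm).const_smul a).congr_deriv ?_
  simp

namespace LocalMetric

variable {U : Set E} {G : E → E →L[ℝ] E →L[ℝ] ℝ} {Γ : E → E →L[ℝ] E →L[ℝ] E}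

theorem differentiableAt (hG : LocalMetric U G Γ) {y : E} (hy : y ∈ U) :
    DifferentiableAt ℝ G y :=
  (hG.contDiffOn_metric.contDiffAt (hG.isOpen.mem_nhds hy)).differentiableAt (by norm_num)

theorem nonneg (hG : LocalMetric U G Γ) {y : E} (hy : y ∈ U) (v : E) : 0 ≤ G y v v := by
  rcases eq_or_ne v 0 with rfl | hv
  · simp
  · exact (hG.pos y hy v hv).le

theorem hasDerivAt_apply (hG : LocalMetric U G Γ) {c a b : ℝ → E} {c₁ a₁ b₁ : E} {t : ℝ}
    (hU : c t ∈ U) (hc : HasDerivAt c c₁ t) (ha : HasDerivAt a a₁ t) (hb : HasDerivAt b b₁ t) :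
    HasDerivAt (fun s ↦ G (c s) (a s) (b s))
      (fderiv ℝ G (c t) c₁ (a t) (b t) + G (c t) a₁ (b t) + G (c t) (a t) b₁) t := by
  have h := (hG.differentiableAt hU).hasFDerivAt.comp_hasDerivAt t hc
  have := (h.clm_apply ha).clm_apply hb
  simpa using this

/-- With all three arguments equal to the velocity v, the Koszul identity reads 2 G(Γ(v,v), v) =
dG(v)(v, v), which cancels the contribution of the acceleration -Γ(v,v). -/
theorem hasDerivAt_speed (hG : LocalMetric U G Γ) {c c' : ℝ → E} {t : ℝ}
    (h : SolvesAt Γ c c' t) (hU : c t ∈ U) :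
    HasDerivAt (fun s ↦ G (c s) (c' s) (c' s)) 0 t := by
  have := hG.hasDerivAt_apply hU h.1 h.2 h.2
  refine this.congr_deriv ?_
  have k := hG.koszul _ hU (c' t) (c' t) (c' t)
  have s := hG.symm _ hU (c' t) (Γ (c t) (c' t) (c' t))
  simp only [map_neg, neg_apply, s]
  linarith

/-- The first variation formula: the derivative of the energy density of `c` in direction `η`
is a total derivative when `c` is a geodesic. -/
theorem hasDerivAt_firstVariation (hG : LocalMetric U G Γ) {c c' η : ℝ → E} {η₁ : E} {t : ℝ}
    (h : SolvesAt Γ c c' t) (hU : c t ∈ U) (hη : HasDerivAt η η₁ t) :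
    HasDerivAt (fun s ↦ 2 * G (c s) (c' s) (η s))
      (fderiv ℝ G (c t) (η t) (c' t) (c' t) + 2 * G (c t) (c' t) η₁) t := by
  have := (hG.hasDerivAt_apply hU h.1 h.2 hη).const_mul 2
  refine this.congr_deriv ?_
  have k := hG.koszul _ hU (c' t) (c' t) (η t)
  simp only [map_neg, neg_apply]
  linarith

end LocalMetric

/-- A positive definite bilinear form on a finite-dimensional space is coercive. -/
theorem exists_forall_mul_norm_sq_le [FiniteDimensional ℝ E] (B : E →L[ℝ] E →L[ℝ] ℝ)
    (hB : ∀ v, v ≠ 0 → 0 < B v v) : ∃ l > 0, ∀ v, l * ‖v‖ ^ 2 ≤ B v v := by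
  have := FiniteDimensional.proper ℝ E
  rcases (sphere (0 : E) 1).eq_empty_or_nonempty with hS | hS
  · refine ⟨1, one_pos, fun v ↦ ?_⟩
    have hv : v = 0 := by
      by_contra hv
      have : (‖v‖⁻¹ • v) ∈ sphere (0 : E) 1 := by
        simp [norm_smul, norm_ne_zero_iff.2 hv]
      simp [hS] at this
    simp [hv]
  · obtain ⟨w, hw, hmin⟩ := (isCompact_sphere (0 : E) 1).exists_isMinOn hS
      (f := fun v ↦ B v v) (by fun_prop)
    have hw0 : w ≠ 0 := by
      rintro rfl
      simp at hw
    refine ⟨B w w, hB w hw0, fun v ↦ ?_⟩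
    rcases eq_or_ne v 0 with rfl | hv
    · simp
    have hv' : 0 < ‖v‖ := norm_pos_iff.2 hv
    have h1 : B w w ≤ B (‖v‖⁻¹ • v) (‖v‖⁻¹ • v) :=
      hmin (by simp [norm_smul, hv'.ne'] : (‖v‖⁻¹ • v) ∈ sphere (0 : E) 1)
    simp only [map_smul, smul_apply, smul_eq_mul] at h1
    calc B w w * ‖v‖ ^ 2 ≤ (‖v‖⁻¹ * (‖v‖⁻¹ * B v v)) * ‖v‖ ^ 2 := by gcongr
      _ = B v v := by field_simp

namespace LocalMetric

variable {U : Set E} {G : E → E →L[ℝ] E →L[ℝ] ℝ} {Γ : E → E →L[ℝ] E →L[ℝ] E}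

/-- Uniform local bounds for a metric: coercivity, Lipschitz bound and Taylor expansion. -/
theorem exists_bounds [FiniteDimensional ℝ E] (hG : LocalMetric U G Γ) {p : E} (hp : p ∈ U) :
    ∃ R > 0, ∃ l > 0, ∃ C > 0, closedBall p R ⊆ U ∧
      (∀ y ∈ closedBall p R, ∀ v, l * ‖v‖ ^ 2 ≤ G y v v) ∧
      (∀ y ∈ closedBall p R, ∀ z ∈ closedBall p R, ‖G z - G y‖ ≤ C * ‖z - y‖) ∧
      (∀ y ∈ closedBall p R, ∀ z ∈ closedBall p R,
        ‖G z - G y - fderiv ℝ G y (z - y)‖ ≤ C * ‖z - y‖ ^ 2) := by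
  obtain ⟨l, hl, hlG⟩ := exists_forall_mul_norm_sq_le (G p) (hG.pos p hp)
  have hGp := hG.contDiffOn_metric.contDiffAt (hG.isOpen.mem_nhds hp)
  obtain ⟨K₁, s₁, hs₁, hK₁⟩ := (hGp.of_le (m := 1) (by norm_num)).exists_lipschitzOnWith
  obtain ⟨K₂, s₂, hs₂, hK₂⟩ :=
    (hGp.fderiv_right (m := 1) (by norm_num)).exists_lipschitzOnWith
  -- A perturbation of norm below l/2 leaves half of the coercivity constant at p.
  have hc : ∀ᶠ y in 𝓝 p, ‖G y - G p‖ < l / 2 := by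
    have : Tendsto (fun y ↦ ‖G y - G p‖) (𝓝 p) (𝓝 ‖G p - G p‖) :=
      ((hGp.continuousAt.sub continuousAt_const).norm)
    exact this.eventually (gt_mem_nhds (by simpa using half_pos hl))
  obtain ⟨R, hR, hRs⟩ := nhds_basis_closedBall.mem_iff.1
    (inter_mem (inter_mem hs₁ hs₂) (inter_mem hc (hG.isOpen.mem_nhds hp)))
  refine ⟨R, hR, l / 2, half_pos hl, K₁ + K₂ + 1, by positivity,
    fun y hy ↦ (hRs hy).2.2, fun y hy v ↦ ?_, fun y hy z hz ↦ ?_, fun y hy z hz ↦ ?_⟩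
  · have h1 : |(G y - G p) v v| ≤ l / 2 * ‖v‖ * ‖v‖ :=
      ((G y - G p).le_opNorm₂ v v).trans (by gcongr; exact (hRs hy).2.1.le)
    have h2 := hlG v
    simp only [sub_apply] at h1
    have := (abs_le.1 h1).1
    nlinarith
  · refine (hK₁.norm_sub_le (hRs hz).1.1 (hRs hy).1.1).trans ?_
    gcongr
    have := K₂.2
    linarith
  -- Taylor bound by the mean value inequality. Intersecting with the ball of radius ‖z - y‖ about y
  -- keeps the derivative of G within K₂ ‖z - y‖ of its value at y, which produces the quadratic
  -- error.
  · have hconv : Convex ℝ (closedBall p R ∩ closedBall y ‖z - y‖) :=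
      (convex_closedBall _ _).inter (convex_closedBall _ _)
    have := hconv.norm_image_sub_le_of_norm_hasFDerivWithin_le' (f := G)
      (f' := fun x ↦ fderiv ℝ G x) (φ := fderiv ℝ G y) (C := K₂ * ‖z - y‖) (x := y) (y := z)
      (fun x hx ↦ (hG.differentiableAt (hRs hx.1).2.2).hasFDerivAt.hasFDerivWithinAt)
      (fun x hx ↦ (hK₂.norm_sub_le (hRs hx.1).1.2 (hRs hy).1.2).trans (by
        have := hx.2; rw [mem_closedBall, dist_eq_norm] at this; gcongr))
      ⟨hy, by simp⟩ ⟨hz, by simp [dist_eq_norm]⟩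
    refine this.trans ?_
    have := K₁.2
    nlinarith [norm_nonneg (z - y), mul_nonneg (norm_nonneg (z - y)) (norm_nonneg (z - y))]

end LocalMetric

end LocalTheory

/-! ### Short geodesics minimise energy. -/

section LocalTheory

variable {E : Type*} [NormedAddCommGroup E] [NormedSpace ℝ E]

/-- The variance ∫ (f - I)² is nonnegative, I being the mean of f over the unit interval. -/
theorem sq_intervalIntegral_le {f : ℝ → ℝ} (hf : ContinuousOn f (Icc 0 1)) :
    (∫ t in (0 : ℝ)..1, f t) ^ 2 ≤ ∫ t in (0 : ℝ)..1, f t ^ 2 := by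
  have hi : IntervalIntegrable f volume 0 1 := hf.intervalIntegrable_of_Icc zero_le_one
  have hi2 : IntervalIntegrable (fun t ↦ f t ^ 2) volume 0 1 :=
    (hf.pow 2).intervalIntegrable_of_Icc zero_le_one
  set I := ∫ t in (0 : ℝ)..1, f t with hI
  have h0 : 0 ≤ ∫ t in (0 : ℝ)..1, (f t ^ 2 - (2 * I) * f t + I ^ 2) :=
    intervalIntegral.integral_nonneg zero_le_one fun t _ ↦ by nlinarith [sq_nonneg (f t - I)]
  rw [intervalIntegral.integral_add (hi2.sub (hi.const_mul _)) (by simp),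
    intervalIntegral.integral_sub hi2 (hi.const_mul _), intervalIntegral.integral_const_mul,
    ← hI] at h0
  simp at h0
  nlinarith

namespace LocalMetric

variable {U : Set E} {G : E → E →L[ℝ] E →L[ℝ] ℝ} {Γ : E → E →L[ℝ] E →L[ℝ] E}

theorem continuousOn_apply (hG : LocalMetric U G Γ) {c a b : ℝ → E} {s : Set ℝ}
    (hc : ContinuousOn c s) (hU : MapsTo c s U) (ha : ContinuousOn a s) (hb : ContinuousOn b s) :
    ContinuousOn (fun t ↦ G (c t) (a t) (b t)) s :=
  ((hG.contDiffOn_metric.continuousOn.comp hc hU).clm_apply ha).clm_apply hb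

theorem speed_eq (hG : LocalMetric U G Γ) {c c' : ℝ → E} {b : ℝ}
    (h : ∀ t ∈ Icc 0 b, SolvesAt Γ c c' t) (hU : MapsTo c (Icc 0 b) U) {t : ℝ}
    (ht : t ∈ Icc 0 b) : G (c t) (c' t) (c' t) = G (c 0) (c' 0) (c' 0) :=
  constant_of_has_deriv_right_zero (f := fun t ↦ G (c t) (c' t) (c' t))
    (fun s hs ↦ (hG.hasDerivAt_speed (h s hs) (hU hs)).continuousAt.continuousWithinAt)
    (fun s hs ↦ (hG.hasDerivAt_speed (h s (Ico_subset_Icc_self hs))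
      (hU (Ico_subset_Icc_self hs))).hasDerivWithinAt) t ht

/-- Short geodesics minimise energy among nearby curves with the same endpoints. -/
theorem exists_energy_le [FiniteDimensional ℝ E] (hG : LocalMetric U G Γ) {p : E} (hp : p ∈ U) :
    ∃ R > 0, ∃ K > 0, closedBall p R ⊆ U ∧ ∀ c c' σ σ' : ℝ → E,
      (∀ t ∈ Icc (0 : ℝ) 1, SolvesAt Γ c c' t) → MapsTo c (Icc 0 1) (closedBall p R) →
      (∀ t ∈ Icc (0 : ℝ) 1, ‖c' t‖ ≤ K) →
      (∀ t ∈ Icc (0 : ℝ) 1, HasDerivAt σ (σ' t) t) → ContinuousOn σ' (Icc 0 1) →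
      MapsTo σ (Icc 0 1) (closedBall p R) → σ 0 = c 0 → σ 1 = c 1 →
      G (c 0) (c' 0) (c' 0) ≤ ∫ t in (0 : ℝ)..1, G (σ t) (σ' t) (σ' t) := by
  obtain ⟨R, hR, l, hl, C, hC, hRU, hlb, hlip, htay⟩ := hG.exists_bounds hp
  -- The errors below add up to 3 C K N², to be absorbed by l N²; hence K ≤ l / (3C). The bound K ≤
  -- 1 lets K² be replaced by K.
  refine ⟨R, hR, min 1 (l / (3 * C)), by positivity, hRU, ?_⟩
  intro c c' σ σ' hc hcR hcK hσ hσ' hσR h0 h1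
  set K := min 1 (l / (3 * C)) with hK
  have hK0 : 0 < K := by positivity
  have hK1 : K ≤ 1 := min_le_left _ _
  have hKl : 3 * C * K ≤ l := by
    have : K ≤ l / (3 * C) := min_le_right _ _
    rwa [le_div_iff₀ (by positivity), mul_comm] at this
  have cc : ContinuousOn c (Icc 0 1) := fun t ht ↦ (hc t ht).1.continuousAt.continuousWithinAt
  have cc' : ContinuousOn c' (Icc 0 1) := fun t ht ↦ (hc t ht).2.continuousAt.continuousWithinAt
  have cσ : ContinuousOn σ (Icc 0 1) := fun t ht ↦ (hσ t ht).continuousAt.continuousWithinAt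
  have hcU : MapsTo c (Icc 0 1) U := fun t ht ↦ hRU (hcR ht)
  have hσU : MapsTo σ (Icc 0 1) U := fun t ht ↦ hRU (hσR ht)
  set η : ℝ → E := fun t ↦ σ t - c t with hη
  set η' : ℝ → E := fun t ↦ σ' t - c' t with hη'
  have dη : ∀ t ∈ Icc (0 : ℝ) 1, HasDerivAt η (η' t) t := fun t ht ↦ (hσ t ht).sub (hc t ht).1
  have cη' : ContinuousOn η' (Icc 0 1) := hσ'.sub cc'
  have cη : ContinuousOn η (Icc 0 1) := cσ.sub cc
  -- the first variation integrates to zero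
  set h' : ℝ → ℝ := fun t ↦ fderiv ℝ G (c t) (η t) (c' t) (c' t) + 2 * G (c t) (c' t) (η' t)
    with hh'
  have ch' : ContinuousOn h' (Icc 0 1) := by
    have : ContinuousOn (fun t ↦ fderiv ℝ G (c t)) (Icc 0 1) :=
      (hG.contDiffOn_metric.continuousOn_fderiv_of_isOpen hG.isOpen (by norm_num)).comp cc hcU
    exact (((this.clm_apply cη).clm_apply cc').clm_apply cc').add
      ((hG.continuousOn_apply cc hcU cc' cη').const_smul (2 : ℝ))
  have hzero : ∫ t in (0 : ℝ)..1, h' t = 0 := by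
    rw [intervalIntegral.integral_eq_sub_of_hasDerivAt
      (f := fun t ↦ 2 * G (c t) (c' t) (η t)) (fun t ht ↦ ?_)
      (ch'.intervalIntegrable_of_Icc zero_le_one)]
    · simp [hη, h0, h1]
    · rw [uIcc_of_le zero_le_one] at ht
      exact hG.hasDerivAt_firstVariation (hc t ht) (hcU ht) (dη t ht)
  -- N dominates the variation η uniformly, because η vanishes at time 0.
  set N := ∫ t in (0 : ℝ)..1, ‖η' t‖ with hN
  have hN0 : 0 ≤ N := intervalIntegral.integral_nonneg zero_le_one fun _ _ ↦ norm_nonneg _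
  have hηN : ∀ t ∈ Icc (0 : ℝ) 1, ‖η t‖ ≤ N := by
    intro t ht
    have hint : IntervalIntegrable η' volume 0 t :=
      (cη'.mono (Icc_subset_Icc_right ht.2)).intervalIntegrable_of_Icc ht.1
    have e : ∫ s in (0 : ℝ)..t, η' s = η t := by
      rw [intervalIntegral.integral_eq_sub_of_hasDerivAt (f := η) (fun s hs ↦ ?_) hint]
      · simp [hη, h0]
      · rw [uIcc_of_le ht.1] at hs
        exact dη s ⟨hs.1, hs.2.trans ht.2⟩
    rw [← e]
    refine (intervalIntegral.norm_integral_le_integral_norm ht.1).trans ?_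
    exact intervalIntegral.integral_mono_interval le_rfl ht.1 ht.2
      (Eventually.of_forall fun _ ↦ norm_nonneg _)
      (cη'.norm.intervalIntegrable_of_Icc zero_le_one)
  have hN2 := sq_intervalIntegral_le cη'.norm
  rw [← hN] at hN2
  -- Expand the energy density at σ = c + η. The constant term is the conserved speed of c, the
  -- linear term is h', coercivity gives l ‖η'‖², and the Taylor and Lipschitz bounds of the metric
  -- control the rest.
  have key : ∀ t ∈ Icc (0 : ℝ) 1,
      G (c 0) (c' 0) (c' 0) + h' t + (l * ‖η' t‖ ^ 2 - 2 * C * K * N * ‖η' t‖ - C * K * N ^ 2)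
        ≤ G (σ t) (σ' t) (σ' t) := by
    intro t ht
    rw [← hG.speed_eq hc hcU ht]
    have hσc : σ t = c t + η t := by simp [hη]
    have hσc' : σ' t = c' t + η' t := by simp [hη']
    have s := hG.symm _ (hσU ht) (c' t) (η' t)
    have b1 : -(C * N ^ 2 * K)
        ≤ (G (σ t) - G (c t) - fderiv ℝ G (c t) (σ t - c t)) (c' t) (c' t) := by
      refine (abs_le.1 ((((G (σ t) - G (c t) - fderiv ℝ G (c t) (σ t - c t))).le_opNorm₂ (c' t)
        (c' t)).trans (?_ : _ ≤ C * N ^ 2 * K))).1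
      calc _ ≤ (C * N ^ 2) * K * 1 := by
            gcongr
            · exact (htay _ (hcR ht) _ (hσR ht)).trans (by gcongr; exact hηN t ht)
            · exact hcK t ht
            · exact (hcK t ht).trans hK1
        _ = _ := by ring
    have b2 : -(C * N * K * ‖η' t‖) ≤ (G (σ t) - G (c t)) (c' t) (η' t) := by
      refine (abs_le.1 (((G (σ t) - G (c t)).le_opNorm₂ (c' t) (η' t)).trans
        (?_ : _ ≤ C * N * K * ‖η' t‖))).1
      gcongr
      · exact (hlip _ (hcR ht) _ (hσR ht)).trans (by gcongr; exact hηN t ht)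
      · exact hcK t ht
    have b3 := hlb _ (hσR ht) (η' t)
    have ex : G (σ t) (σ' t) (σ' t) = G (σ t) (c' t) (c' t) + 2 * G (σ t) (c' t) (η' t)
        + G (σ t) (η' t) (η' t) := by
      rw [hσc']
      simp only [map_add, add_apply]
      rw [← s]
      ring
    simp only [sub_apply] at b1 b2
    rw [ex, hh']
    simp only [hη]
    nlinarith
  have i1 : IntervalIntegrable (fun t ↦ ‖η' t‖ ^ 2) volume 0 1 :=
    (cη'.norm.pow 2).intervalIntegrable_of_Icc zero_le_one
  have i2 : IntervalIntegrable (fun t ↦ ‖η' t‖) volume 0 1 :=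
    cη'.norm.intervalIntegrable_of_Icc zero_le_one
  have i3 : IntervalIntegrable h' volume 0 1 := ch'.intervalIntegrable_of_Icc zero_le_one
  have mono := intervalIntegral.integral_mono_on zero_le_one
    (((intervalIntegrable_const (c := G (c 0) (c' 0) (c' 0))).add i3).add
      (((i1.const_mul l).sub (i2.const_mul (2 * C * K * N))).sub
        (intervalIntegrable_const (c := C * K * N ^ 2))))
    ((hG.continuousOn_apply cσ hσU hσ' hσ').intervalIntegrable_of_Icc zero_le_one) key
  rw [intervalIntegral.integral_add (intervalIntegrable_const.add i3)
      (((i1.const_mul l).sub (i2.const_mul _)).sub intervalIntegrable_const),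
    intervalIntegral.integral_add intervalIntegrable_const i3, hzero,
    intervalIntegral.integral_sub ((i1.const_mul l).sub (i2.const_mul _)) intervalIntegrable_const,
    intervalIntegral.integral_sub (i1.const_mul l) (i2.const_mul _),
    intervalIntegral.integral_const_mul, intervalIntegral.integral_const_mul, ← hN] at mono
  simp only [intervalIntegral.integral_const, sub_zero, one_smul] at mono
  -- After integration the remainder is at least (l - 3 C K) N² ≥ 0.
  have : l * N ^ 2 ≤ l * ∫ t in (0 : ℝ)..1, ‖η' t‖ ^ 2 := by gcongr
  nlinarith [sq_nonneg N]

end LocalMetric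

end LocalTheory

/-! ### The geodesic flow: existence, uniqueness, and geodesics with prescribed endpoints. -/

section LocalTheory

variable {E : Type*} [NormedAddCommGroup E] [NormedSpace ℝ E]

/-- Solutions of an autonomous differential equation with `C^1` right-hand side which start close
to `x₀` exist for a uniform time and stay in a prescribed ball. -/
theorem exists_flow [CompleteSpace E] {F : E → E} {x₀ : E} (hF : ContDiffAt ℝ 1 F x₀) {R : ℝ}
    (hR : 0 < R) :
    ∃ a > 0, a ≤ R ∧ ∃ τ > 0, ∃ L : ℝ≥0, LipschitzOnWith L F (closedBall x₀ a) ∧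
      ∀ x ∈ closedBall x₀ (a / 2), ∃ α : ℝ → E, α 0 = x ∧ ∀ t ∈ Icc (-τ) τ,
        α t ∈ closedBall x₀ a ∧ HasDerivWithinAt α (F (α t)) (Icc (-τ) τ) t := by
  obtain ⟨L, s, hs, hL⟩ := hF.exists_lipschitzOnWith
  obtain ⟨b, hb, hbs⟩ := nhds_basis_closedBall.mem_iff.1 hs
  obtain ⟨a, ha0, hab, haR⟩ : ∃ a, 0 < a ∧ a ≤ b ∧ a ≤ R :=
    ⟨min b R, lt_min hb hR, min_le_left _ _, min_le_right _ _⟩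
  have has : closedBall x₀ a ⊆ s := (closedBall_subset_closedBall hab).trans hbs
  obtain ⟨N, hN⟩ : ∃ N, N = L * a + ‖F x₀‖ + 1 := ⟨_, rfl⟩
  have hN0 : 0 < N := by rw [hN]; positivity
  set τ := a / (2 * N) with hτ
  have hτ0 : 0 < τ := by positivity
  have bound : ∀ x ∈ closedBall x₀ a, ‖F x‖ ≤ N := by
    intro x hx
    have h1 := hL.norm_sub_le (has hx) (has (mem_closedBall_self ha0.le))
    have h2 : ‖x - x₀‖ ≤ a := by simpa [dist_eq_norm] using hx
    have h3 : (L : ℝ) * ‖x - x₀‖ ≤ L * a := by gcongr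
    have h4 := norm_le_norm_sub_add (F x) (F x₀)
    linarith
  lift a to ℝ≥0 using ha0.le
  lift N to ℝ≥0 using hN0.le
  have pl : IsPicardLindelof (fun _ ↦ F) (tmin := -τ) (tmax := τ) ⟨0, by simp [hτ0.le]⟩ x₀
      a (a / 2) N L := by
    refine .of_time_independent bound (hL.mono has) ?_
    simp only [sub_zero, sub_neg_eq_add, zero_add, max_self, hτ]
    have : (N : ℝ) ≠ 0 := hN0.ne'
    push_cast
    field_simp
    norm_num
  refine ⟨a, ha0, haR, τ, hτ0, L, hL.mono has, fun x hx ↦ ?_⟩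
  have hx' : x ∈ closedBall x₀ ((a / 2 : ℝ≥0) : ℝ) := by simpa using hx
  obtain ⟨α, hα⟩ := ODE.FunSpace.exists_isFixedPt_next pl hx'
  refine ⟨α.compProj, ?_, fun t ht ↦ ⟨α.compProj_mem_closedBall pl.mul_max_le, ?_⟩⟩
  · have h0 : (0 : ℝ) ∈ Icc (-τ) τ := ⟨by linarith, hτ0.le⟩
    rw [ODE.FunSpace.compProj_of_mem h0, ← hα]
    exact ODE.FunSpace.next_apply₀ _ _ _
  · apply (ODE.hasDerivWithinAt_picard_Icc (t₀ := 0) ⟨by linarith, hτ0.le⟩ pl.continuousOn_uncurry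
      α.continuous_compProj.continuousOn (fun _ _ ↦ α.compProj_mem_closedBall pl.mul_max_le)
      x ht).congr_of_mem _ ht
    intro t' ht'
    nth_rw 1 [← hα]
    rw [ODE.FunSpace.compProj_of_mem ht', ODE.FunSpace.next_apply]

/-- The geodesic equation as a first-order system. -/
noncomputable def spray (Γ : E → E →L[ℝ] E →L[ℝ] E) (z : E × E) : E × E := (z.2, -Γ z.1 z.2 z.2)

theorem SolvesAt.hasDerivAt_prodMk {Γ : E → E →L[ℝ] E →L[ℝ] E} {c c' : ℝ → E} {t : ℝ}
    (h : SolvesAt Γ c c' t) : HasDerivAt (fun s ↦ (c s, c' s)) (spray Γ (c t, c' t)) t :=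
  h.1.prodMk h.2

theorem solvesAt_of_hasDerivAt {Γ : E → E →L[ℝ] E →L[ℝ] E} {α : ℝ → E × E} {t : ℝ}
    (h : HasDerivAt α (spray Γ (α t)) t) :
    SolvesAt Γ (fun s ↦ (α s).1) (fun s ↦ (α s).2) t :=
  ⟨h.fst, h.snd⟩

namespace LocalMetric

variable {U : Set E} {G : E → E →L[ℝ] E →L[ℝ] ℝ} {Γ : E → E →L[ℝ] E →L[ℝ] E}

theorem contDiffAt_spray (hG : LocalMetric U G Γ) {p : E} (hp : p ∈ U) (v : E) :
    ContDiffAt ℝ 1 (spray Γ) (p, v) := by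
  have h1 : ContDiffAt ℝ 1 (fun z : E × E ↦ Γ z.1) (p, v) :=
    (hG.contDiffOn_christoffel.contDiffAt (hG.isOpen.mem_nhds hp)).comp (p, v) contDiffAt_fst
  exact contDiffAt_snd.prodMk ((h1.clm_apply contDiffAt_snd).clm_apply contDiffAt_snd).neg

/-- Local uniqueness of geodesics. -/
theorem eventuallyEq_of_solvesAt (hG : LocalMetric U G Γ) {c c' d d' : ℝ → E} {t₀ : ℝ}
    (hU : c t₀ ∈ U) (hc : ∀ᶠ t in 𝓝 t₀, SolvesAt Γ c c' t) (hd : ∀ᶠ t in 𝓝 t₀, SolvesAt Γ d d' t)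
    (h : c t₀ = d t₀) (h' : c' t₀ = d' t₀) : c =ᶠ[𝓝 t₀] d := by
  obtain ⟨L, s, hs, hL⟩ := (hG.contDiffAt_spray hU (c' t₀)).exists_lipschitzOnWith
  have hs' : s ∈ 𝓝 (d t₀, d' t₀) := by rwa [← h, ← h']
  have := ODE_solution_unique_of_eventually (v := fun _ ↦ spray Γ) (s := fun _ ↦ s) (K := L)
    (f := fun s ↦ (c s, c' s)) (g := fun s ↦ (d s, d' s)) (t₀ := t₀)
    (Eventually.of_forall fun _ ↦ hL)
    ((hc.mono fun t ht ↦ ht.hasDerivAt_prodMk).and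
      (hc.self_of_nhds.hasDerivAt_prodMk.continuousAt.preimage_mem_nhds hs))
    ((hd.mono fun t ht ↦ ht.hasDerivAt_prodMk).and
      (hd.self_of_nhds.hasDerivAt_prodMk.continuousAt.preimage_mem_nhds hs'))
    (by simp [h, h'])
  filter_upwards [this] with t ht using congrArg Prod.fst ht

/-- Every point near `p` is joined to `p` by a short geodesic with small velocity. -/
theorem exists_solution_to [FiniteDimensional ℝ E] (hG : LocalMetric U G Γ) {p : E} (hp : p ∈ U)
    {R K : ℝ} (hR : 0 < R) (hK : 0 < K) :
    ∃ r > 0, ∀ z ∈ closedBall p r, ∃ c c' : ℝ → E, c 0 = p ∧ c 1 = z ∧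
      ∀ t ∈ Icc (-1 : ℝ) 1, SolvesAt Γ c c' t ∧ c t ∈ closedBall p R ∧ ‖c' t‖ ≤ K := by
  have := FiniteDimensional.complete ℝ E
  obtain ⟨a, ha, haR, τ, hτ, L, hL, flow⟩ := exists_flow (hG.contDiffAt_spray hp 0) hR
  choose! α hα0 hα using flow
  have mem (v : E) (hv : v ∈ closedBall (0 : E) (a / 2)) :
      ((p, v) : E × E) ∈ closedBall ((p, 0) : E × E) (a / 2) := by
    simpa [Prod.dist_eq, (half_pos ha).le] using hv
  set M : ℝ := L * Real.exp (L * τ) with hM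
  have hM0 : 0 ≤ M := by positivity
  -- Three constraints: trajectories exist up to time T, velocities bounded by a become at most K
  -- after rescaling time by T, and M T ≤ 1/2 makes the endpoint map a small perturbation of a
  -- linear map.
  set T : ℝ := min (τ / 2) (min (K / a) (1 / (2 * (M + 1)))) with hT
  have hT0 : 0 < T := by positivity
  have hTτ : T < τ := (min_le_left _ _).trans_lt (half_lt_self hτ)
  have hTK : T * a ≤ K := by
    rw [← le_div_iff₀ ha]
    exact (min_le_right _ _).trans (min_le_left _ _)
  have hTM : M * T ≤ 1 / 2 := by
    have h : T ≤ 1 / (2 * (M + 1)) := (min_le_right _ _).trans (min_le_right _ _)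
    rw [le_div_iff₀ (by positivity)] at h
    nlinarith
  -- the solution with initial velocity `v`
  let s : E → ℝ → E × E := fun v ↦ α (p, v)
  have sder (v : E) (hv : v ∈ closedBall (0 : E) (a / 2)) {t : ℝ} (ht : t ∈ Icc (-T) T) :
      HasDerivAt (s v) (spray Γ (s v t)) t :=
    ((hα _ (mem v hv) t ⟨by linarith [ht.1], by linarith [ht.2]⟩).2).hasDerivAt
      (Icc_mem_nhds (by linarith [ht.1]) (by linarith [ht.2]))
  have smem (v : E) (hv : v ∈ closedBall (0 : E) (a / 2)) {t : ℝ} (ht : t ∈ Icc (-T) T) :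
      s v t ∈ closedBall ((p, 0) : E × E) a :=
    (hα _ (mem v hv) t ⟨by linarith [ht.1], by linarith [ht.2]⟩).1
  have s0 (v : E) (hv : v ∈ closedBall (0 : E) (a / 2)) : s v 0 = (p, v) := hα0 _ (mem v hv)
  have sub : Icc 0 T ⊆ Icc (-T) T := Icc_subset_Icc_left (by linarith)
  have scont (v : E) (hv : v ∈ closedBall (0 : E) (a / 2)) : ContinuousOn (s v) (Icc 0 T) :=
    fun t ht ↦ (sder v hv (sub ht)).continuousAt.continuousWithinAt
  -- Lipschitz dependence on the initial velocity
  have lip (v w : E) (hv : v ∈ closedBall (0 : E) (a / 2)) (hw : w ∈ closedBall (0 : E) (a / 2))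
      {t : ℝ} (ht : t ∈ Icc 0 T) : ‖spray Γ (s v t) - spray Γ (s w t)‖ ≤ M * ‖v - w‖ := by
    have h1 := dist_le_of_trajectories_ODE_of_mem (v := fun _ ↦ spray Γ)
      (s := fun _ ↦ closedBall ((p, 0) : E × E) a) (K := L) (δ := ‖v - w‖) (fun _ _ ↦ hL)
      (scont v hv)
      (fun t ht ↦ (sder v hv (sub (Ico_subset_Icc_self ht))).hasDerivWithinAt)
      (fun t ht ↦ smem v hv (sub (Ico_subset_Icc_self ht)))
      (scont w hw)
      (fun t ht ↦ (sder w hw (sub (Ico_subset_Icc_self ht))).hasDerivWithinAt)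
      (fun t ht ↦ smem w hw (sub (Ico_subset_Icc_self ht)))
      (by simp [s0 v hv, s0 w hw, dist_eq_norm]) t ht
    refine (hL.norm_sub_le (smem v hv (sub ht)) (smem w hw (sub ht))).trans ?_
    rw [← dist_eq_norm]
    calc (L : ℝ) * dist (s v t) (s w t) ≤ L * (‖v - w‖ * Real.exp (L * (t - 0))) := by gcongr
      _ ≤ L * (‖v - w‖ * Real.exp (L * τ)) := by
        gcongr
        have := ht.2
        linarith
      _ = M * ‖v - w‖ := by rw [hM]; ring
  -- Integrating the bound on the accelerations once controls the difference of velocities; `d1`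
  -- integrates once more for the positions.
  have d2 (v w : E) (hv : v ∈ closedBall (0 : E) (a / 2)) (hw : w ∈ closedBall (0 : E) (a / 2))
      {t : ℝ} (ht : t ∈ Icc 0 T) : ‖(s v t).2 - (s w t).2 - (v - w)‖ ≤ M * ‖v - w‖ * T := by
    have := norm_image_sub_le_of_norm_deriv_le_segment' (f := fun t ↦ (s v t).2 - (s w t).2)
      (f' := fun t ↦ (spray Γ (s v t)).2 - (spray Γ (s w t)).2) (a := 0) (b := T)
      (C := M * ‖v - w‖)
      (fun t ht ↦ ((solvesAt_of_hasDerivAt (sder v hv (sub ht))).2.sub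
        (solvesAt_of_hasDerivAt (sder w hw (sub ht))).2).hasDerivWithinAt)
      (fun t ht ↦ (norm_snd_le (spray Γ (s v t) - spray Γ (s w t))).trans
        (lip v w hv hw (Ico_subset_Icc_self ht))) t ht
    simp only [s0 v hv, s0 w hw, sub_zero] at this
    refine this.trans ?_
    gcongr
    exact ht.2
  have d1 (v w : E) (hv : v ∈ closedBall (0 : E) (a / 2)) (hw : w ∈ closedBall (0 : E) (a / 2)) :
      ‖(s v T).1 - (s w T).1 - T • (v - w)‖ ≤ M * ‖v - w‖ * T * T := by
    have := norm_image_sub_le_of_norm_deriv_le_segment'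
      (f := fun t ↦ (s v t).1 - (s w t).1 - t • (v - w))
      (f' := fun t ↦ (s v t).2 - (s w t).2 - (v - w)) (a := 0) (b := T)
      (C := M * ‖v - w‖ * T)
      (fun t ht ↦ (((solvesAt_of_hasDerivAt (sder v hv (sub ht))).1.sub
        (solvesAt_of_hasDerivAt (sder w hw (sub ht))).1).sub
        (((hasDerivAt_id t).smul_const (v - w)).congr_deriv (one_smul _ _))).hasDerivWithinAt)
      (fun t ht ↦ d2 v w hv hw (Ico_subset_Icc_self ht)) T ⟨hT0.le, le_rfl⟩
    simpa [s0 v hv, s0 w hw] using this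
  -- the time-`T` map is close to `T • id`
  have hz : (0 : E) ∈ closedBall (0 : E) (a / 2) := mem_closedBall_self (half_pos ha).le
  have sT0 : (s 0 T).1 = p := by
    have hsp : spray Γ ((p, 0) : E × E) = 0 := by simp [spray]
    have := ODE_solution_unique_of_mem_Icc_right (v := fun _ ↦ spray Γ)
      (s := fun _ ↦ closedBall ((p, 0) : E × E) a) (K := L) (fun _ _ ↦ hL)
      (scont 0 hz)
      (fun t ht ↦ (sder 0 hz (sub (Ico_subset_Icc_self ht))).hasDerivWithinAt)
      (fun t ht ↦ smem 0 hz (sub (Ico_subset_Icc_self ht)))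
      (g := fun _ ↦ ((p, 0) : E × E)) continuousOn_const
      (fun t ht ↦ by rw [hsp]; exact hasDerivWithinAt_const _ _ _)
      (fun t ht ↦ mem_closedBall_self ha.le) (s0 0 hz) ⟨hT0.le, le_rfl⟩
    rw [this]
  -- This replaces the inverse function theorem for the exponential map: only Lipschitz closeness to
  -- the identity, with constant 1/2, is needed for surjectivity.
  have approx : ApproximatesLinearOn (fun v ↦ T⁻¹ • (s v T).1) (ContinuousLinearMap.id ℝ E)
      (closedBall 0 (a / 2)) (1 / 2) := by
    intro v hv w hw
    have e : T⁻¹ • (s v T).1 - T⁻¹ • (s w T).1 - (ContinuousLinearMap.id ℝ E) (v - w)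
        = T⁻¹ • ((s v T).1 - (s w T).1 - T • (v - w)) := by
      simp [smul_sub, smul_smul, hT0.ne']
    rw [e, norm_smul, norm_inv, Real.norm_of_nonneg hT0.le, inv_mul_le_iff₀ hT0]
    refine (d1 v w hv hw).trans ?_
    have := norm_nonneg (v - w)
    have h2 : M * T * (‖v - w‖ * T) ≤ 1 / 2 * (‖v - w‖ * T) := by gcongr
    push_cast
    linarith
  have surj := approx.surjOn_closedBall_of_nonlinearRightInverse
    ⟨id, 1, by simp, by simp⟩ (half_pos ha).le (b := 0) subset_rfl
  -- The rescaled endpoint map covers the ball of radius (1 - 1/2) · a/2 = a/4 about its value at 0;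
  -- undoing the factor 1/T gives this radius.
  refine ⟨T * (a / 4), by positivity, fun z hz ↦ ?_⟩
  obtain ⟨v, hv, hvz⟩ := surj (a := T⁻¹ • z) (by
    rw [mem_closedBall, sT0, dist_eq_norm, ← smul_sub, norm_smul, norm_inv,
      Real.norm_of_nonneg hT0.le, inv_mul_le_iff₀ hT0, ← dist_eq_norm]
    refine (mem_closedBall.1 hz).trans (le_of_eq ?_)
    push_cast
    ring)
  have hvz' : (s v T).1 = z := smul_right_injective E (inv_ne_zero hT0.ne') hvz
  refine ⟨fun t ↦ (s v (T * t)).1, fun t ↦ T • (s v (T * t)).2, by simp [s0 v hv],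
    by simpa using hvz', fun t ht ↦ ?_⟩
  have htT : T * t ∈ Icc (-T) T := ⟨by nlinarith [ht.1], by nlinarith [ht.2]⟩
  have hm := smem v hv htT
  rw [mem_closedBall, Prod.dist_eq, max_le_iff] at hm
  refine ⟨(solvesAt_of_hasDerivAt (sder v hv htT)).comp_mul, hm.1.trans haR, ?_⟩
  rw [norm_smul, Real.norm_of_nonneg hT0.le]
  have h2 : ‖(s v (T * t)).2‖ ≤ a := by simpa using hm.2
  exact (mul_le_mul_of_nonneg_left h2 hT0.le).trans hTK

end LocalMetric

end LocalTheory

/-! ### The Riemannian metric and its Christoffel symbols in a chart. -/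

noncomputable section Charts

variable {m : ℕ} {M : Type*} [TopologicalSpace M] [ChartedSpace (Model m) M]

/-- The derivative of the chart around `x₀`, read in the model space. -/
def chartD (x₀ : M) (x : M) : Tan m x →L[ℝ] Model m :=
  mfderiv (𝓡 m) 𝓘(ℝ, Model m) (extChartAt (𝓡 m) x₀) x

/-- The derivative of the inverse of the chart around `x₀`. -/
def chartDSymm (x₀ : M) (y : Model m) : Model m →L[ℝ] Tan m ((extChartAt (𝓡 m) x₀).symm y) :=
  mfderiv 𝓘(ℝ, Model m) (𝓡 m) (extChartAt (𝓡 m) x₀).symm y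

theorem coordVector_eq (x₀ : M) (i : Fin m) (y : Model m) :
    coordVector x₀ i y = chartDSymm x₀ y (EuclideanSpace.single i 1) := rfl

variable [IsManifold (𝓡 m) ∞ M]

theorem isOpen_target (x₀ : M) : IsOpen (extChartAt (𝓡 m) x₀).target := isOpen_extChartAt_target x₀

theorem chartD_chartDSymm {x₀ : M} {y : Model m} (hy : y ∈ (extChartAt (𝓡 m) x₀).target)
    (v : Model m) : chartD x₀ ((extChartAt (𝓡 m) x₀).symm y) (chartDSymm x₀ y v) = v := by
  have := mfderiv_extChartAt_comp_mfderivWithin_extChartAt_symm hy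
  simp only [ModelWithCorners.range_eq_univ, mfderivWithin_univ] at this
  exact congr($this v)

theorem chartDSymm_chartD {x₀ : M} {y : Model m} (hy : y ∈ (extChartAt (𝓡 m) x₀).target)
    (w : Tan m ((extChartAt (𝓡 m) x₀).symm y)) :
    chartDSymm x₀ y (chartD x₀ ((extChartAt (𝓡 m) x₀).symm y) w) = w := by
  have := mfderivWithin_extChartAt_symm_comp_mfderiv_extChartAt hy
  simp only [ModelWithCorners.range_eq_univ, mfderivWithin_univ] at this
  exact congr($this w)

theorem mdifferentiableAt_symm {x₀ : M} {y : Model m} (hy : y ∈ (extChartAt (𝓡 m) x₀).target) :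
    MDifferentiableAt 𝓘(ℝ, Model m) (𝓡 m) (extChartAt (𝓡 m) x₀).symm y := by
  have := mdifferentiableWithinAt_extChartAt_symm hy
  simpa only [ModelWithCorners.range_eq_univ, mdifferentiableWithinAt_univ] using this

theorem mdifferentiableAt_chart {x₀ x : M} (hx : x ∈ (extChartAt (𝓡 m) x₀).source) :
    MDifferentiableAt (𝓡 m) 𝓘(ℝ, Model m) (extChartAt (𝓡 m) x₀) x :=
  mdifferentiableAt_extChartAt (by simpa using hx)

theorem exists_mem_target_eq {x₀ x : M} (hx : x ∈ (extChartAt (𝓡 m) x₀).source) :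
    ∃ y ∈ (extChartAt (𝓡 m) x₀).target, (extChartAt (𝓡 m) x₀).symm y = x :=
  ⟨_, (extChartAt (𝓡 m) x₀).map_source hx, (extChartAt (𝓡 m) x₀).left_inv hx⟩

/-- The derivative of the chart around `x` at `x` is the identification of `Tan m x` with the
model space. -/
theorem chartD_self (x : M) (v : Tan m x) : chartD x x v = (v : Model m) := by
  have h : mfderiv (𝓡 m) 𝓘(ℝ, Model m) (extChartAt (𝓡 m) x) x = tangentCoordChange (𝓡 m) x x x := by
    rw [(hasMFDerivAt_extChartAt (mem_chart_source _ x)).mfderiv]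
    exact mfderiv_chartAt_eq_tangentCoordChange (mem_chart_source _ x)
  rw [chartD, h]
  exact tangentCoordChange_self (mem_extChartAt_source x)

variable [RiemannianBundle (fun x : M ↦ Tan m x)]
  [IsContMDiffRiemannianBundle (𝓡 m) ∞ (Model m) (fun x : M ↦ Tan m x)]

/-- The coordinate vectors form smooth sections, being the tangent map of the inverse chart applied
to constant fields, and the bundle metric is smooth. -/
theorem contDiffOn_gram (x₀ : M) (i j : Fin m) :
    ContDiffOn ℝ ∞ (fun y ↦ gram x₀ y i j) (extChartAt (𝓡 m) x₀).target := by
  have h (k : Fin m) : ContMDiffOn 𝓘(ℝ, Model m) ((𝓡 m).prod 𝓘(ℝ, Model m)) ∞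
      (fun y : Model m ↦ (⟨(extChartAt (𝓡 m) x₀).symm y, coordVector x₀ k y⟩ :
        TotalSpace (Model m) (fun x : M ↦ Tan m x))) (extChartAt (𝓡 m) x₀).target := by
    have h1 : ContMDiffOn 𝓘(ℝ, Model m) (𝓡 m) ∞ (extChartAt (𝓡 m) x₀).symm
      (extChartAt (𝓡 m) x₀).target := contMDiffOn_extChartAt_symm x₀
    have h2 := h1.contMDiffOn_tangentMapWithin (m := ∞) (by simp)
      (isOpen_target x₀).uniqueMDiffOn
    have h3 : ContMDiff 𝓘(ℝ, Model m) 𝓘(ℝ, Model m).tangent ∞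
        (fun y : Model m ↦ (⟨y, EuclideanSpace.single k (1 : ℝ)⟩ :
          TangentBundle 𝓘(ℝ, Model m) (Model m))) :=
      contMDiff_vectorSpace_iff_contDiff.2 contDiff_const
    refine (h2.comp h3.contMDiffOn fun y hy ↦ hy).congr fun y hy ↦ ?_
    simp only [Function.comp, tangentMapWithin, coordVector]
    rw [mfderivWithin_of_isOpen (isOpen_target x₀) hy]
  have := ContMDiffOn.inner_bundle (h i) (h j)
  rw [contMDiffOn_iff_contDiffOn] at this
  exact this

/-- The metric in the chart around `x₀`, as a field of bilinear forms. -/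
def metricForm (x₀ : M) (y : Model m) : Model m →L[ℝ] Model m →L[ℝ] ℝ :=
  ∑ i, ∑ j, gram x₀ y i j • ContinuousLinearMap.smulRight (EuclideanSpace.proj (𝕜 := ℝ) i)
    (EuclideanSpace.proj (𝕜 := ℝ) j : Model m →L[ℝ] ℝ)

/-- The Christoffel symbols in the chart around `x₀`, as a field of bilinear maps. -/
def christoffelForm (x₀ : M) (y : Model m) : Model m →L[ℝ] Model m →L[ℝ] Model m :=
  ∑ k, ∑ i, ∑ j, christoffel x₀ k i j y •
    ContinuousLinearMap.smulRight (EuclideanSpace.proj (𝕜 := ℝ) i)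
      (ContinuousLinearMap.smulRight (EuclideanSpace.proj (𝕜 := ℝ) j : Model m →L[ℝ] ℝ)
        (EuclideanSpace.single k (1 : ℝ)))

theorem metricForm_apply (x₀ : M) (y v w : Model m) :
    metricForm x₀ y v w = ∑ i, ∑ j, gram x₀ y i j * v i * w j := by
  simp [metricForm, mul_assoc]

theorem christoffelForm_apply (x₀ : M) (y v w : Model m) (k : Fin m) :
    christoffelForm x₀ y v w k = ∑ i, ∑ j, christoffel x₀ k i j y * v i * w j := by
  simp [christoffelForm, mul_assoc, Finset.sum_apply, Pi.single_apply]

theorem eq_sum_single (v : Model m) : v = ∑ i, v i • EuclideanSpace.single i (1 : ℝ) := by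
  ext k
  simp [Pi.single_apply]

theorem inner_chartDSymm (x₀ : M) (y v w : Model m) :
    inner ℝ (chartDSymm x₀ y v) (chartDSymm x₀ y w) = metricForm x₀ y v w := by
  conv_lhs => rw [eq_sum_single v, eq_sum_single w]
  simp only [map_sum, map_smul, sum_inner, inner_sum, real_inner_smul_left, real_inner_smul_right,
    metricForm_apply, gram, coordVector_eq, Matrix.of_apply]
  rw [Finset.sum_comm]
  exact Finset.sum_congr rfl fun i _ ↦ Finset.sum_congr rfl fun j _ ↦ by ring

theorem inner_eq_metricForm {x₀ x : M} (hx : x ∈ (extChartAt (𝓡 m) x₀).source) (v w : Tan m x) :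
    inner ℝ v w = metricForm x₀ (extChartAt (𝓡 m) x₀ x) (chartD x₀ x v) (chartD x₀ x w) := by
  obtain ⟨y, hy, rfl⟩ := exists_mem_target_eq hx
  rw [(extChartAt (𝓡 m) x₀).right_inv hy, ← inner_chartDSymm, chartDSymm_chartD hy,
    chartDSymm_chartD hy]

theorem chartDSymm_ne_zero {x₀ : M} {y : Model m} (hy : y ∈ (extChartAt (𝓡 m) x₀).target)
    {v : Model m} (hv : v ≠ 0) : chartDSymm x₀ y v ≠ 0 := by
  intro h
  have := chartD_chartDSymm hy v
  rw [h, map_zero] at this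
  exact hv this.symm

theorem metricForm_pos {x₀ : M} {y : Model m} (hy : y ∈ (extChartAt (𝓡 m) x₀).target)
    {v : Model m} (hv : v ≠ 0) : 0 < metricForm x₀ y v v := by
  rw [← inner_chartDSymm]
  exact real_inner_self_pos.2 (chartDSymm_ne_zero hy hv)

theorem gram_symm (x₀ : M) (y : Model m) (i j : Fin m) : gram x₀ y i j = gram x₀ y j i := by
  simp only [gram, Matrix.of_apply]
  exact real_inner_comm _ _

theorem posDef_gram {x₀ : M} {y : Model m} (hy : y ∈ (extChartAt (𝓡 m) x₀).target) :
    (gram x₀ y).PosDef := by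
  refine Matrix.PosDef.of_dotProduct_mulVec_pos (Matrix.IsHermitian.ext fun i j ↦ ?_)
    fun v hv ↦ ?_
  · simpa using gram_symm x₀ y j i
  · have h := metricForm_pos hy (v := WithLp.toLp 2 v) (by simpa using hv)
    rw [metricForm_apply] at h
    have e : star v ⬝ᵥ (gram x₀ y).mulVec v = ∑ i, ∑ j, gram x₀ y i j * v i * v j := by
      simp only [dotProduct, Matrix.mulVec, Finset.mul_sum, star_trivial]
      exact Finset.sum_congr rfl fun i _ ↦ Finset.sum_congr rfl fun j _ ↦ by ring
    rw [e]
    exact h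

theorem det_gram_pos {x₀ : M} {y : Model m} (hy : y ∈ (extChartAt (𝓡 m) x₀).target) :
    0 < (gram x₀ y).det := (posDef_gram hy).det_pos

theorem density_pos {x₀ : M} {y : Model m} (hy : y ∈ (extChartAt (𝓡 m) x₀).target) :
    0 < density x₀ y := Real.sqrt_pos.2 (det_gram_pos hy)

theorem contDiffOn_det_gram (x₀ : M) :
    ContDiffOn ℝ ∞ (fun y ↦ (gram x₀ y).det) (extChartAt (𝓡 m) x₀).target := by
  simp only [Matrix.det_apply]
  exact ContDiffOn.sum fun σ _ ↦ (contDiffOn_prod fun i _ ↦ contDiffOn_gram x₀ _ _).const_smul _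

theorem contDiffOn_density (x₀ : M) :
    ContDiffOn ℝ ∞ (density x₀) (extChartAt (𝓡 m) x₀).target :=
  (contDiffOn_det_gram x₀).sqrt fun _ hy ↦ (det_gram_pos hy).ne'

/-- By Cramer's rule the entries are polynomials in the gram matrix divided by its nonvanishing
determinant. -/
theorem contDiffOn_gram_inv (x₀ : M) (i j : Fin m) :
    ContDiffOn ℝ ∞ (fun y ↦ (gram x₀ y)⁻¹ i j) (extChartAt (𝓡 m) x₀).target := by
  have : ∀ y, (gram x₀ y)⁻¹ i j = ((gram x₀ y).det)⁻¹ * (gram x₀ y).adjugate i j := by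
    intro y
    simp [Matrix.inv_def]
  simp only [this, Matrix.adjugate_apply, Matrix.det_apply]
  refine ContDiffOn.mul ?_ ?_
  · have := (contDiffOn_det_gram (m := m) x₀).inv fun _ hy ↦ (det_gram_pos hy).ne'
    exact this.congr fun y _ ↦ by simp only [Pi.inv_apply, Matrix.det_apply]
  · refine ContDiffOn.sum fun σ _ ↦ ContDiffOn.const_smul _ ?_
    refine contDiffOn_prod fun k _ ↦ ?_
    by_cases h : σ k = j
    · simp only [h, Matrix.updateRow_self]
      exact contDiffOn_const
    · simp only [Matrix.updateRow_ne h]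
      exact contDiffOn_gram x₀ _ _

theorem contDiffOn_partialDeriv {f : Model m → ℝ} {U : Set (Model m)} (hU : IsOpen U)
    (hf : ContDiffOn ℝ ∞ f U) (i : Fin m) : ContDiffOn ℝ ∞ (partialDeriv i f) U :=
  (hf.fderiv_of_isOpen hU (m := ∞) (by simp)).clm_apply contDiffOn_const

theorem contDiffOn_christoffel (x₀ : M) (k i j : Fin m) :
    ContDiffOn ℝ ∞ (christoffel x₀ k i j) (extChartAt (𝓡 m) x₀).target := by
  have h (a b c : Fin m) := contDiffOn_partialDeriv (isOpen_target x₀) (contDiffOn_gram x₀ a b) c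
  exact contDiffOn_const.mul (ContDiffOn.sum fun l _ ↦ (contDiffOn_gram_inv x₀ k l).mul
    (((h j l i).add (h i l j)).sub (h i j l)))

theorem contDiffOn_metricForm (x₀ : M) :
    ContDiffOn ℝ ∞ (metricForm x₀) (extChartAt (𝓡 m) x₀).target :=
  ContDiffOn.sum fun i _ ↦ ContDiffOn.sum fun j _ ↦ (contDiffOn_gram x₀ i j).smul contDiffOn_const

theorem contDiffOn_christoffelForm (x₀ : M) :
    ContDiffOn ℝ ∞ (christoffelForm x₀) (extChartAt (𝓡 m) x₀).target :=
  ContDiffOn.sum fun k _ ↦ ContDiffOn.sum fun i _ ↦ ContDiffOn.sum fun j _ ↦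
    (contDiffOn_christoffel x₀ k i j).smul contDiffOn_const

theorem fderiv_eq_sum_partialDeriv (f : Model m → ℝ) (y v : Model m) :
    fderiv ℝ f y v = ∑ i, v i * partialDeriv i f y := by
  conv_lhs => rw [eq_sum_single v]
  simp [partialDeriv]

theorem differentiableAt_gram {x₀ : M} {y : Model m} (hy : y ∈ (extChartAt (𝓡 m) x₀).target)
    (i j : Fin m) : DifferentiableAt ℝ (fun z ↦ gram x₀ z i j) y :=
  ((contDiffOn_gram x₀ i j).contDiffAt ((isOpen_target x₀).mem_nhds hy)).differentiableAt (by simp)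

theorem fderiv_metricForm {x₀ : M} {y : Model m} (hy : y ∈ (extChartAt (𝓡 m) x₀).target)
    (u v w : Model m) :
    fderiv ℝ (metricForm x₀) y u v w
      = ∑ i, ∑ j, fderiv ℝ (fun z ↦ gram x₀ z i j) y u * v i * w j := by
  have h : HasFDerivAt (metricForm x₀) (∑ i, ∑ j,
      (fderiv ℝ (fun z ↦ gram x₀ z i j) y).smulRight
        (ContinuousLinearMap.smulRight (EuclideanSpace.proj (𝕜 := ℝ) i)
          (EuclideanSpace.proj (𝕜 := ℝ) j : Model m →L[ℝ] ℝ))) y :=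
    HasFDerivAt.fun_sum fun i _ ↦ HasFDerivAt.fun_sum fun j _ ↦
      (differentiableAt_gram hy i j).hasFDerivAt.smul_const _
  rw [h.fderiv]
  simp [mul_assoc]

/-- The inverse matrix in the definition of the symbols cancels against the metric; this is the
Koszul identity on coordinate vectors. -/
theorem sum_gram_mul_christoffel {x₀ : M} {y : Model m} (hy : y ∈ (extChartAt (𝓡 m) x₀).target)
    (i j l : Fin m) :
    2 * ∑ k, gram x₀ y k l * christoffel x₀ k i j y
      = partialDeriv i (fun z ↦ gram x₀ z j l) y + partialDeriv j (fun z ↦ gram x₀ z i l) y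
        - partialDeriv l (fun z ↦ gram x₀ z i j) y := by
  set P : Fin m → ℝ := fun l ↦ partialDeriv i (fun z ↦ gram x₀ z j l) y
    + partialDeriv j (fun z ↦ gram x₀ z i l) y - partialDeriv l (fun z ↦ gram x₀ z i j) y with hP
  have h1 : ∀ k, christoffel x₀ k i j y = (1 / 2) * ((gram x₀ y)⁻¹.mulVec P) k := fun k ↦ rfl
  have h2 : (gram x₀ y).mulVec ((gram x₀ y)⁻¹.mulVec P) = P := by
    rw [Matrix.mulVec_mulVec, Matrix.mul_nonsing_inv _ (det_gram_pos hy).ne'.isUnit,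
      Matrix.one_mulVec]
  have h3 : ∑ k, gram x₀ y k l * christoffel x₀ k i j y
      = (1 / 2) * (gram x₀ y).mulVec ((gram x₀ y)⁻¹.mulVec P) l := by
    simp only [h1, gram_symm x₀ y _ l]
    rw [Matrix.mulVec, dotProduct, Finset.mul_sum]
    exact Finset.sum_congr rfl fun k _ ↦ by ring
  rw [h3, h2]
  ring

theorem sum_rotate {ι : Type*} [Fintype ι] (F : ι → ι → ι → ι → ℝ) :
    ∑ k, ∑ l, ∑ i, ∑ j, F k l i j = ∑ i, ∑ j, ∑ l, ∑ k, F k l i j := by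
  calc ∑ k, ∑ l, ∑ i, ∑ j, F k l i j = ∑ l, ∑ i, ∑ k, ∑ j, F k l i j := by
        rw [Finset.sum_comm]
        exact Finset.sum_congr rfl fun l _ ↦ Finset.sum_comm
    _ = ∑ i, ∑ l, ∑ j, ∑ k, F k l i j := by
        rw [Finset.sum_comm]
        exact Finset.sum_congr rfl fun i _ ↦ Finset.sum_congr rfl fun l _ ↦ Finset.sum_comm
    _ = _ := Finset.sum_congr rfl fun i _ ↦ Finset.sum_comm

/-- The metric in a chart is a local metric whose Christoffel form is `christoffelForm`. -/
theorem localMetric (x₀ : M) :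
    LocalMetric (extChartAt (𝓡 m) x₀).target (metricForm x₀) (christoffelForm x₀) where
  isOpen := isOpen_target x₀
  contDiffOn_metric := contDiffOn_infty.1 (contDiffOn_metricForm x₀) 2
  contDiffOn_christoffel := contDiffOn_infty.1 (contDiffOn_christoffelForm x₀) 1
  symm y _ v w := by
    rw [← inner_chartDSymm, ← inner_chartDSymm]
    exact real_inner_comm _ _
  pos y hy v hv := metricForm_pos hy hv
  koszul y hy v w z := by
    simp only [metricForm_apply, christoffelForm_apply, fderiv_metricForm hy,
      fderiv_eq_sum_partialDeriv]
    have e1 : 2 * ∑ k, ∑ l, gram x₀ y k l * (∑ i, ∑ j, christoffel x₀ k i j y * v i * w j) * z l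
        = ∑ i, ∑ j, ∑ l, (2 * ∑ k, gram x₀ y k l * christoffel x₀ k i j y) * (v i * w j * z l) := by
      simp only [Finset.mul_sum, Finset.sum_mul]
      rw [sum_rotate]
      exact Finset.sum_congr rfl fun i _ ↦ Finset.sum_congr rfl fun j _ ↦
        Finset.sum_congr rfl fun l _ ↦ Finset.sum_congr rfl fun k _ ↦ by ring
    rw [e1]
    simp only [sum_gram_mul_christoffel hy]
    have e2 : ∑ j, ∑ l, (∑ i, v i * partialDeriv i (fun z ↦ gram x₀ z j l) y) * w j * z l
        = ∑ i, ∑ j, ∑ l, partialDeriv i (fun z ↦ gram x₀ z j l) y * (v i * w j * z l) := by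
      simp only [Finset.sum_mul]
      rw [Finset.sum_congr rfl fun j _ ↦ Finset.sum_comm, Finset.sum_comm]
      exact Finset.sum_congr rfl fun i _ ↦ Finset.sum_congr rfl fun j _ ↦
        Finset.sum_congr rfl fun l _ ↦ by ring
    have e3 : ∑ i, ∑ l, (∑ j, w j * partialDeriv j (fun z ↦ gram x₀ z i l) y) * v i * z l
        = ∑ i, ∑ j, ∑ l, partialDeriv j (fun z ↦ gram x₀ z i l) y * (v i * w j * z l) := by
      simp only [Finset.sum_mul]
      rw [Finset.sum_congr rfl fun j _ ↦ Finset.sum_comm]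
      exact Finset.sum_congr rfl fun i _ ↦ Finset.sum_congr rfl fun j _ ↦
        Finset.sum_congr rfl fun l _ ↦ by ring
    have e4 : ∑ i, ∑ j, (∑ l, z l * partialDeriv l (fun z ↦ gram x₀ z i j) y) * v i * w j
        = ∑ i, ∑ j, ∑ l, partialDeriv l (fun z ↦ gram x₀ z i j) y * (v i * w j * z l) := by
      simp only [Finset.sum_mul]
      exact Finset.sum_congr rfl fun i _ ↦ Finset.sum_congr rfl fun j _ ↦
        Finset.sum_congr rfl fun l _ ↦ by ring
    rw [e2, e3, e4]
    simp only [sub_mul, add_mul, Finset.sum_sub_distrib, Finset.sum_add_distrib]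

end Charts

/-! ### The Riemannian distance. -/

noncomputable section Distance

variable {m : ℕ} {M : Type*} [TopologicalSpace M] [ChartedSpace (Model m) M]
  [IsManifold (𝓡 m) ∞ M] [RiemannianBundle (fun x : M ↦ Tan m x)]
  [IsContMDiffRiemannianBundle (𝓡 m) ∞ (Model m) (fun x : M ↦ Tan m x)]

/-- Supplies the continuity of the metric on which the results about `Manifold.riemannianEDist`
rest. -/
instance isContinuousRiemannianBundle :
    IsContinuousRiemannianBundle (Model m) (fun x : M ↦ Tan m x) := by
  obtain ⟨g, hg, hg'⟩ := IsContMDiffRiemannianBundle.exists_contMDiff (IB := 𝓡 m) (n := ∞)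
    (F := Model m) (E := fun x : M ↦ Tan m x)
  exact ⟨g, hg.continuous, hg'⟩

/-- The velocity of a curve. -/
def velocity (m : ℕ) [ChartedSpace (Model m) M] (γ : ℝ → M) (t : ℝ) : Tan m (γ t) :=
  mfderiv 𝓘(ℝ, ℝ) (𝓡 m) γ t (1 : ℝ)

/-- The Riemannian distance, as a real number. -/
def rdist (m : ℕ) [ChartedSpace (Model m) M] [RiemannianBundle (fun x : M ↦ Tan m x)]
    (x y : M) : ℝ :=
  (Manifold.riemannianEDist (𝓡 m) x y).toReal

theorem hasDerivAt_chart_comp {x₀ : M} {γ : ℝ → M} {t : ℝ}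
    (hγ : MDifferentiableAt 𝓘(ℝ, ℝ) (𝓡 m) γ t) (ht : γ t ∈ (extChartAt (𝓡 m) x₀).source) :
    HasDerivAt (fun s ↦ extChartAt (𝓡 m) x₀ (γ s)) (chartD x₀ (γ t) (velocity m γ t)) t := by
  have h := (mdifferentiableAt_chart ht).hasMFDerivAt.comp t hγ.hasMFDerivAt
  have h2 : HasFDerivAt (fun s ↦ extChartAt (𝓡 m) x₀ (γ s))
    ((chartD x₀ (γ t)).comp (mfderiv 𝓘(ℝ, ℝ) (𝓡 m) γ t) : ℝ →L[ℝ] Model m) t :=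
    hasMFDerivAt_iff_hasFDerivAt.1 h
  exact hasFDerivAt_iff_hasDerivAt.1 h2

theorem norm_velocity_sq {x₀ : M} {γ : ℝ → M} {t : ℝ}
    (hγ : MDifferentiableAt 𝓘(ℝ, ℝ) (𝓡 m) γ t) (ht : γ t ∈ (extChartAt (𝓡 m) x₀).source)
    {v : Model m} (hv : HasDerivAt (fun s ↦ extChartAt (𝓡 m) x₀ (γ s)) v t) :
    ‖velocity m γ t‖ ^ 2 = metricForm x₀ (extChartAt (𝓡 m) x₀ (γ t)) v v := by
  rw [← real_inner_self_eq_norm_sq, inner_eq_metricForm ht,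
    (hasDerivAt_chart_comp hγ ht).unique hv]

theorem mdifferentiableAt_symm_comp {x₀ : M} {c : ℝ → Model m} {v : Model m} {t : ℝ}
    (hc : HasDerivAt c v t) (ht : c t ∈ (extChartAt (𝓡 m) x₀).target) :
    MDifferentiableAt 𝓘(ℝ, ℝ) (𝓡 m) (fun s ↦ (extChartAt (𝓡 m) x₀).symm (c s)) t :=
  (mdifferentiableAt_symm ht).comp t hc.differentiableAt.mdifferentiableAt

theorem norm_velocity_symm_comp_sq {x₀ : M} {c : ℝ → Model m} {v : Model m} {t : ℝ}
    (hc : HasDerivAt c v t) (ht : c t ∈ (extChartAt (𝓡 m) x₀).target) :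
    ‖velocity m (fun s ↦ (extChartAt (𝓡 m) x₀).symm (c s)) t‖ ^ 2 = metricForm x₀ (c t) v v := by
  have h : HasDerivAt (fun s ↦ extChartAt (𝓡 m) x₀ ((extChartAt (𝓡 m) x₀).symm (c s))) v t := by
    refine hc.congr_of_eventuallyEq ?_
    filter_upwards [hc.continuousAt.preimage_mem_nhds ((isOpen_target x₀).mem_nhds ht)] with s hs
    exact (extChartAt (𝓡 m) x₀).right_inv hs
  rw [norm_velocity_sq (mdifferentiableAt_symm_comp hc ht) ((extChartAt (𝓡 m) x₀).map_target ht) h,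
    (extChartAt (𝓡 m) x₀).right_inv ht]

theorem continuous_norm_velocity {γ : ℝ → M} (hγ : ContMDiff 𝓘(ℝ, ℝ) (𝓡 m) 1 γ) :
    Continuous fun t ↦ ‖velocity m γ t‖ := by
  have h1 : ContMDiff 𝓘(ℝ, ℝ).tangent (𝓡 m).tangent 0 (tangentMap 𝓘(ℝ, ℝ) (𝓡 m) γ) :=
    hγ.contMDiff_tangentMap (by simp)
  have h3 : ContMDiff 𝓘(ℝ, ℝ) 𝓘(ℝ, ℝ).tangent 0
      (fun t : ℝ ↦ (⟨t, (1 : ℝ)⟩ : TangentBundle 𝓘(ℝ, ℝ) ℝ)) :=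
    contMDiff_vectorSpace_iff_contDiff.2 contDiff_const
  have h4 : Continuous (fun t ↦ (⟨γ t, velocity m γ t⟩ :
      TotalSpace (Model m) (fun x : M ↦ Tan m x))) := (h1.comp h3).continuous
  have h5 := Continuous.inner_bundle h4 h4
  refine (Real.continuous_sqrt.comp h5).congr fun t ↦ ?_
  simp [Function.comp]

theorem rdist_nonneg (x y : M) : 0 ≤ rdist m x y := ENNReal.toReal_nonneg

theorem rdist_self (x : M) : rdist m x x = 0 := by
  rw [rdist, Manifold.riemannianEDist_self]; rfl

theorem rdist_comm (x y : M) : rdist m x y = rdist m y x := by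
  rw [rdist, Manifold.riemannianEDist_comm]; rfl

section Connected

variable [ConnectedSpace M]

/-- The points at finite distance from x form a clopen set. Hence `rdist` loses nothing by
truncating to a real number. -/
theorem riemannianEDist_ne_top (x y : M) : Manifold.riemannianEDist (𝓡 m) x y ≠ ⊤ := by
  have hopen : ∀ z : M, ∀ᶠ w in 𝓝 z, Manifold.riemannianEDist (𝓡 m) z w < ⊤ := fun z ↦
    eventually_riemannianEDist_lt (𝓡 m) z ENNReal.zero_lt_top
  have hcl : IsClopen {z | Manifold.riemannianEDist (𝓡 m) x z < ⊤} := by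
    refine ⟨⟨isOpen_iff_mem_nhds.2 fun z hz ↦ ?_⟩, isOpen_iff_mem_nhds.2 fun z hz ↦ ?_⟩
    · filter_upwards [hopen z] with w hw hw'
      refine hz ?_
      refine (Manifold.riemannianEDist_triangle (y := w)).trans_lt (ENNReal.add_lt_top.2 ⟨hw', ?_⟩)
      rwa [Manifold.riemannianEDist_comm]
    · filter_upwards [hopen z] with w hw
      exact (Manifold.riemannianEDist_triangle (y := z)).trans_lt (ENNReal.add_lt_top.2 ⟨hz, hw⟩)
  have := hcl.eq_univ ⟨x, by simp [Manifold.riemannianEDist_self]⟩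
  exact (this.symm ▸ mem_univ y : y ∈ {z | Manifold.riemannianEDist (𝓡 m) x z < ⊤}).ne

theorem rdist_triangle (x y z : M) : rdist m x z ≤ rdist m x y + rdist m y z := by
  rw [rdist, rdist, rdist, ← ENNReal.toReal_add (riemannianEDist_ne_top _ _)
    (riemannianEDist_ne_top _ _)]
  exact ENNReal.toReal_mono (by simp [riemannianEDist_ne_top]) Manifold.riemannianEDist_triangle

theorem eventually_rdist_lt (x : M) {c : ℝ} (hc : 0 < c) : ∀ᶠ y in 𝓝 x, rdist m x y < c := by
  filter_upwards [eventually_riemannianEDist_lt (𝓡 m) x (ENNReal.ofReal_pos.2 hc)] with y hy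
  rwa [rdist, ← ENNReal.lt_ofReal_iff_toReal_lt (riemannianEDist_ne_top _ _)]

/-- Together with `eventually_rdist_lt`, this says that the distance induces the topology of the
manifold. -/
theorem exists_rdist_lt_subset [RegularSpace M] {x : M} {s : Set M} (hs : s ∈ 𝓝 x) :
    ∃ c > 0, {y | rdist m x y < c} ⊆ s := by
  obtain ⟨c, hc, hcs⟩ := setOfPred_riemannianEDist_lt_subset_nhds (𝓡 m) hs
  refine ⟨c, hc, fun y hy ↦ hcs ?_⟩
  have : Manifold.riemannianEDist (𝓡 m) x y < ENNReal.ofReal c :=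
    (ENNReal.lt_ofReal_iff_toReal_lt (riemannianEDist_ne_top _ _)).2 hy
  simpa using this

theorem abs_rdist_sub_le (x y z : M) : |rdist m x y - rdist m x z| ≤ rdist m y z := by
  have h1 := rdist_triangle (m := m) x y z
  have h2 := rdist_triangle (m := m) x z y
  rw [rdist_comm z y] at h2
  rw [abs_le]
  constructor <;> linarith

theorem continuous_of_abs_sub_le_rdist {f : M → ℝ} {C : ℝ}
    (hf : ∀ y z, |f y - f z| ≤ C * rdist m y z) : Continuous f := by
  rw [continuous_iff_continuousAt]
  intro x
  rw [ContinuousAt, Metric.tendsto_nhds]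
  intro ε hε
  filter_upwards [eventually_rdist_lt (m := m) x (show 0 < ε / (|C| + 1) by positivity)] with y hy
  rw [dist_comm, Real.dist_eq]
  refine (hf x y).trans_lt ?_
  rw [lt_div_iff₀ (by positivity)] at hy
  have := rdist_nonneg (m := m) x y
  nlinarith [le_abs_self C]

theorem continuous_rdist (x : M) : Continuous (rdist m x) :=
  continuous_of_abs_sub_le_rdist (C := 1) fun y z ↦ by simpa using abs_rdist_sub_le x y z

theorem rdist_le_of_norm_velocity_le {γ : ℝ → M} {a b L : ℝ} (hab : a ≤ b) (hL : 0 ≤ L)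
    (hγ : ContMDiffOn 𝓘(ℝ, ℝ) (𝓡 m) 1 γ (Icc a b))
    (h : ∀ t ∈ Ioo a b, ‖velocity m γ t‖ ≤ L) : rdist m (γ a) (γ b) ≤ L * (b - a) := by
  have h1 := Manifold.riemannianEDist_le_pathELength hγ rfl rfl hab
  have h2 : Manifold.pathELength (𝓡 m) γ a b ≤ ENNReal.ofReal (L * (b - a)) := by
    rw [Manifold.pathELength_eq_lintegral_mfderiv_Ioo]
    calc ∫⁻ t in Ioo a b, ‖mfderiv 𝓘(ℝ, ℝ) (𝓡 m) γ t 1‖ₑ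
        ≤ ∫⁻ _ in Ioo a b, ENNReal.ofReal L := by
          refine setLIntegral_mono' measurableSet_Ioo fun t ht ↦ ?_
          rw [← ofReal_norm]
          exact ENNReal.ofReal_le_ofReal (h t ht)
      _ = ENNReal.ofReal (L * (b - a)) := by
          simp [ENNReal.ofReal_mul hL]
  exact ENNReal.toReal_le_of_le_ofReal (by nlinarith) (h1.trans h2)

theorem rdist_symm_le {x₀ : M} {c c' : ℝ → Model m} {a b L : ℝ} (hab : a ≤ b) (hL : 0 ≤ L)
    (hc : ∀ t ∈ Icc a b, HasDerivAt c (c' t) t) (hc' : ContinuousOn c' (Icc a b))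
    (ht : MapsTo c (Icc a b) (extChartAt (𝓡 m) x₀).target)
    (h : ∀ t ∈ Icc a b, metricForm x₀ (c t) (c' t) (c' t) ≤ L ^ 2) :
    rdist m ((extChartAt (𝓡 m) x₀).symm (c a)) ((extChartAt (𝓡 m) x₀).symm (c b))
      ≤ L * (b - a) := by
  rcases hab.eq_or_lt with rfl | hab'
  · simp [rdist_self]
  refine rdist_le_of_norm_velocity_le (γ := fun s ↦ (extChartAt (𝓡 m) x₀).symm (c s)) hab hL ?_ ?_
  · have hcd : ContDiffOn ℝ 1 c (Icc a b) := by
      rw [show (1 : ℕ∞ω) = 0 + 1 by simp, contDiffOn_succ_iff_derivWithin (uniqueDiffOn_Icc hab')]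
      refine ⟨fun t ht ↦ (hc t ht).differentiableAt.differentiableWithinAt, by simp, ?_⟩
      rw [contDiffOn_zero]
      exact hc'.congr fun t ht ↦
        (hc t ht).hasDerivWithinAt.derivWithin (uniqueDiffOn_Icc hab' t ht)
    exact (contMDiffOn_extChartAt_symm x₀).comp hcd.contMDiffOn ht
  · intro t ht'
    have ht'' := Ioo_subset_Icc_self ht'
    have := h t ht''
    rw [← norm_velocity_symm_comp_sq (hc t ht'') (ht ht'')] at this
    exact abs_le_of_sq_le_sq' this hL |>.2

end Connected

end Distance

/-! ### Curves of nearly minimal length, and minimising geodesics near a point. -/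

noncomputable section Minimizing

/-- A primitive of a continuous function which is bounded below by a positive constant has a `C^1`
inverse. -/
theorem exists_inverse_primitive {k : ℝ → ℝ} (hk : Continuous k) {δ : ℝ} (hδ : 0 < δ)
    (hkδ : ∀ t, δ ≤ k t) :
    ∃ ψ : ℝ → ℝ, ψ 0 = 0 ∧ ψ (∫ t in (0 : ℝ)..1, k t) = 1 ∧ StrictMono ψ ∧ ContDiff ℝ 1 ψ ∧
      ∀ s, HasDerivAt ψ (k (ψ s))⁻¹ s := by
  set S : ℝ → ℝ := fun t ↦ ∫ s in (0 : ℝ)..t, k s with hS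
  have dS : ∀ t, HasDerivAt S (k t) t := fun t ↦
    intervalIntegral.integral_hasDerivAt_right (hk.intervalIntegrable _ _)
      hk.aestronglyMeasurable.stronglyMeasurableAtFilter hk.continuousAt
  have S0 : S 0 = 0 := by simp [hS]
  have mono : StrictMono S := strictMono_of_hasDerivAt_pos dS fun t ↦ hδ.trans_le (hkδ t)
  have hmono2 : Monotone fun t ↦ S t - δ * t := by
    refine monotone_of_hasDerivAt_nonneg (f' := fun t ↦ k t - δ) (fun t ↦ ?_) fun t ↦ ?_
    · exact ((dS t).sub ((hasDerivAt_id t).const_mul δ)).congr_deriv (by simp)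
    · exact sub_nonneg.2 (hkδ t)
  have cS : Continuous S := continuous_iff_continuousAt.2 fun t ↦ (dS t).continuousAt
  have top : Tendsto S atTop atTop := by
    refine tendsto_atTop_mono' _ ?_ (tendsto_id.const_mul_atTop hδ)
    filter_upwards [eventually_ge_atTop 0] with t ht
    have := hmono2 ht
    simp [S0] at this
    exact this
  have bot : Tendsto S atBot atBot := by
    refine tendsto_atBot_mono' _ ?_ (tendsto_id.const_mul_atBot hδ)
    filter_upwards [eventually_le_atBot 0] with t ht
    have := hmono2 ht
    simp [S0] at this
    exact this
  let e := mono.orderIsoOfSurjective S (cS.surjective top bot)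
  have he : ∀ t, e t = S t := fun _ ↦ rfl
  have hes : ∀ s, S (e.symm s) = s := fun s ↦ e.apply_symm_apply s
  have dψ : ∀ s, HasDerivAt e.symm (k (e.symm s))⁻¹ s := fun s ↦
    (dS (e.symm s)).of_local_left_inverse e.symm.continuous.continuousAt
      (hδ.trans_le (hkδ _)).ne' (Eventually.of_forall hes)
  refine ⟨e.symm, ?_, ?_, e.symm.strictMono, ?_, dψ⟩
  · have := e.symm_apply_apply 0
    rwa [he, S0] at this
  · exact e.symm_apply_apply 1
  · rw [contDiff_one_iff_deriv]
    refine ⟨fun s ↦ (dψ s).differentiableAt, ?_⟩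
    rw [funext fun s ↦ (dψ s).deriv]
    exact (hk.comp e.symm.continuous).inv₀ fun s ↦ (hδ.trans_le (hkδ _)).ne'

variable {m : ℕ} {M : Type*} [TopologicalSpace M] [ChartedSpace (Model m) M]
  [IsManifold (𝓡 m) ∞ M] [RiemannianBundle (fun x : M ↦ Tan m x)]
  [IsContMDiffRiemannianBundle (𝓡 m) ∞ (Model m) (fun x : M ↦ Tan m x)]

theorem velocity_comp {γ : ℝ → M} {ψ : ℝ → ℝ} {a t : ℝ}
    (hγ : MDifferentiableAt 𝓘(ℝ, ℝ) (𝓡 m) γ (ψ t)) (hψ : HasDerivAt ψ a t) :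
    velocity m (fun s ↦ γ (ψ s)) t = a • velocity m γ (ψ t) := by
  have h := (hγ.hasMFDerivAt.comp t hψ.hasFDerivAt.hasMFDerivAt).mfderiv
  let D : ℝ →L[ℝ] Tan m (γ (ψ t)) := mfderiv 𝓘(ℝ, ℝ) (𝓡 m) γ (ψ t)
  have h2 : velocity m (fun s ↦ γ (ψ s)) t = D.comp (ContinuousLinearMap.toSpanSingleton ℝ a) 1 :=
    congr($h (1 : ℝ))
  have h3 : velocity m γ (ψ t) = D 1 := rfl
  rw [h2, h3, ← map_smul]
  simp

theorem lintegral_enorm_velocity {γ : ℝ → M} (hγ : ContMDiff 𝓘(ℝ, ℝ) (𝓡 m) 1 γ) :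
    Manifold.pathELength (𝓡 m) γ 0 1
      = ENNReal.ofReal (∫ t in (0 : ℝ)..1, ‖velocity m γ t‖) := by
  have hc := continuous_norm_velocity hγ
  rw [Manifold.pathELength_eq_lintegral_mfderiv_Icc, intervalIntegral.integral_of_le zero_le_one,
    ← integral_Icc_eq_integral_Ioc, ofReal_integral_eq_lintegral_ofReal]
  · refine lintegral_congr fun t ↦ ?_
    rw [ofReal_norm]
    rfl
  · exact hc.continuousOn.integrableOn_Icc
  · exact Eventually.of_forall fun _ ↦ norm_nonneg _

/-- Points at distance less than `r` are joined by a `C^1` curve of speed at most `r`. -/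
theorem exists_curve_norm_velocity_le [ConnectedSpace M] {x y : M} {r : ℝ} (h : rdist m x y < r) :
    ∃ σ : ℝ → M, σ 0 = x ∧ σ 1 = y ∧ ContMDiff 𝓘(ℝ, ℝ) (𝓡 m) 1 σ ∧
      ∀ t, ‖velocity m σ t‖ ≤ r := by
  have h' : Manifold.riemannianEDist (𝓡 m) x y < ENNReal.ofReal r :=
    (ENNReal.lt_ofReal_iff_toReal_lt (riemannianEDist_ne_top _ _)).2 h
  obtain ⟨γ, hγ0, hγ1, hγ, hγr, -⟩ :=
    Manifold.exists_lt_locally_constant_of_riemannianEDist_lt h' zero_lt_one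
  have hc := continuous_norm_velocity hγ
  rw [lintegral_enorm_velocity hγ,
    ENNReal.ofReal_lt_ofReal_iff ((rdist_nonneg x y).trans_lt h)] at hγr
  set I := ∫ t in (0 : ℝ)..1, ‖velocity m γ t‖ with hI
  -- Reparametrisation by arc length, with the slack r - I > 0 added to the speed: the primitive is
  -- then invertible even where γ stops, and its total over the unit interval is exactly r.
  obtain ⟨ψ, hψ0, hψ1, -, hψ, dψ⟩ := exists_inverse_primitive
    (k := fun t ↦ ‖velocity m γ t‖ + (r - I)) (hc.add continuous_const)
    (sub_pos.2 hγr) (fun t ↦ le_add_of_nonneg_left (norm_nonneg (velocity m γ t)))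
  have hr : ∫ t in (0 : ℝ)..1, (‖velocity m γ t‖ + (r - I)) = r := by
    rw [intervalIntegral.integral_add (hc.intervalIntegrable _ _) (by simp), ← hI]
    simp
  rw [hr] at hψ1
  have hr0 : 0 < r := (rdist_nonneg x y).trans_lt h
  have dψr : ∀ t, HasDerivAt (fun t ↦ ψ (r * t)) (r * (‖velocity m γ (ψ (r * t))‖ + (r - I))⁻¹) t :=
    fun t ↦ by
      have := (dψ (r * t)).comp t ((hasDerivAt_id t).const_mul r)
      exact this.congr_deriv (by simp; ring)
  refine ⟨fun t ↦ γ (ψ (r * t)), by simp [hψ0, hγ0], by simp [hψ1, hγ1], ?_, fun t ↦ ?_⟩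
  · exact hγ.comp (hψ.comp (contDiff_const.mul contDiff_id)).contMDiff
  · rw [velocity_comp (ψ := fun t ↦ ψ (r * t)) (hγ.mdifferentiable (by simp) _) (dψr t), norm_smul,
      Real.norm_of_nonneg, mul_assoc, inv_mul_eq_div]
    · refine mul_le_of_le_one_right hr0.le (div_le_one_of_le₀ ?_ ?_)
      · linarith
      · have := norm_nonneg (velocity m γ (ψ (r * t))); linarith
    · have := norm_nonneg (velocity m γ (ψ (r * t)))
      have : 0 < ‖velocity m γ (ψ (r * t))‖ + (r - I) := by linarith
      positivity

variable [ConnectedSpace M]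

/-- Near `p`, every point is joined to `p` by a geodesic whose speed is at most the distance. -/
theorem exists_minimizing_solution [RegularSpace M] (p : M) :
    ∃ r > 0, ∀ z, rdist m p z < r → z ∈ (extChartAt (𝓡 m) p).source ∧
      ∃ c c' : ℝ → Model m, c 0 = extChartAt (𝓡 m) p p ∧ c 1 = extChartAt (𝓡 m) p z ∧
        (∀ t ∈ Icc (-1 : ℝ) 1, SolvesAt (christoffelForm p) c c' t ∧
          c t ∈ (extChartAt (𝓡 m) p).target) ∧
        metricForm p (c 0) (c' 0) (c' 0) ≤ rdist m p z ^ 2 := by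
  set φ := extChartAt (𝓡 m) p with hφ
  have hp : φ p ∈ φ.target := mem_extChartAt_target p
  obtain ⟨R, hR, K, hK, hRU, hmin⟩ := (localMetric p).exists_energy_le hp
  obtain ⟨r₀, hr₀, hsol⟩ := (localMetric p).exists_solution_to hp hR hK
  have hs : φ.source ∩ φ ⁻¹' closedBall (φ p) (min R r₀) ∈ 𝓝 p :=
    inter_mem (extChartAt_source_mem_nhds p)
      ((continuousAt_extChartAt p).preimage_mem_nhds (closedBall_mem_nhds _ (lt_min hR hr₀)))
  -- A curve from p of length less than r cannot leave the chart ball on which energy minimality is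
  -- available.
  obtain ⟨r, hr, hrs⟩ := exists_rdist_lt_subset (m := m) hs
  refine ⟨r, hr, fun z hz ↦ ⟨(hrs hz).1, ?_⟩⟩
  obtain ⟨c, c', hc0, hc1, hc⟩ := hsol (φ z)
    (closedBall_subset_closedBall (min_le_right _ _) (hrs hz).2)
  refine ⟨c, c', hc0, hc1, fun t ht ↦ ⟨(hc t ht).1, hRU (hc t ht).2.1⟩, ?_⟩
  have hsub : Icc (0 : ℝ) 1 ⊆ Icc (-1) 1 := Icc_subset_Icc_left (by norm_num)
  -- Compare the geodesic with a curve of speed at most d, whose energy is at most d²; d then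
  -- decreases to the distance.
  have key : ∀ d, rdist m p z < d → d < r → metricForm p (c 0) (c' 0) (c' 0) ≤ d ^ 2 := by
    intro d hd hdr
    obtain ⟨σ, hσ0, hσ1, hσ, hσd⟩ := exists_curve_norm_velocity_le hd
    have hd0 : 0 ≤ d := (rdist_nonneg _ _).trans hd.le
    have hσs : ∀ t ∈ Icc (0 : ℝ) 1, σ t ∈ φ.source ∩ φ ⁻¹' closedBall (φ p) (min R r₀) := by
      intro t ht
      refine hrs ?_
      have := rdist_le_of_norm_velocity_le (m := m) ht.1 hd0 hσ.contMDiffOn fun t _ ↦ hσd t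
      rw [hσ0, sub_zero] at this
      refine this.trans_lt (lt_of_le_of_lt ?_ hdr)
      exact mul_le_of_le_one_right hd0 ht.2
    have hdiff : ∀ t, MDifferentiableAt 𝓘(ℝ, ℝ) (𝓡 m) σ t := hσ.mdifferentiable (by simp)
    have hder : ∀ t ∈ Icc (0 : ℝ) 1, HasDerivAt (fun s ↦ φ (σ s)) (deriv (fun s ↦ φ (σ s)) t) t :=
      fun t ht ↦ (hasDerivAt_chart_comp (hdiff t) (hσs t ht).1).differentiableAt.hasDerivAt
    have hcont : ContinuousOn (deriv (fun s ↦ φ (σ s))) (Icc 0 1) := by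
      have hopen : IsOpen (σ ⁻¹' φ.source) := (isOpen_extChartAt_source p).preimage hσ.continuous
      have h1 : ContMDiffOn 𝓘(ℝ, ℝ) 𝓘(ℝ, Model m) 1 (fun s ↦ φ (σ s)) (σ ⁻¹' φ.source) :=
        (contMDiffOn_extChartAt (n := 1)).comp hσ.contMDiffOn
          fun s hs ↦ by simpa [hφ] using hs
      exact ((contMDiffOn_iff_contDiffOn.1 h1).continuousOn_deriv_of_isOpen hopen
        (by simp)).mono fun t ht ↦ (hσs t ht).1
    have e := hmin c c' (fun s ↦ φ (σ s)) (deriv fun s ↦ φ (σ s)) (fun t ht ↦ (hc t (hsub ht)).1)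
      (fun t ht ↦ (hc t (hsub ht)).2.1) (fun t ht ↦ (hc t (hsub ht)).2.2) hder hcont
      (fun t ht ↦ closedBall_subset_closedBall (min_le_left _ _) (hσs t ht).2)
      (by rw [hc0, hσ0]) (by rw [hc1, hσ1])
    refine e.trans ?_
    have hσt : MapsTo (fun s ↦ φ (σ s)) (Icc 0 1) φ.target := fun t ht ↦ φ.map_source (hσs t ht).1
    have := intervalIntegral.integral_mono_on zero_le_one
      (((localMetric p).continuousOn_apply (HasDerivAt.continuousOn hder) hσt hcont
        hcont).intervalIntegrable_of_Icc zero_le_one)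
      (intervalIntegrable_const (c := d ^ 2) (μ := volume)) (fun t ht ↦ ?_)
    · simpa using this
    · rw [← norm_velocity_sq (hdiff t) (hσs t ht).1 (hder t ht)]
      gcongr
      exact hσd t
  have lim : Tendsto (fun d : ℝ ↦ d ^ 2) (𝓝[>] (rdist m p z)) (𝓝 (rdist m p z ^ 2)) :=
    ((continuous_pow 2).tendsto _).mono_left nhdsWithin_le_nhds
  refine ge_of_tendsto lim ?_
  filter_upwards [Ioo_mem_nhdsGT hz] with d hd using key d hd.1 hd.2

/-- Infinitesimally, the distance is bounded by the norm of the metric in a chart. -/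
theorem eventually_rdist_symm_le {x₀ : M} {y₀ : Model m} (hy₀ : y₀ ∈ (extChartAt (𝓡 m) x₀).target)
    {ε : ℝ} (hε : 0 < ε) :
    ∃ r > 0, ∀ y ∈ ball y₀ r, ∀ z ∈ ball y₀ r,
      rdist m ((extChartAt (𝓡 m) x₀).symm y) ((extChartAt (𝓡 m) x₀).symm z)
        ≤ (1 + ε) * √(metricForm x₀ y₀ (z - y) (z - y)) := by
  obtain ⟨l, hl, hlG⟩ := exists_forall_mul_norm_sq_le (metricForm x₀ y₀) fun v hv ↦
    metricForm_pos hy₀ hv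
  have hc : ContinuousAt (metricForm x₀) y₀ :=
    ((contDiffOn_metricForm x₀).contDiffAt ((isOpen_target x₀).mem_nhds hy₀)).continuousAt
  -- By coercivity, a perturbation of norm below l ε changes the form by a factor of at most 1 + ε ≤
  -- (1 + ε)². The comparison curve is the straight segment.
  have hev : ∀ᶠ w in 𝓝 y₀, ‖metricForm x₀ w - metricForm x₀ y₀‖ < l * ε := by
    have : Tendsto (fun y ↦ ‖metricForm x₀ y - metricForm x₀ y₀‖) (𝓝 y₀) (𝓝 0) := by
      simpa using (hc.sub (continuousAt_const (y := metricForm x₀ y₀))).norm.tendsto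
    exact this.eventually (gt_mem_nhds (by positivity))
  obtain ⟨r, hr, hrs⟩ := Metric.mem_nhds_iff.1
    (inter_mem hev ((isOpen_target x₀).mem_nhds hy₀))
  refine ⟨r, hr, fun y hy z hz ↦ ?_⟩
  set v := z - y with hv
  have hnn : 0 ≤ metricForm x₀ y₀ v v := (localMetric x₀).nonneg hy₀ v
  have hseg : ∀ t ∈ Icc (0 : ℝ) 1, y + t • v ∈ ball y₀ r := fun t ht ↦
    (convex_ball y₀ r).add_smul_sub_mem hy hz ht
  have := rdist_symm_le (x₀ := x₀) (c := fun t : ℝ ↦ y + t • v) (c' := fun _ ↦ v)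
    (L := (1 + ε) * √(metricForm x₀ y₀ v v)) zero_le_one (by positivity)
    (fun t _ ↦ by simpa using ((hasDerivAt_id t).smul_const v).const_add y)
    continuousOn_const (fun t ht ↦ (hrs (hseg t ht)).2) (fun t ht ↦ ?_)
  · simpa [hv] using this
  · have h1 := (metricForm x₀ (y + t • v) - metricForm x₀ y₀).le_opNorm₂ v v
    have h2 : ‖metricForm x₀ (y + t • v) - metricForm x₀ y₀‖ * ‖v‖ * ‖v‖ ≤ l * ε * ‖v‖ * ‖v‖ := by
      gcongr
      exact (hrs (hseg t ht)).1.le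
    have h3 := (abs_le.1 (h1.trans h2)).2
    simp only [sub_apply] at h3
    rw [mul_pow, Real.sq_sqrt hnn]
    nlinarith [hlG v, mul_nonneg hε.le hnn, mul_nonneg (sq_nonneg ε) hnn]

end Minimizing

/-! ### The Hopf-Rinow theorem: closed balls of a complete manifold are compact. -/

noncomputable section HopfRinow

variable {m : ℕ} {M : Type*} [TopologicalSpace M] [ChartedSpace (Model m) M]
  [IsManifold (𝓡 m) ∞ M] [RiemannianBundle (fun x : M ↦ Tan m x)]
  [IsContMDiffRiemannianBundle (𝓡 m) ∞ (Model m) (fun x : M ↦ Tan m x)]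

theorem hasDerivAt_euclidean_apply {c : ℝ → Model m} {v : Model m} {t : ℝ} (h : HasDerivAt c v t)
    (i : Fin m) : HasDerivAt (fun s ↦ c s i) (v i) t :=
  (EuclideanSpace.proj (𝕜 := ℝ) i).hasFDerivAt.comp_hasDerivAt t h

theorem IsGeodesic.solvesAt {γ : ℝ → M} (hγ : IsGeodesic m γ) {x₀ : M} {t : ℝ}
    (ht : γ t ∈ (extChartAt (𝓡 m) x₀).source) :
    SolvesAt (christoffelForm x₀) (fun s ↦ extChartAt (𝓡 m) x₀ (γ s))
      (deriv fun s ↦ extChartAt (𝓡 m) x₀ (γ s)) t := by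
  set φ := extChartAt (𝓡 m) x₀ with hφ
  have hopen : IsOpen (γ ⁻¹' φ.source) :=
    (isOpen_extChartAt_source x₀).preimage hγ.1.continuous
  have h1 : ContMDiffOn 𝓘(ℝ, ℝ) 𝓘(ℝ, Model m) ∞ (fun s ↦ φ (γ s)) (γ ⁻¹' φ.source) :=
    (contMDiffOn_extChartAt (n := ∞)).comp hγ.1.contMDiffOn fun s hs ↦ by simpa [hφ] using hs
  have h2 : ContDiffOn ℝ 2 (fun s ↦ φ (γ s)) (γ ⁻¹' φ.source) :=
    contDiffOn_infty.1 (contMDiffOn_iff_contDiffOn.1 h1) 2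
  have hd : ∀ s ∈ γ ⁻¹' φ.source, HasDerivAt (fun s ↦ φ (γ s)) (deriv (fun s ↦ φ (γ s)) s) s :=
    fun s hs ↦ ((h2.differentiableOn (by simp)).differentiableAt (hopen.mem_nhds hs)).hasDerivAt
  have hd2 : ∀ s ∈ γ ⁻¹' φ.source,
      HasDerivAt (deriv fun s ↦ φ (γ s)) (deriv (deriv fun s ↦ φ (γ s)) s) s := fun s hs ↦
    (((h2.deriv_of_isOpen hopen (m := 1) (by norm_num)).differentiableOn
      (by simp)).differentiableAt (hopen.mem_nhds hs)).hasDerivAt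
  have hcomp : ∀ s ∈ γ ⁻¹' φ.source, ∀ i,
      deriv (fun s ↦ φ (γ s) i) s = deriv (fun s ↦ φ (γ s)) s i := fun s hs i ↦
    (hasDerivAt_euclidean_apply (hd s hs) i).deriv
  refine ⟨hd t ht, (hd2 t ht).congr_deriv ?_⟩
  ext k
  have h := hγ.2 x₀ t ht k
  have h3 : deriv (deriv fun s ↦ φ (γ s) k) t = deriv (deriv fun s ↦ φ (γ s)) t k := by
    rw [← (hasDerivAt_euclidean_apply (hd2 t ht) k).deriv]
    refine EventuallyEq.deriv_eq ?_
    filter_upwards [hopen.mem_nhds ht] with s hs using hcomp s hs k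
  rw [← hφ, h3] at h
  simp only [hcomp t ht] at h
  rw [PiLp.neg_apply, christoffelForm_apply]
  linarith

theorem IsGeodesic.norm_velocity_eq {γ : ℝ → M} (hγ : IsGeodesic m γ) (s t : ℝ) :
    ‖velocity m γ s‖ = ‖velocity m γ t‖ := by
  have hdiff : ∀ t, MDifferentiableAt 𝓘(ℝ, ℝ) (𝓡 m) γ t := hγ.1.mdifferentiable (by simp)
  have key : ∀ t, HasDerivAt (fun s ↦ ‖velocity m γ s‖ ^ 2) 0 t := by
    intro t
    have ht := mem_extChartAt_source (I := 𝓡 m) (γ t)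
    refine ((localMetric (γ t)).hasDerivAt_speed (hγ.solvesAt ht)
      ((extChartAt (𝓡 m) (γ t)).map_source ht)).congr_of_eventuallyEq ?_
    filter_upwards [hγ.1.continuous.continuousAt.preimage_mem_nhds
      ((isOpen_extChartAt_source (γ t)).mem_nhds ht)] with s hs
    exact norm_velocity_sq (hdiff s) hs (hγ.solvesAt hs).1
  have := is_const_of_deriv_eq_zero (fun t ↦ (key t).differentiableAt) (fun t ↦ (key t).deriv) s t
  exact (pow_left_inj₀ (norm_nonneg _) (norm_nonneg _) two_ne_zero).1 this

variable [ConnectedSpace M]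

/-- A nearly minimising curve from x to q crosses the sphere of radius δ by the intermediate value
theorem, and its remaining part is short. -/
theorem exists_rdist_eq_and_le {x q : M} {δ ε : ℝ} (hδ : 0 ≤ δ) (hq : δ ≤ rdist m x q)
    (hε : 0 < ε) : ∃ z, rdist m x z = δ ∧ rdist m z q ≤ rdist m x q - δ + ε := by
  obtain ⟨σ, h0, h1, hσ, hv⟩ := exists_curve_norm_velocity_le (show rdist m x q < rdist m x q + ε by
    linarith)
  have hr : 0 ≤ rdist m x q + ε := by linarith
  have hc : Continuous fun t ↦ rdist m x (σ t) := (continuous_rdist x).comp hσ.continuous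
  obtain ⟨t, ht, hz⟩ := intermediate_value_Icc zero_le_one hc.continuousOn
    (show δ ∈ Icc (rdist m x (σ 0)) (rdist m x (σ 1)) by rw [h0, h1, rdist_self]; exact ⟨hδ, hq⟩)
  refine ⟨σ t, hz, ?_⟩
  have e1 := rdist_le_of_norm_velocity_le ht.1 hr hσ.contMDiffOn fun t _ ↦ hv t
  have e2 := rdist_le_of_norm_velocity_le ht.2 hr hσ.contMDiffOn fun t _ ↦ hv t
  rw [h0] at e1
  rw [h1] at e2
  simp only at hz
  linarith

variable [T2Space M] [LocallyCompactSpace M]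

/-- Small balls lie in a compact neighbourhood of y, and spheres are closed. -/
theorem exists_isCompact_sphere (y : M) : ∃ c > 0, ∀ δ < c, IsCompact {z | rdist m y z = δ} := by
  obtain ⟨K, hK, hy⟩ := exists_compact_mem_nhds y
  obtain ⟨c, hc, hcK⟩ := exists_rdist_lt_subset (m := m) hy
  refine ⟨c, hc, fun δ hδ ↦ hK.of_isClosed_subset
    (isClosed_singleton.preimage (continuous_rdist y)) fun z hz ↦ hcK ?_⟩
  rw [mem_ofPred_eq] at hz ⊢
  linarith

/-- On a compact sphere the distance to q attains its minimum, which removes the ε of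
`exists_rdist_eq_and_le`. -/
theorem exists_rdist_eq_of_isCompact {x q : M} {δ : ℝ} (hδ : 0 ≤ δ) (hq : δ ≤ rdist m x q)
    (hS : IsCompact {z | rdist m x z = δ}) :
    ∃ z, rdist m x z = δ ∧ rdist m z q ≤ rdist m x q - δ := by
  obtain ⟨z₁, hz₁, -⟩ := exists_rdist_eq_and_le hδ hq zero_lt_one
  obtain ⟨z, hz, hmin⟩ := hS.exists_isMinOn ⟨z₁, hz₁⟩ (continuous_rdist (m := m) q).continuousOn
  refine ⟨z, hz, le_of_forall_pos_le_add fun ε hε ↦ ?_⟩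
  obtain ⟨w, hw, hw'⟩ := exists_rdist_eq_and_le hδ hq hε
  have := hmin hw
  simp only [mem_ofPred_eq] at this
  rw [rdist_comm z q]
  rw [rdist_comm w q] at hw'
  linarith

/-- The limit of the distances to the points of a bounded ultrafilter without limit. -/
theorem exists_busemann {𝒰 : Ultrafilter M} {x : M} {r : ℝ} (hr : ∀ᶠ q in 𝒰, rdist m x q ≤ r)
    (h𝒰 : ∀ y, ¬ (𝒰 : Filter M) ≤ 𝓝 y) :
    ∃ f : M → ℝ, (∀ y, 0 < f y) ∧ (∀ y z, |f y - f z| ≤ rdist m y z) ∧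
      ∀ y, ∃ c > 0, ∀ δ, 0 < δ → δ < c → ∃ z, rdist m y z = δ ∧ f z = f y - δ := by
  have hex : ∀ y, ∃ l, Tendsto (rdist m y) (𝒰 : Filter M) (𝓝 l) := by
    intro y
    have : ∀ᶠ q in 𝒰, rdist m y q ∈ Icc 0 (rdist m y x + r) := by
      filter_upwards [hr] with q hq
      exact ⟨rdist_nonneg _ _, (rdist_triangle y x q).trans (by linarith)⟩
    obtain ⟨l, -, hl⟩ := isCompact_Icc.ultrafilter_le_nhds (𝒰.map (rdist m y))
      (le_principal_iff.2 this)
    exact ⟨l, hl⟩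
  choose f hf using hex
  have hnn : ∀ y, 0 ≤ f y := fun y ↦
    ge_of_tendsto' (hf y) fun q ↦ rdist_nonneg y q
  have hlip : ∀ y z, f y ≤ f z + rdist m y z := fun y z ↦
    le_of_tendsto_of_tendsto' (hf y) ((hf z).add_const _) fun q ↦ by
      rw [add_comm]; exact rdist_triangle y z q
  -- If f y = 0, the ultrafilter would converge to y.
  refine ⟨f, fun y ↦ (hnn y).lt_of_ne' fun h0 ↦ h𝒰 y fun s hs ↦ ?_, fun y z ↦ ?_, fun y ↦ ?_⟩
  · obtain ⟨c, hc, hcs⟩ := exists_rdist_lt_subset (m := m) hs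
    have := (hf y).eventually (gt_mem_nhds (h0 ▸ hc))
    exact mem_of_superset this hcs
  · have h1 := hlip y z
    have h2 := hlip z y
    rw [rdist_comm z y] at h2
    rw [abs_le]
    constructor <;> linarith
  · have hy : 0 < f y := (hnn y).lt_of_ne' fun h0 ↦ h𝒰 y fun s hs ↦ by
      obtain ⟨c, hc, hcs⟩ := exists_rdist_lt_subset (m := m) hs
      exact mem_of_superset ((hf y).eventually (gt_mem_nhds (h0 ▸ hc))) hcs
    obtain ⟨c, hc, hS⟩ := exists_isCompact_sphere (m := m) y
    refine ⟨min c (f y), lt_min hc hy, fun δ hδ hδc ↦ ?_⟩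
    have hSδ := hS δ (hδc.trans_le (min_le_left _ _))
    -- For each q far enough from y choose a point of the sphere lying on the way to q. The default
    -- y for the other q is harmless, since the ultrafilter does not see them.
    have hex : ∀ q, ∃ z, δ ≤ rdist m y q → rdist m y z = δ ∧ rdist m z q ≤ rdist m y q - δ :=
      fun q ↦ by
        by_cases hq : δ ≤ rdist m y q
        · obtain ⟨z, hz⟩ := exists_rdist_eq_of_isCompact hδ.le hq hSδ
          exact ⟨z, fun _ ↦ hz⟩
        · exact ⟨y, fun h ↦ absurd h hq⟩
    choose g hg using hex
    have hev : ∀ᶠ q in 𝒰, δ ≤ rdist m y q :=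
      ((hf y).eventually (lt_mem_nhds (hδc.trans_le (min_le_right _ _)))).mono fun _ h ↦ le_of_lt h
    -- The limit of these points along the ultrafilter, in the compact sphere, is on the way to
    -- infinity.
    obtain ⟨z, hz, hlim⟩ := hSδ.ultrafilter_le_nhds (𝒰.map g)
      (le_principal_iff.2 (hev.mono fun q hq ↦ (hg q hq).1))
    refine ⟨z, hz, le_antisymm ?_ ?_⟩
    · have h1 : Tendsto (fun q ↦ rdist m z (g q)) (𝒰 : Filter M) (𝓝 0) := by
        have := ((continuous_rdist (m := m) z).tendsto z).comp
          (show Tendsto g (𝒰 : Filter M) (𝓝 z) from hlim)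
        rwa [rdist_self] at this
      have h2 := h1.add ((hf y).sub_const δ)
      rw [zero_add] at h2
      refine le_of_tendsto_of_tendsto (hf z) h2 ?_
      filter_upwards [hev] with q hq
      have := (hg q hq).2
      have := rdist_triangle (m := m) z (g q) q
      linarith
    · have := hlip y z
      have hz' : rdist m y z = δ := hz
      linarith

/-- From every point there is a geodesic along which `f` decreases at unit speed for a while. -/
theorem exists_solution_descending {f : M → ℝ} (hf : ∀ y z, |f y - f z| ≤ rdist m y z) {y : M}
    (hy : ∃ c > 0, ∀ δ, 0 < δ → δ < c → ∃ z, rdist m y z = δ ∧ f z = f y - δ) :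
    ∃ δ > 0, ∃ c c' : ℝ → Model m, c 0 = extChartAt (𝓡 m) y y ∧
      metricForm y (c 0) (c' 0) (c' 0) ≤ 1 ∧
      (∀ t ∈ Icc (-δ) δ, SolvesAt (christoffelForm y) c c' t) ∧
      ∀ t ∈ Icc 0 δ, f ((extChartAt (𝓡 m) y).symm (c t)) = f y - t := by
  obtain ⟨r, hr, hmin⟩ := exists_minimizing_solution (m := m) y
  obtain ⟨a, ha, hstep⟩ := hy
  obtain ⟨δ, hδ, hδ'⟩ := exists_between (lt_min hr ha)
  obtain ⟨z, hz, hfz⟩ := hstep δ hδ (hδ'.trans_le (min_le_right _ _))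
  obtain ⟨hzs, c, c', hc0, hc1, hc, hE⟩ := hmin z (hz ▸ hδ'.trans_le (min_le_left _ _))
  rw [hz] at hE
  have hI : ∀ t ∈ Icc (-δ) δ, δ⁻¹ * t ∈ Icc (-1 : ℝ) 1 := by
    intro t ht
    rw [inv_mul_eq_div, mem_Icc, le_div_iff₀ hδ, div_le_iff₀ hδ]
    constructor <;> linarith [ht.1, ht.2]
  have hsub : Icc 0 δ ⊆ Icc (-δ) δ := Icc_subset_Icc_left (by linarith)
  have hsol : ∀ t ∈ Icc (-δ) δ,
      SolvesAt (christoffelForm y) (fun s ↦ c (δ⁻¹ * s)) (fun s ↦ δ⁻¹ • c' (δ⁻¹ * s)) t :=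
    fun t ht ↦ (hc _ (hI t ht)).1.comp_mul
  have hmaps : MapsTo (fun s ↦ c (δ⁻¹ * s)) (Icc 0 δ) (extChartAt (𝓡 m) y).target :=
    fun t ht ↦ (hc _ (hI t (hsub ht))).2
  have hsp0 : metricForm y (c (δ⁻¹ * 0)) (δ⁻¹ • c' (δ⁻¹ * 0)) (δ⁻¹ • c' (δ⁻¹ * 0)) ≤ 1 := by
    simp only [mul_zero, map_smul, smul_apply, smul_eq_mul]
    calc δ⁻¹ * (δ⁻¹ * metricForm y (c 0) (c' 0) (c' 0)) ≤ δ⁻¹ * (δ⁻¹ * δ ^ 2) := by gcongr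
      _ = 1 := by field_simp
  have hsp : ∀ t ∈ Icc 0 δ, metricForm y (c (δ⁻¹ * t)) (δ⁻¹ • c' (δ⁻¹ * t)) (δ⁻¹ • c' (δ⁻¹ * t))
      ≤ 1 ^ 2 := by
    intro t ht
    have := (localMetric y).speed_eq (fun t ht ↦ hsol t (hsub ht)) hmaps ht
    rw [one_pow]
    exact this.trans_le hsp0
  -- The geodesic has speed at most 1.
  have hd : ∀ a b, 0 ≤ a → a ≤ b → b ≤ δ → rdist m ((extChartAt (𝓡 m) y).symm (c (δ⁻¹ * a)))
      ((extChartAt (𝓡 m) y).symm (c (δ⁻¹ * b))) ≤ b - a := by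
    intro a b ha hab hb
    have hs : Icc a b ⊆ Icc 0 δ := Icc_subset_Icc ha hb
    have := rdist_symm_le (x₀ := y) hab zero_le_one (fun t ht ↦ (hsol t (hsub (hs ht))).1)
      (fun t ht ↦ (hsol t (hsub (hs ht))).2.continuousAt.continuousWithinAt)
      (hmaps.mono_left hs) (fun t ht ↦ hsp t (hs ht))
    simpa using this
  refine ⟨δ, hδ, fun s ↦ c (δ⁻¹ * s), fun s ↦ δ⁻¹ • c' (δ⁻¹ * s), by simpa using hc0, hsp0, hsol,
    fun t ht ↦ ?_⟩
  -- f is 1-Lipschitz and drops by δ in total time δ, so it can lose neither more nor less than t up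
  -- to time t.
  have h1 := hd 0 t le_rfl ht.1 ht.2
  have h2 := hd t δ ht.1 ht.2 le_rfl
  rw [mul_zero, hc0, extChartAt_to_inv] at h1
  rw [inv_mul_cancel₀ hδ.ne', hc1, (extChartAt (𝓡 m) y).left_inv hzs] at h2
  have e1 := abs_le.1 ((hf _ _).trans h1)
  have e2 := abs_le.1 ((hf _ _).trans h2)
  dsimp only
  linarith [e1.1, e1.2, e2.1, e2.2]

theorem IsGeodesic.rdist_le {γ : ℝ → M} (hγ : IsGeodesic m γ) (h0 : ‖velocity m γ 0‖ ≤ 1) {a b : ℝ}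
    (hab : a ≤ b) : rdist m (γ a) (γ b) ≤ b - a := by
  have := rdist_le_of_norm_velocity_le (m := m) hab zero_le_one
    (hγ.1.of_le (by exact_mod_cast le_top)).contMDiffOn
    fun t _ ↦ (hγ.norm_velocity_eq t 0).trans_le h0
  simpa using this

/-- If two curves through a point form a minimizing curve of unit speed, then there is no corner. -/
theorem velocity_eq_of_le_rdist {x₀ : M} {y₀ : Model m}
    (hy₀ : y₀ ∈ (extChartAt (𝓡 m) x₀).target) {c d : ℝ → Model m} {v w : Model m}
    (hc : HasDerivAt c w 0) (hd : HasDerivAt d v 0) (hc0 : c 0 = y₀) (hd0 : d 0 = y₀)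
    (hv : metricForm x₀ y₀ v v ≤ 1) (hw : metricForm x₀ y₀ w w ≤ 1)
    (h : ∀ᶠ s in 𝓝[>] (0 : ℝ), 2 * s ≤ rdist m ((extChartAt (𝓡 m) x₀).symm (d (-s)))
      ((extChartAt (𝓡 m) x₀).symm (c s))) : v = w := by
  have hd' : HasDerivAt (fun s ↦ d (-s)) (-v) 0 := by
    have : HasDerivAt d v (-0) := by simpa using hd
    exact this.scomp (0 : ℝ) (hasDerivAt_neg 0) |>.congr_deriv (by simp)
  have hder : HasDerivAt (fun s ↦ c s - d (-s)) (w + v) 0 := by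
    exact (hc.sub hd').congr_deriv (by simp)
  have hslope : Tendsto (fun s : ℝ ↦ s⁻¹ • (c s - d (-s))) (𝓝[>] 0) (𝓝 (w + v)) := by
    have := (hasDerivAt_iff_tendsto_slope_zero.1 hder).mono_left
      (nhdsWithin_mono 0 (show Ioi (0 : ℝ) ⊆ {0}ᶜ from fun s hs ↦ (ne_of_gt hs)))
    simpa [hc0, hd0] using this
  -- The endpoints are at distance at least 2s, while in the chart they differ by s(w + v) to first
  -- order; dividing by s bounds the norm of w + v from below.
  have hbound : ∀ ε > 0, 2 ≤ (1 + ε) * √(metricForm x₀ y₀ (w + v) (w + v)) := by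
    intro ε hε
    obtain ⟨r, hr, hrd⟩ := eventually_rdist_symm_le hy₀ hε
    have hlim : Tendsto (fun s : ℝ ↦ (1 + ε) * √(metricForm x₀ y₀ (s⁻¹ • (c s - d (-s)))
        (s⁻¹ • (c s - d (-s))))) (𝓝[>] 0)
        (𝓝 ((1 + ε) * √(metricForm x₀ y₀ (w + v) (w + v)))) := by
      refine Tendsto.const_mul _ ((Real.continuous_sqrt.tendsto _).comp ?_)
      have hcont : Continuous fun z : Model m ↦ metricForm x₀ y₀ z z := by fun_prop
      exact (hcont.tendsto _).comp hslope
    refine ge_of_tendsto hlim ?_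
    have hcb : ∀ᶠ s in 𝓝[>] (0 : ℝ), c s ∈ ball y₀ r :=
      nhdsWithin_le_nhds (hc.continuousAt.preimage_mem_nhds (hc0 ▸ ball_mem_nhds _ hr))
    have hdb : ∀ᶠ s in 𝓝[>] (0 : ℝ), d (-s) ∈ ball y₀ r :=
      nhdsWithin_le_nhds (hd'.continuousAt.preimage_mem_nhds
        (by simpa [hd0] using ball_mem_nhds y₀ hr))
    filter_upwards [h, hcb, hdb, self_mem_nhdsWithin] with s h1 h2 h3 (hs : 0 < s)
    have h4 := h1.trans (hrd _ h3 _ h2)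
    have h5 : √(metricForm x₀ y₀ (s⁻¹ • (c s - d (-s))) (s⁻¹ • (c s - d (-s))))
        = s⁻¹ * √(metricForm x₀ y₀ (c s - d (-s)) (c s - d (-s))) := by
      rw [map_smul, map_smul, smul_apply, smul_eq_mul, smul_eq_mul, ← mul_assoc, ← sq,
        Real.sqrt_mul (sq_nonneg _), Real.sqrt_sq (by positivity)]
    rw [h5]
    calc (2 : ℝ) = s⁻¹ * (2 * s) := by field_simp
      _ ≤ s⁻¹ * ((1 + ε) * √(metricForm x₀ y₀ (c s - d (-s)) (c s - d (-s)))) := by gcongr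
      _ = _ := by ring
  have h2 : 2 ≤ √(metricForm x₀ y₀ (w + v) (w + v)) := by
    have hlim : Tendsto (fun ε : ℝ ↦ (1 + ε) * √(metricForm x₀ y₀ (w + v) (w + v))) (𝓝[>] 0)
        (𝓝 ((1 + 0) * √(metricForm x₀ y₀ (w + v) (w + v)))) :=
      ((continuous_const.add continuous_id).mul continuous_const).continuousAt.tendsto.mono_left
        nhdsWithin_le_nhds
    rw [add_zero, one_mul] at hlim
    exact ge_of_tendsto hlim (eventually_mem_nhdsWithin.mono hbound)
  have h4 : 4 ≤ metricForm x₀ y₀ (w + v) (w + v) := by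
    have := (Real.le_sqrt' two_pos).1 h2
    linarith
  -- Parallelogram law: |v - w|² = 2|v|² + 2|w|² - |v + w|² ≤ 2 + 2 - 4 = 0.
  by_contra hne
  have hpos := metricForm_pos hy₀ (sub_ne_zero.2 hne)
  have hs := (localMetric x₀).symm y₀ hy₀ v w
  simp only [map_add, map_sub, add_apply, sub_apply] at hpos h4
  linarith

/-- A geodesic with the right initial velocity can be followed for a while. -/
theorem IsGeodesic.exists_descending {γ : ℝ → M} (hγ : IsGeodesic m γ) {f : M → ℝ} {T δ : ℝ}
    (hδ : 0 < δ) {z : M} {c c' : ℝ → Model m} (hTz : γ T = z) (hc0 : c 0 = extChartAt (𝓡 m) z z)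
    (hsol : ∀ t ∈ Icc (-δ) δ, SolvesAt (christoffelForm z) c c' t)
    (hdesc : ∀ t ∈ Icc 0 δ, f ((extChartAt (𝓡 m) z).symm (c t)) = f z - t)
    (hder : deriv (fun s ↦ extChartAt (𝓡 m) z (γ s)) T = c' 0) :
    ∃ s > 0, f (γ (T + s)) = f z - s := by
  have hT0 : γ T ∈ (extChartAt (𝓡 m) z).source := by
    rw [hTz]; exact mem_extChartAt_source z
  have hsrc : ∀ᶠ s in 𝓝 T, γ s ∈ (extChartAt (𝓡 m) z).source :=
    hγ.1.continuous.continuousAt.preimage_mem_nhds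
      ((isOpen_extChartAt_source z).mem_nhds hT0)
  have htr : Tendsto (fun s ↦ s - T) (𝓝 T) (𝓝 0) := by
    have : Tendsto (fun s ↦ s - T) (𝓝 T) (𝓝 (T - T)) :=
      (continuous_id.sub continuous_const).tendsto T
    rwa [sub_self] at this
  -- Both curves solve the geodesic equation near T with the same position and velocity, so they
  -- coincide there.
  have heq := (localMetric z).eventuallyEq_of_solvesAt (t₀ := T)
    (c := fun s ↦ extChartAt (𝓡 m) z (γ s)) (c' := deriv fun s ↦ extChartAt (𝓡 m) z (γ s))
    (d := fun s ↦ c (s - T)) (d' := fun s ↦ c' (s - T))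
    ((extChartAt (𝓡 m) z).map_source hT0)
    (hsrc.mono fun s hs ↦ hγ.solvesAt hs)
    ((htr.eventually (Icc_mem_nhds (neg_lt_zero.2 hδ) hδ)).mono fun s hs ↦
      ⟨(hsol _ hs).1.comp_sub_const s T, (hsol _ hs).2.comp_sub_const s T⟩)
    (by simp [hc0, hTz]) (by simpa using hder)
  have hboth := heq.and hsrc
  have htr2 : Tendsto (fun s ↦ T + s) (𝓝[>] 0) (𝓝 T) := by
    have : Tendsto (fun s ↦ T + s) (𝓝 0) (𝓝 (T + 0)) :=
      (continuous_const.add continuous_id).tendsto 0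
    rw [add_zero] at this
    exact this.mono_left nhdsWithin_le_nhds
  obtain ⟨s, ⟨hs1, hs2⟩, hs3⟩ := ((htr2.eventually hboth).and (Ioc_mem_nhdsGT hδ)).exists
  refine ⟨s, hs3.1, ?_⟩
  rw [← hdesc s ⟨hs3.1.le, hs3.2⟩]
  simp only [add_sub_cancel_left] at hs1
  rw [← hs1, (extChartAt (𝓡 m) z).left_inv hs2]

/-- Along the incoming piece of γ followed by c, the function f drops by at least 2s between times T
- s and T + s. As f is 1-Lipschitz, the endpoints are at distance at least 2s, and
`velocity_eq_of_le_rdist` excludes a corner. Positivity of T provides the incoming piece. -/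
theorem IsGeodesic.deriv_eq_of_descending {γ : ℝ → M} (hγ : IsGeodesic m γ)
    (hv0 : ‖velocity m γ 0‖ ≤ 1) {f : M → ℝ} (hlip : ∀ y z, |f y - f z| ≤ rdist m y z) {T δ : ℝ}
    (hT0 : 0 < T) (hfT : f (γ T) = f (γ 0) - T) (hδ : 0 < δ) {z : M} {c c' : ℝ → Model m}
    (hTz : γ T = z) (hc0 : c 0 = extChartAt (𝓡 m) z z) (hsp : metricForm z (c 0) (c' 0) (c' 0) ≤ 1)
    (hsol : ∀ t ∈ Icc (-δ) δ, SolvesAt (christoffelForm z) c c' t)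
    (hdesc : ∀ t ∈ Icc 0 δ, f ((extChartAt (𝓡 m) z).symm (c t)) = f z - t) :
    deriv (fun s ↦ extChartAt (𝓡 m) z (γ s)) T = c' 0 := by
  have hdiff : ∀ t, MDifferentiableAt 𝓘(ℝ, ℝ) (𝓡 m) γ t := hγ.1.mdifferentiable (by simp)
  have hTs : γ T ∈ (extChartAt (𝓡 m) z).source := by
    rw [hTz]; exact mem_extChartAt_source z
  have hs := hγ.solvesAt hTs
  have hd : HasDerivAt (fun s ↦ extChartAt (𝓡 m) z (γ (T + s)))
      (deriv (fun s ↦ extChartAt (𝓡 m) z (γ s)) T) 0 :=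
    HasDerivAt.comp_const_add (f := fun s ↦ extChartAt (𝓡 m) z (γ s)) T 0
      (by rw [add_zero]; exact hs.1)
  refine velocity_eq_of_le_rdist (mem_extChartAt_target z)
    (hsol 0 ⟨by linarith, hδ.le⟩).1 hd hc0 (by simp only [add_zero, hTz]) ?_
    (by rw [← hc0]; exact hsp) ?_
  · rw [← congrArg (extChartAt (𝓡 m) z) hTz, ← norm_velocity_sq (hdiff T) hTs hs.1,
      hγ.norm_velocity_eq T 0]
    exact pow_le_one₀ (norm_nonneg _) hv0
  · have htr : Tendsto (fun s ↦ T + -s) (𝓝[>] (0 : ℝ)) (𝓝 T) := by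
      have : Tendsto (fun s ↦ T + -s) (𝓝 0) (𝓝 (T + -0)) :=
        (continuous_const.add continuous_neg).tendsto 0
      simp only [neg_zero, add_zero] at this
      exact this.mono_left nhdsWithin_le_nhds
    filter_upwards [htr.eventually (hγ.1.continuous.continuousAt.preimage_mem_nhds
      ((isOpen_extChartAt_source z).mem_nhds hTs)), Ioc_mem_nhdsGT hδ, Ioc_mem_nhdsGT hT0]
      with s h1 h2 h3
    rw [(extChartAt (𝓡 m) z).left_inv h1]
    have e1 := hdesc s ⟨h2.1.le, h2.2⟩
    have e2 := (abs_le.1 (hlip (γ (T + -s)) ((extChartAt (𝓡 m) z).symm (c s)))).2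
    have e3 := (abs_le.1 ((hlip _ _).trans (hγ.rdist_le hv0
      (show 0 ≤ T + -s by linarith [h3.2])))).2
    have e4 : f z = f (γ 0) - T := by rw [← hTz, hfT]
    rw [e1, e4] at e2
    linarith

/-- Closed balls of a geodesically complete manifold are compact. -/
theorem isCompact_setOf_rdist_le (hM : GeodesicallyComplete m M) (x : M) (r : ℝ) :
    IsCompact {y | rdist m x y ≤ r} := by
  rw [isCompact_iff_ultrafilter_le_nhds]
  intro 𝒰 h𝒰
  by_contra! hlim
  have hr : ∀ᶠ q in (𝒰 : Filter M), rdist m x q ≤ r := le_principal_iff.1 h𝒰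
  have hclosed : IsClosed {y | rdist m x y ≤ r} := isClosed_le (continuous_rdist x) continuous_const
  have hlim' : ∀ y, ¬ (𝒰 : Filter M) ≤ 𝓝 y := fun y hy ↦ by
    refine hlim y ?_ hy
    exact hclosed.mem_of_tendsto (f := id) hy hr
  obtain ⟨f, hpos, hlip, hstep⟩ := exists_busemann hr hlim'
  obtain ⟨δ₀, hδ₀, c₀, c₀', hc0, hsp, hsol, hdesc⟩ := exists_solution_descending hlip (hstep x)
  obtain ⟨γ, hγ, hγ0, hγ'⟩ := hM x (c₀' 0)
  have hdiff : ∀ t, MDifferentiableAt 𝓘(ℝ, ℝ) (𝓡 m) γ t := hγ.1.mdifferentiable (by simp)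
  have hγx : γ 0 ∈ (extChartAt (𝓡 m) x).source := by
    rw [hγ0]; exact mem_extChartAt_source x
  have hv0 : ‖velocity m γ 0‖ ≤ 1 := by
    have h1 := norm_velocity_sq (hdiff 0) hγx hγ'
    rw [congrArg (extChartAt (𝓡 m) x) hγ0, ← hc0] at h1
    exact (sq_le_one_iff₀ (norm_nonneg _)).1 (h1.trans_le hsp)
  -- The times up to which γ has lost the full amount of f. Positivity of f bounds A by f x; the
  -- contradiction is that its largest element can be exceeded.
  set A := {t : ℝ | 0 ≤ t ∧ f (γ t) = f x - t} with hA
  have hfc : Continuous f := continuous_of_abs_sub_le_rdist (m := m) (C := 1) fun y z ↦ by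
    simpa using hlip y z
  have hAc : IsClosed A := (isClosed_le continuous_const continuous_id).inter
    (isClosed_eq (hfc.comp hγ.1.continuous) (continuous_const.sub continuous_id))
  have hA0 : (0 : ℝ) ∈ A := ⟨le_rfl, by simp [hγ0]⟩
  have hAb : BddAbove A := ⟨f x, fun t ht ↦ by have := hpos (γ t); linarith [ht.2]⟩
  set T := sSup A with hT
  have hTA : T ∈ A := hAc.csSup_mem ⟨0, hA0⟩ hAb
  suffices h : ∃ s > 0, f (γ (T + s)) = f (γ T) - s by
    obtain ⟨s, hs, hfs⟩ := h
    have : T + s ∈ A := ⟨by linarith [hTA.1], by rw [hfs, hTA.2]; ring⟩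
    linarith [le_csSup hAb this]
  -- At T = 0 there is no incoming piece, but the initial velocity of γ was chosen to be that of the
  -- descending geodesic.
  rcases hTA.1.eq_or_lt with hT0 | hT0
  · rw [← hT0, hγ0]
    exact hγ.exists_descending hδ₀ hγ0 hc0 hsol hdesc hγ'.deriv
  · obtain ⟨δ, hδ, c, c', hc0, hsp, hsol, hdesc⟩ :=
      exists_solution_descending hlip (hstep (γ T))
    exact hγ.exists_descending hδ rfl hc0 hsol hdesc
      (hγ.deriv_eq_of_descending hv0 hlip hT0 (by rw [hγ0]; exact hTA.2) hδ rfl hc0 hsp hsol hdesc)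

end HopfRinow

/-! ### The Riemannian volume measure. -/

noncomputable section Volume

/-- The supremum of a family of measures which agree on overlaps restricts to each of them. -/
theorem iSup_measure_apply {α ι : Type*} [MeasurableSpace α] {μ : ι → Measure α} {U : ι → Set α}
    (hU : ∀ i, MeasurableSet (U i)) (hcov : ∃ a : ℕ → ι, ⋃ n, U (a n) = univ)
    (hμ : ∀ i, μ i (U i)ᶜ = 0)
    (h : ∀ i j s, MeasurableSet s → s ⊆ U i → s ⊆ U j → μ i s = μ j s)
    {i : ι} {s : Set α} (hs : MeasurableSet s) (hsi : s ⊆ U i) : (⨆ i, μ i) s = μ i s := by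
  refine le_antisymm ?_ (Measure.le_iff'.1 (le_iSup μ i) s)
  obtain ⟨a, ha⟩ := hcov
  set D := disjointed fun n ↦ U (a n) with hD
  have hDm : ∀ n, MeasurableSet (D n) := fun n ↦ MeasurableSet.disjointed (fun n ↦ hU (a n)) n
  have hDs : ∀ n, D n ⊆ U (a n) := fun n ↦ disjointed_subset _ n
  have hDu : ⋃ n, D n = univ := by rw [hD, iUnion_disjointed, ha]
  have hsum : ∀ (ν : Measure α) (t : Set α), MeasurableSet t → ν t = ∑' n, ν (t ∩ D n) := by
    intro ν t ht
    conv_lhs => rw [← inter_univ t, ← hDu, inter_iUnion]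
    refine measure_iUnion (fun k l hkl ↦ ?_) fun n ↦ ht.inter (hDm n)
    exact ((disjoint_disjointed _) hkl).mono inter_subset_right inter_subset_right
  -- The measure glued along a disjoint countable refinement of the cover dominates every μ i, hence
  -- their supremum, and agrees with μ i on subsets of U i.
  set ν : Measure α := Measure.sum fun n ↦ (μ (a n)).restrict (D n) with hν
  have hνt : ∀ t, MeasurableSet t → ν t = ∑' n, μ (a n) (t ∩ D n) := fun t ht ↦ by
    rw [hν, Measure.sum_apply _ ht]
    exact tsum_congr fun n ↦ Measure.restrict_apply ht
  have hle : ⨆ i, μ i ≤ ν := by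
    refine iSup_le fun j ↦ Measure.le_iff.2 fun t ht ↦ ?_
    have h1 : μ j t ≤ μ j (t ∩ U j) := by
      rw [measure_inter_conull' (measure_mono_null (fun x hx ↦ hx.2) (hμ j))]
    rw [hνt t ht]
    refine h1.trans ?_
    rw [hsum (μ j) _ (ht.inter (hU j))]
    refine ENNReal.tsum_le_tsum fun n ↦ ?_
    rw [h j (a n) _ ((ht.inter (hU j)).inter (hDm n)) (fun x hx ↦ hx.1.2) fun x hx ↦ hDs n hx.2]
    exact measure_mono fun x hx ↦ ⟨hx.1.1, hx.2⟩
  refine (Measure.le_iff'.1 hle s).trans_eq ?_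
  rw [hνt s hs, hsum (μ i) s hs]
  exact tsum_congr fun n ↦ h _ _ _ (hs.inter (hDm n)) (fun x hx ↦ hDs n hx.2) fun x hx ↦ hsi hx.1

theorem measurableSet_inter_preimage {α β : Type*} [TopologicalSpace α] [MeasurableSpace α]
    [OpensMeasurableSpace α] [TopologicalSpace β] [MeasurableSpace β] [BorelSpace β] {f : α → β}
    {s : Set α} {t : Set β} (hf : ContinuousOn f s) (hs : MeasurableSet s) (ht : MeasurableSet t) :
    MeasurableSet (s ∩ f ⁻¹' t) := by
  have h : Continuous fun x : s ↦ f x := continuousOn_iff_continuous_domRestrict.1 hf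
  have h2 := hs.subtype_image (h.measurable ht)
  rwa [show (fun x : s ↦ f x) ⁻¹' t = Subtype.val ⁻¹' (f ⁻¹' t) from rfl,
    Subtype.image_preimage_coe] at h2

variable {m : ℕ} {M : Type*} [TopologicalSpace M] [ChartedSpace (Model m) M]
  [IsManifold (𝓡 m) ∞ M]

/-- The derivative of the change of coordinates from the chart around `x₀` to that around `x₁`. -/
def transitionD (x₀ x₁ : M) (y : Model m) : Model m →L[ℝ] Model m :=
  (chartD x₁ ((extChartAt (𝓡 m) x₀).symm y)).comp (chartDSymm x₀ y)

theorem hasFDerivAt_transition {x₀ x₁ : M} {y : Model m} (hy : y ∈ (extChartAt (𝓡 m) x₀).target)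
    (hy' : (extChartAt (𝓡 m) x₀).symm y ∈ (extChartAt (𝓡 m) x₁).source) :
    HasFDerivAt (fun z ↦ extChartAt (𝓡 m) x₁ ((extChartAt (𝓡 m) x₀).symm z))
      (transitionD x₀ x₁ y) y :=
  hasMFDerivAt_iff_hasFDerivAt.1
    ((mdifferentiableAt_chart hy').hasMFDerivAt.comp y (mdifferentiableAt_symm hy).hasMFDerivAt)

variable [RiemannianBundle (fun x : M ↦ Tan m x)]
  [IsContMDiffRiemannianBundle (𝓡 m) ∞ (Model m) (fun x : M ↦ Tan m x)]

theorem metricForm_transition {x₀ x₁ : M} {y : Model m}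
    (hy' : (extChartAt (𝓡 m) x₀).symm y ∈ (extChartAt (𝓡 m) x₁).source) (v w : Model m) :
    metricForm x₀ y v w = metricForm x₁ (extChartAt (𝓡 m) x₁ ((extChartAt (𝓡 m) x₀).symm y))
      (transitionD x₀ x₁ y v) (transitionD x₀ x₁ y w) := by
  rw [← inner_chartDSymm, inner_eq_metricForm hy']
  rfl

theorem gram_eq_metricForm (x₀ : M) (y : Model m) (i j : Fin m) :
    gram x₀ y i j = metricForm x₀ y (EuclideanSpace.single i 1) (EuclideanSpace.single j 1) := by
  simp [metricForm_apply]

/-- With J the Jacobian matrix of the transition, the gram matrices satisfy g₀ = Jᵀ g₁ J; take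
square roots of determinants. -/
theorem density_eq_mul_density {x₀ x₁ : M} {y : Model m}
    (hy' : (extChartAt (𝓡 m) x₀).symm y ∈ (extChartAt (𝓡 m) x₁).source) :
    density x₀ y = |(transitionD x₀ x₁ y).det|
      * density x₁ (extChartAt (𝓡 m) x₁ ((extChartAt (𝓡 m) x₀).symm y)) := by
  set b := (EuclideanSpace.basisFun (Fin m) ℝ).toBasis with hb
  set D := transitionD x₀ x₁ y with hD
  set J := LinearMap.toMatrix b b (D : Model m →ₗ[ℝ] Model m) with hJ
  have hJa : ∀ k i, J k i = D (EuclideanSpace.single i 1) k := fun k i ↦ by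
    simp [hJ, LinearMap.toMatrix_apply, hb]
  have hg : gram x₀ y
      = J.transpose * gram x₁ (extChartAt (𝓡 m) x₁ ((extChartAt (𝓡 m) x₀).symm y)) * J := by
    ext i j
    rw [gram_eq_metricForm, metricForm_transition hy', metricForm_apply, Matrix.mul_apply,
      Finset.sum_comm]
    refine Finset.sum_congr rfl fun l _ ↦ ?_
    rw [Matrix.mul_apply, Finset.sum_mul]
    refine Finset.sum_congr rfl fun k _ ↦ ?_
    rw [Matrix.transpose_apply, hJa, hJa]
    ring
  have hdet : D.det = J.det := by
    rw [hJ, LinearMap.det_toMatrix]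
  rw [density, hg, Matrix.det_mul, Matrix.det_mul, Matrix.det_transpose, hdet, density,
    mul_right_comm, ← sq, Real.sqrt_mul (sq_nonneg _), Real.sqrt_sq_eq_abs]

theorem aemeasurable_density (x₀ : M) : AEMeasurable (density x₀)
    ((volume : Measure (Model m)).restrict (extChartAt (𝓡 m) x₀).target) :=
  (contDiffOn_density x₀).continuousOn.aemeasurable (isOpen_target x₀).measurableSet

variable [MeasurableSpace M] [BorelSpace M]

theorem aemeasurable_extChartAt_symm (x₀ : M) : AEMeasurable (extChartAt (𝓡 m) x₀).symm
    ((volume : Measure (Model m)).restrict (extChartAt (𝓡 m) x₀).target) :=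
  (continuousOn_extChartAt_symm x₀).aemeasurable (isOpen_target x₀).measurableSet

theorem measurableSet_source (x₀ : M) : MeasurableSet (extChartAt (𝓡 m) x₀).source :=
  (isOpen_extChartAt_source x₀).measurableSet

theorem measurableSet_target_inter_preimage (x₀ : M) {s : Set M} (hs : MeasurableSet s) :
    MeasurableSet ((extChartAt (𝓡 m) x₀).target ∩ (extChartAt (𝓡 m) x₀).symm ⁻¹' s) :=
  measurableSet_inter_preimage (continuousOn_extChartAt_symm x₀) (isOpen_target x₀).measurableSet hs

theorem chartVolume_apply (x₀ : M) {s : Set M} (hs : MeasurableSet s) :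
    chartVolume m x₀ s
      = ∫⁻ y in (extChartAt (𝓡 m) x₀).target ∩ (extChartAt (𝓡 m) x₀).symm ⁻¹' s,
          ENNReal.ofReal (density x₀ y) := by
  have hac := withDensity_absolutelyContinuous
    ((volume : Measure (Model m)).restrict (extChartAt (𝓡 m) x₀).target)
    (fun y ↦ ENNReal.ofReal (density x₀ y))
  have hmeas := (aemeasurable_extChartAt_symm (m := m) x₀).mono_ac hac
  have hms := measurableSet_target_inter_preimage (m := m) x₀ hs
  rw [chartVolume, Measure.map_apply_of_aemeasurable hmeas hs]
  rw [withDensity_apply₀ _ (((aemeasurable_extChartAt_symm (m := m) x₀).nullMeasurable hs))]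
  rw [Measure.restrict_restrict₀ ((aemeasurable_extChartAt_symm (m := m) x₀).nullMeasurable hs),
    inter_comm]

/-- The change of variables formula for the transition map, whose Jacobian is cancelled by
`density_eq_mul_density`. -/
theorem chartVolume_eq_of_subset (x₀ x₁ : M) {s : Set M} (hs : MeasurableSet s)
    (h₀ : s ⊆ (extChartAt (𝓡 m) x₀).source) (h₁ : s ⊆ (extChartAt (𝓡 m) x₁).source) :
    chartVolume m x₀ s = chartVolume m x₁ s := by
  rw [chartVolume_apply x₀ hs, chartVolume_apply x₁ hs]
  set φ₀ := extChartAt (𝓡 m) x₀ with hφ₀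
  set φ₁ := extChartAt (𝓡 m) x₁ with hφ₁
  have himg : φ₁.target ∩ φ₁.symm ⁻¹' s
      = (fun z ↦ φ₁ (φ₀.symm z)) '' (φ₀.target ∩ φ₀.symm ⁻¹' s) := by
    ext z
    constructor
    · rintro ⟨hz, hzs⟩
      refine ⟨φ₀ (φ₁.symm z), ⟨φ₀.map_source (h₀ hzs), ?_⟩, ?_⟩
      · rw [mem_preimage, φ₀.left_inv (h₀ hzs)]; exact hzs
      · dsimp only
        rw [φ₀.left_inv (h₀ hzs), φ₁.right_inv hz]
    · rintro ⟨y, ⟨hy, hys⟩, rfl⟩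
      refine ⟨φ₁.map_source (h₁ hys), ?_⟩
      rw [mem_preimage, φ₁.left_inv (h₁ hys)]; exact hys
  rw [himg, lintegral_image_eq_lintegral_abs_det_fderiv_mul (f' := transitionD x₀ x₁) volume
    (measurableSet_target_inter_preimage x₀ hs)
    (fun y hy ↦ (hasFDerivAt_transition hy.1 (h₁ hy.2)).hasFDerivWithinAt)]
  · refine setLIntegral_congr_fun (measurableSet_target_inter_preimage x₀ hs) fun y hy ↦ ?_
    rw [← ENNReal.ofReal_mul (abs_nonneg _), density_eq_mul_density (h₁ hy.2)]
  · intro y hy z hz hyz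
    have := φ₁.injOn (h₁ hy.2) (h₁ hz.2) hyz
    exact φ₀.symm.injOn hy.1 hz.1 this

theorem chartVolume_compl_source (x₀ : M) :
    chartVolume m x₀ (extChartAt (𝓡 m) x₀).sourceᶜ = 0 := by
  rw [chartVolume_apply x₀ (measurableSet_source x₀).compl]
  have : (extChartAt (𝓡 m) x₀).target
      ∩ (extChartAt (𝓡 m) x₀).symm ⁻¹' (extChartAt (𝓡 m) x₀).sourceᶜ = ∅ := by
    ext y
    simp only [mem_inter_iff, mem_preimage, mem_compl_iff, mem_empty_iff_false, iff_false, not_and,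
      not_not]
    exact fun hy ↦ (extChartAt (𝓡 m) x₀).map_target hy
  rw [this]
  simp

variable [SecondCountableTopology M]

theorem exists_seq_iUnion_source (m : ℕ) (M : Type*) [TopologicalSpace M]
    [ChartedSpace (Model m) M] [SecondCountableTopology M] [Nonempty M] :
    ∃ a : ℕ → M, ⋃ n, (extChartAt (𝓡 m) (a n)).source = univ := by
  obtain ⟨s, hs, hsU⟩ := TopologicalSpace.countable_cover_nhds fun x : M ↦
    extChartAt_source_mem_nhds (I := 𝓡 m) x
  have hne : s.Nonempty := by
    by_contra h
    rw [not_nonempty_iff_eq_empty] at h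
    simp [h] at hsU
    exact (univ_nonempty (α := M)).ne_empty hsU.symm
  obtain ⟨a, ha⟩ := hs.exists_eq_range hne
  refine ⟨a, ?_⟩
  rw [← hsU, ha, biUnion_range]

variable [Nonempty M]

theorem vol_apply_of_subset {x₀ : M} {s : Set M} (hs : MeasurableSet s)
    (h : s ⊆ (extChartAt (𝓡 m) x₀).source) : vol m M s = chartVolume m x₀ s :=
  iSup_measure_apply (μ := fun x₀ : M ↦ chartVolume m x₀)
    (U := fun x₀ ↦ (extChartAt (𝓡 m) x₀).source) measurableSet_source
    (exists_seq_iUnion_source m M) chartVolume_compl_source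
    (fun i j _ ht hi hj ↦ chartVolume_eq_of_subset i j ht hi hj) hs h

theorem vol_restrict_source (x₀ : M) :
    (vol m M).restrict (extChartAt (𝓡 m) x₀).source = chartVolume m x₀ := by
  ext s hs
  rw [Measure.restrict_apply hs, vol_apply_of_subset (hs.inter (measurableSet_source x₀))
    inter_subset_right, measure_inter_conull'
      (measure_mono_null (fun x hx ↦ hx.2) (chartVolume_compl_source x₀))]

/-- The volume has a density with respect to Lebesgue measure in the chart, so Lebesgue-null sets of
coordinates are null in M. -/
theorem ae_of_ae_chart {x₀ : M} {P : M → Prop}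
    (h : ∀ᵐ y : Model m, y ∈ (extChartAt (𝓡 m) x₀).target → P ((extChartAt (𝓡 m) x₀).symm y)) :
    ∀ᵐ x ∂vol m M, x ∈ (extChartAt (𝓡 m) x₀).source → P x := by
  set φ := extChartAt (𝓡 m) x₀ with hφ
  -- The exceptional set need not be measurable; a measurable null hull is transported instead.
  set N := toMeasurable volume {y | ¬ (y ∈ φ.target → P (φ.symm y))} with hN
  have hN0 : volume N = 0 := by rw [hN, measure_toMeasurable]; exact h
  have hm : MeasurableSet (φ.source ∩ φ ⁻¹' N) :=
    measurableSet_inter_preimage (continuousOn_extChartAt x₀) (measurableSet_source x₀)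
      (measurableSet_toMeasurable _ _)
  refine measure_mono_null (t := φ.source ∩ φ ⁻¹' N) (fun x hx ↦ ?_) ?_
  · have hx' : ¬ (x ∈ φ.source → P x) := hx
    push Not at hx'
    refine ⟨hx'.1, subset_toMeasurable _ _ fun hP ↦ hx'.2 ?_⟩
    have := hP (φ.map_source hx'.1)
    rwa [φ.left_inv hx'.1] at this
  · rw [vol_apply_of_subset hm inter_subset_left, chartVolume_apply x₀ hm]
    refine setLIntegral_measure_zero _ _ (measure_mono_null (fun y hy ↦ ?_) hN0)
    have := hy.2.2
    rwa [mem_preimage, φ.right_inv hy.1] at this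

theorem ae_of_forall_ae_chart {P : M → Prop}
    (h : ∀ x₀ : M, ∀ᵐ y : Model m, y ∈ (extChartAt (𝓡 m) x₀).target →
      P ((extChartAt (𝓡 m) x₀).symm y)) :
    ∀ᵐ x ∂vol m M, P x := by
  obtain ⟨a, ha⟩ := exists_seq_iUnion_source m M
  filter_upwards [ae_all_iff.2 fun n ↦ ae_of_ae_chart (h (a n))] with x hx
  obtain ⟨n, hn⟩ := mem_iUnion.1 (ha.symm ▸ mem_univ x)
  exact hx n hn

/-- The density is bounded on a compact coordinate ball. This makes continuous functions with
compact support integrable. -/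
instance isLocallyFiniteMeasure_vol : IsLocallyFiniteMeasure (vol m M) := by
  refine ⟨fun x ↦ ?_⟩
  set φ := extChartAt (𝓡 m) x with hφ
  obtain ⟨r, hr, hrs⟩ := nhds_basis_closedBall.mem_iff.1
    ((isOpen_target x).mem_nhds (mem_extChartAt_target (I := 𝓡 m) x))
  have hm : MeasurableSet (φ.source ∩ φ ⁻¹' closedBall (φ x) r) :=
    measurableSet_inter_preimage (continuousOn_extChartAt x) (measurableSet_source x)
      measurableSet_closedBall
  refine ⟨φ.source ∩ φ ⁻¹' closedBall (φ x) r, inter_mem (extChartAt_source_mem_nhds x)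
    ((continuousAt_extChartAt x).preimage_mem_nhds (closedBall_mem_nhds _ hr)), ?_⟩
  rw [vol_apply_of_subset hm inter_subset_left, chartVolume_apply x hm]
  have hi : IntegrableOn (density x) (closedBall (φ x) r) :=
    ((contDiffOn_density x).continuousOn.mono hrs).integrableOn_compact (isCompact_closedBall _ _)
  refine (lintegral_mono_set fun y hy ↦ ?_).trans_lt hi.lintegral_lt_top
  have := hy.2.2
  rwa [mem_preimage, φ.right_inv hy.1] at this

theorem integral_vol_eq {x₀ : M} {F : M → ℝ} (hF : AEStronglyMeasurable F (vol m M))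
    (h0 : ∀ x ∉ (extChartAt (𝓡 m) x₀).source, F x = 0) :
    ∫ x, F x ∂vol m M = ∫ y in (extChartAt (𝓡 m) x₀).target,
      density x₀ y * F ((extChartAt (𝓡 m) x₀).symm y) := by
  rw [← setIntegral_eq_integral_of_forall_compl_eq_zero (s := (extChartAt (𝓡 m) x₀).source)
    (fun x hx ↦ h0 x hx), vol_restrict_source]
  have hF' := hF.mono_measure (Measure.restrict_le_self (s := (extChartAt (𝓡 m) x₀).source))
  rw [vol_restrict_source] at hF'
  have hac := withDensity_absolutelyContinuous
    ((volume : Measure (Model m)).restrict (extChartAt (𝓡 m) x₀).target)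
    (fun y ↦ ENNReal.ofReal (density x₀ y))
  rw [chartVolume, integral_map ((aemeasurable_extChartAt_symm (m := m) x₀).mono_ac hac) hF']
  have := integral_withDensity_eq_integral_smul₀ (aemeasurable_density (m := m) x₀).real_toNNReal
    (fun y ↦ F ((extChartAt (𝓡 m) x₀).symm y))
  refine this.trans ?_
  refine setIntegral_congr_fun (isOpen_target x₀).measurableSet fun y hy ↦ ?_
  simp [NNReal.smul_def, Real.coe_toNNReal _ (Real.sqrt_nonneg _), density]

end Volume

/-! ### The Piola identity and independence of the divergence from the chart. -/

noncomputable section Divergence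

section Piola

variable {E : Type*} [NormedAddCommGroup E] [NormedSpace ℝ E] [FiniteDimensional ℝ E]

/-- The determinant is a polynomial in t with linear coefficient the trace; what remains is a
multiple of t². -/
theorem hasDerivAt_det_one_add_smul (N : E →ₗ[ℝ] E) :
    HasDerivAt (fun t : ℝ ↦ LinearMap.det (1 + t • N)) (LinearMap.trace ℝ E N) 0 := by
  set b := Module.finBasis ℝ E
  set P := LinearMap.toMatrix b b N with hP
  have h : (fun t : ℝ ↦ LinearMap.det (1 + t • N)) = fun t ↦ 1 + P.trace * t
      + ((1 + (Polynomial.X : Polynomial ℝ) • P.map Polynomial.C).det.divX.divX).eval t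
        * t ^ 2 := by
    ext t
    rw [← Matrix.det_one_add_smul, ← LinearMap.det_toMatrix b, map_add, map_smul,
      LinearMap.toMatrix_one]
  rw [h, LinearMap.trace_eq_matrix_trace ℝ b]
  have h1 := ((hasDerivAt_id (0 : ℝ)).const_mul P.trace).const_add 1
  have h2 := ((1 + (Polynomial.X : Polynomial ℝ) • P.map Polynomial.C).det.divX.divX).hasDerivAt
    (0 : ℝ)
  have h3 := h2.mul (hasDerivAt_pow 2 (0 : ℝ))
  exact (h1.add h3).congr_deriv (by simp [hP])

theorem differentiable_det : Differentiable ℝ fun B : E →L[ℝ] E ↦ B.det := by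
  set b := Module.finBasis ℝ E
  have h : (fun B : E →L[ℝ] E ↦ B.det)
      = fun B : E →L[ℝ] E ↦ (LinearMap.toMatrix b b (B : E →ₗ[ℝ] E)).det := by
    ext B
    rw [LinearMap.det_toMatrix]
  have hentry : ∀ i j, ContDiff ℝ 1 fun B : E →L[ℝ] E ↦
      LinearMap.toMatrix b b (B : E →ₗ[ℝ] E) i j := by
    intro i j
    have := ((b.coord i).toContinuousLinearMap.comp
      (ContinuousLinearMap.apply ℝ E (b j))).contDiff (n := 1)
    convert this using 1
    ext B
    simp [LinearMap.toMatrix_apply]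
  rw [h]
  simp only [Matrix.det_apply]
  have : ContDiff ℝ 1 fun B : E →L[ℝ] E ↦ ∑ σ : Equiv.Perm (Fin (Module.finrank ℝ E)),
      Equiv.Perm.sign σ • ∏ i, LinearMap.toMatrix b b (B : E →ₗ[ℝ] E) (σ i) i :=
    ContDiff.sum fun σ _ ↦ (contDiff_prod fun i _ ↦ hentry (σ i) i).const_smul _
  exact this.differentiable (by simp)

/-- Jacobi's formula. -/
theorem exists_hasFDerivAt_det {B A : E →L[ℝ] E} (hA : B.comp A = ContinuousLinearMap.id ℝ E) :
    ∃ F : (E →L[ℝ] E) →L[ℝ] ℝ, HasFDerivAt (fun B : E →L[ℝ] E ↦ B.det) F B ∧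
      ∀ C : E →L[ℝ] E, F C = B.det * LinearMap.trace ℝ E (A.comp C : E →L[ℝ] E) := by
  refine ⟨_, (differentiable_det B).hasFDerivAt, fun C ↦ ?_⟩
  have hline : HasDerivAt (fun t : ℝ ↦ B + t • C) C 0 := by
    simpa using ((hasDerivAt_id (0 : ℝ)).smul_const C).const_add B
  have h1 : HasDerivAt (fun t : ℝ ↦ (B + t • C).det)
      (fderiv ℝ (fun B : E →L[ℝ] E ↦ B.det) B C) 0 := by
    have h0 : HasFDerivAt (fun B : E →L[ℝ] E ↦ B.det)
        (fderiv ℝ (fun B : E →L[ℝ] E ↦ B.det) B) (B + (0 : ℝ) • C) := by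
      rw [zero_smul, add_zero]; exact (differentiable_det B).hasFDerivAt
    exact h0.comp_hasDerivAt (0 : ℝ) hline
  have h2 : HasDerivAt (fun t : ℝ ↦ (B + t • C).det)
      (B.det * LinearMap.trace ℝ E (A.comp C : E →L[ℝ] E)) 0 := by
    -- Since B A = 1, the line factors as B + tC = B (1 + t A C).
    refine ((hasDerivAt_det_one_add_smul
      (A.comp C : E →ₗ[ℝ] E)).const_mul B.det).congr_of_eventuallyEq
      (Eventually.of_forall fun t ↦ ?_)
    change LinearMap.det _ = LinearMap.det _ * _
    rw [← map_mul]
    congr 1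
    ext v
    have := congr($hA (C v))
    simp at this
    simp [this]
  exact h1.unique h2

/-- The Piola identity: the divergence of a density-weighted vector field transforms by the Jacobian
determinant under a change of coordinates. -/
theorem trace_fderiv_transform {τ W₀ W₁ : E → E} {D : E → E →L[ℝ] E} {D' : E →L[ℝ] E →L[ℝ] E}
    {A W₀' W₁' : E →L[ℝ] E} {y : E} (hτ : ∀ᶠ z in 𝓝 y, HasFDerivAt τ (D z) z)
    (hD : HasFDerivAt D D' y) (hA : (D y).comp A = ContinuousLinearMap.id ℝ E)
    (hA' : A.comp (D y) = ContinuousLinearMap.id ℝ E) (hW₀ : HasFDerivAt W₀ W₀' y)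
    (hW₁ : HasFDerivAt W₁ W₁' (τ y)) (h : ∀ᶠ z in 𝓝 y, D z (W₀ z) = |(D z).det| • W₁ (τ z)) :
    LinearMap.trace ℝ E W₀' = |(D y).det| * LinearMap.trace ℝ E W₁' := by
  obtain ⟨F, hF, hFC⟩ := exists_hasFDerivAt_det hA
  have hdet : (D y).det ≠ 0 := by
    intro h0
    have h1 : LinearMap.det ((D y : E →ₗ[ℝ] E) * (A : E →ₗ[ℝ] E)) = 1 := by
      have : (D y : E →ₗ[ℝ] E) * (A : E →ₗ[ℝ] E) = 1 := by
        ext v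
        exact congr($hA v)
      rw [this, map_one]
    rw [map_mul, show LinearMap.det (D y : E →ₗ[ℝ] E) = 0 from h0, zero_mul] at h1
    exact zero_ne_one h1
  -- The derivative of |det| is this sign times the derivative of det.
  set s : ℝ := (SignType.sign (D y).det : ℝ) with hs
  have hsd : s * (D y).det = |(D y).det| := sign_mul_self _
  have hd1 := hD.clm_apply hW₀
  have hd2 := ((hF.comp y hD).abs hdet).smul (hW₁.comp y hτ.self_of_nhds)
  have heq := hd1.unique (hd2.congr_of_eventuallyEq h)
  have hAv : ∀ v, A (D y v) = v := fun v ↦ congr($hA' v)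
  have hW : |(D y).det| • A (W₁ (τ y)) = W₀ y := by
    rw [← map_smul, ← h.self_of_nhds, hAv]
  have hsymm : ∀ v w, D' v w = D' w v := second_derivative_symmetric_of_eventually hτ hD
  -- Differentiate D W₀ = |det D| (W₁ ∘ τ) and solve for W₀' by applying A. In trace, the first
  -- summand gives the claim and the other two must cancel.
  have key : (W₀' : E →ₗ[ℝ] E)
      = |(D y).det| • ((A : E →ₗ[ℝ] E) * ((W₁' : E →ₗ[ℝ] E) * (D y : E →ₗ[ℝ] E)))
      + (((s • F.comp D' : E →L[ℝ] ℝ) : E →ₗ[ℝ] ℝ)).smulRight (A (W₁ (τ y)))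
      - (A : E →ₗ[ℝ] E) * (D' (W₀ y) : E →ₗ[ℝ] E) := by
    ext v
    have hv := congr(A ($heq v))
    simp [hAv, Function.comp] at hv
    simp [hsymm (W₀ y) v, hs]
    rw [← hv]
    abel
  have hm : LinearMap.trace ℝ E ((A : E →ₗ[ℝ] E) * ((W₁' : E →ₗ[ℝ] E) * (D y : E →ₗ[ℝ] E)))
      = LinearMap.trace ℝ E W₁' := by
    rw [LinearMap.trace_mul_comm, mul_assoc]
    have : (D y : E →ₗ[ℝ] E) * (A : E →ₗ[ℝ] E) = 1 := by
      ext v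
      exact congr($hA v)
    rw [this, mul_one]
  rw [key, map_sub, map_add, map_smul, hm, LinearMap.trace_smulRight]
  -- The cancellation: Jacobi's formula evaluates the derivative of the determinant as a trace, and
  -- the symmetry of D', used in `key`, matches it with the trace of A ∘ D'(W₀).
  have hF2 := hFC (D' (W₀ y))
  have hF3 : |(D y).det| * F (D' (A (W₁ (τ y)))) = F (D' (W₀ y)) := by
    rw [← hW, map_smul, map_smul, smul_eq_mul]
  have hd : |(D y).det| ≠ 0 := abs_ne_zero.2 hdet
  have hF4 : s * F (D' (A (W₁ (τ y))))
      = LinearMap.trace ℝ E ((A : E →ₗ[ℝ] E) * (D' (W₀ y) : E →ₗ[ℝ] E)) := by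
    refine mul_left_cancel₀ hd ?_
    rw [mul_left_comm, hF3, hF2, ← mul_assoc, hsd]
    rfl
  rw [← hF4]
  simp

theorem trace_eq_sum {m : ℕ} (L : Model m →L[ℝ] Model m) :
    LinearMap.trace ℝ (Model m) L = ∑ i, L (EuclideanSpace.single i 1) i := by
  rw [LinearMap.trace_eq_matrix_trace ℝ (EuclideanSpace.basisFun (Fin m) ℝ).toBasis, Matrix.trace]
  simp [LinearMap.toMatrix_apply]

theorem sum_partialDeriv_eq_trace {m : ℕ} {W : Model m → Model m} {W' : Model m →L[ℝ] Model m}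
    {y : Model m} (h : HasFDerivAt W W' y) :
    ∑ i, partialDeriv i (fun z ↦ W z i) y = LinearMap.trace ℝ (Model m) W' := by
  rw [trace_eq_sum]
  refine Finset.sum_congr rfl fun i _ ↦ ?_
  have := ((EuclideanSpace.proj (𝕜 := ℝ) i).hasFDerivAt (x := W y)).comp y h
  rw [partialDeriv, show (fun z ↦ W z i) = (EuclideanSpace.proj (𝕜 := ℝ) i) ∘ W from rfl,
    this.fderiv]
  rfl

end Piola

variable {m : ℕ} {M : Type*} [TopologicalSpace M] [ChartedSpace (Model m) M]

/-- The components of a vector field in the chart around `x₀`, as a function of the coordinates. -/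
def chartField (x₀ : M) (X : ∀ x : M, Tan m x) (y : Model m) : Model m :=
  chartD x₀ ((extChartAt (𝓡 m) x₀).symm y) (X ((extChartAt (𝓡 m) x₀).symm y))

theorem chartField_apply {x₀ x : M} (X : ∀ x : M, Tan m x)
    (hx : x ∈ (extChartAt (𝓡 m) x₀).source) :
    chartField x₀ X (extChartAt (𝓡 m) x₀ x) = chartD x₀ x (X x) :=
  congrArg (fun p ↦ (chartD x₀ p (X p) : Model m)) ((extChartAt (𝓡 m) x₀).left_inv hx)

variable [IsManifold (𝓡 m) ∞ M]

theorem eventually_mem_source {x₀ x₁ : M} {y : Model m} (hy : y ∈ (extChartAt (𝓡 m) x₀).target)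
    (hy' : (extChartAt (𝓡 m) x₀).symm y ∈ (extChartAt (𝓡 m) x₁).source) :
    ∀ᶠ z in 𝓝 y, z ∈ (extChartAt (𝓡 m) x₀).target ∧
      (extChartAt (𝓡 m) x₀).symm z ∈ (extChartAt (𝓡 m) x₁).source :=
  Filter.Eventually.and ((isOpen_target x₀).mem_nhds hy)
    ((continuousAt_extChartAt_symm'' hy).preimage_mem_nhds
      ((isOpen_extChartAt_source x₁).mem_nhds hy'))

theorem contDiffAt_transition {x₀ x₁ : M} {y : Model m} (hy : y ∈ (extChartAt (𝓡 m) x₀).target)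
    (hy' : (extChartAt (𝓡 m) x₀).symm y ∈ (extChartAt (𝓡 m) x₁).source) :
    ContDiffAt ℝ ∞ (fun z ↦ extChartAt (𝓡 m) x₁ ((extChartAt (𝓡 m) x₀).symm z)) y := by
  have h1 : ContMDiffAt 𝓘(ℝ, Model m) (𝓡 m) ∞ (extChartAt (𝓡 m) x₀).symm y :=
    (contMDiffOn_extChartAt_symm x₀).contMDiffAt ((isOpen_target x₀).mem_nhds hy)
  have h2 : ContMDiffAt (𝓡 m) 𝓘(ℝ, Model m) ∞ (extChartAt (𝓡 m) x₁)
      ((extChartAt (𝓡 m) x₀).symm y) := contMDiffAt_extChartAt' (by simpa using hy')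
  exact contMDiffAt_iff_contDiffAt.1 (h2.comp y h1)

theorem contDiffAt_transitionD {x₀ x₁ : M} {y : Model m} (hy : y ∈ (extChartAt (𝓡 m) x₀).target)
    (hy' : (extChartAt (𝓡 m) x₀).symm y ∈ (extChartAt (𝓡 m) x₁).source) :
    ContDiffAt ℝ ∞ (transitionD x₀ x₁) y := by
  refine ((contDiffAt_transition hy hy').fderiv_right (m := ∞) (by simp)).congr_of_eventuallyEq ?_
  filter_upwards [eventually_mem_source hy hy'] with z hz
  exact (hasFDerivAt_transition hz.1 hz.2).fderiv.symm

theorem transitionD_comp_transitionD {x₀ x₁ x : M} (h₀ : x ∈ (extChartAt (𝓡 m) x₀).source)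
    (h₁ : x ∈ (extChartAt (𝓡 m) x₁).source) :
    (transitionD x₁ x₀ (extChartAt (𝓡 m) x₁ x)).comp (transitionD x₀ x₁ (extChartAt (𝓡 m) x₀ x))
      = ContinuousLinearMap.id ℝ (Model m) := by
  have e₀ := (extChartAt (𝓡 m) x₀).left_inv h₀
  have e₁ := (extChartAt (𝓡 m) x₁).left_inv h₁
  have hy := (extChartAt (𝓡 m) x₀).map_source h₀
  have hy' : (extChartAt (𝓡 m) x₀).symm (extChartAt (𝓡 m) x₀ x) ∈ (extChartAt (𝓡 m) x₁).source := by
    rw [e₀]; exact h₁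
  have d1 := hasFDerivAt_transition hy hy'
  have d2 : HasFDerivAt (fun z ↦ extChartAt (𝓡 m) x₀ ((extChartAt (𝓡 m) x₁).symm z))
      (transitionD x₁ x₀ (extChartAt (𝓡 m) x₁ x))
      (extChartAt (𝓡 m) x₁ ((extChartAt (𝓡 m) x₀).symm (extChartAt (𝓡 m) x₀ x))) := by
    rw [e₀]
    exact hasFDerivAt_transition ((extChartAt (𝓡 m) x₁).map_source h₁) (by rw [e₁]; exact h₀)
  refine (d2.comp (extChartAt (𝓡 m) x₀ x) d1).unique ((hasFDerivAt_id _).congr_of_eventuallyEq ?_)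
  filter_upwards [eventually_mem_source hy hy'] with z hz
  simp only [Function.comp, id]
  rw [(extChartAt (𝓡 m) x₁).left_inv hz.2, (extChartAt (𝓡 m) x₀).right_inv hz.1]

theorem transitionD_chartField {x₀ x₁ : M} (X : ∀ x : M, Tan m x) {z : Model m}
    (hz : z ∈ (extChartAt (𝓡 m) x₀).target)
    (hz' : (extChartAt (𝓡 m) x₀).symm z ∈ (extChartAt (𝓡 m) x₁).source) :
    transitionD x₀ x₁ z (chartField x₀ X z)
      = chartField x₁ X (extChartAt (𝓡 m) x₁ ((extChartAt (𝓡 m) x₀).symm z)) := by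
  rw [chartField_apply X hz', transitionD, ContinuousLinearMap.comp_apply, chartField,
    chartDSymm_chartD hz]

theorem differentiableAt_chartField {x₀ x₁ x : M} {X : ∀ x : M, Tan m x}
    (h₀ : x ∈ (extChartAt (𝓡 m) x₀).source) (h₁ : x ∈ (extChartAt (𝓡 m) x₁).source)
    (hX : DifferentiableAt ℝ (chartField x₀ X) (extChartAt (𝓡 m) x₀ x)) :
    DifferentiableAt ℝ (chartField x₁ X) (extChartAt (𝓡 m) x₁ x) := by
  have e₀ := (extChartAt (𝓡 m) x₀).left_inv h₀
  have e₁ := (extChartAt (𝓡 m) x₁).left_inv h₁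
  have hw := (extChartAt (𝓡 m) x₁).map_source h₁
  have hw' : (extChartAt (𝓡 m) x₁).symm (extChartAt (𝓡 m) x₁ x) ∈ (extChartAt (𝓡 m) x₀).source := by
    rw [e₁]; exact h₀
  have hσ := (hasFDerivAt_transition hw hw').differentiableAt
  have hD : DifferentiableAt ℝ (transitionD x₀ x₁)
      (extChartAt (𝓡 m) x₀ ((extChartAt (𝓡 m) x₁).symm (extChartAt (𝓡 m) x₁ x))) := by
    rw [e₁]
    exact (contDiffAt_transitionD ((extChartAt (𝓡 m) x₀).map_source h₀)
      (by rw [e₀]; exact h₁)).differentiableAt (by simp)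
  have hX' : DifferentiableAt ℝ (chartField x₀ X)
      (extChartAt (𝓡 m) x₀ ((extChartAt (𝓡 m) x₁).symm (extChartAt (𝓡 m) x₁ x))) := by
    rw [e₁]; exact hX
  refine ((hD.comp (extChartAt (𝓡 m) x₁ x) hσ).clm_apply
    (hX'.comp (extChartAt (𝓡 m) x₁ x) hσ)).congr_of_eventuallyEq ?_
  filter_upwards [eventually_mem_source hw hw'] with z hz
  simp only [Function.comp]
  rw [transitionD_chartField X ((extChartAt (𝓡 m) x₀).map_source hz.2),
    (extChartAt (𝓡 m) x₀).left_inv hz.2, (extChartAt (𝓡 m) x₁).right_inv hz.1]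
  rw [(extChartAt (𝓡 m) x₀).left_inv hz.2]
  exact (extChartAt (𝓡 m) x₁).map_target hz.1

variable [RiemannianBundle (fun x : M ↦ Tan m x)]
  [IsContMDiffRiemannianBundle (𝓡 m) ∞ (Model m) (fun x : M ↦ Tan m x)]

theorem differentiableAt_density {x₀ : M} {y : Model m}
    (hy : y ∈ (extChartAt (𝓡 m) x₀).target) : DifferentiableAt ℝ (density x₀) y :=
  ((contDiffOn_density x₀).contDiffAt ((isOpen_target x₀).mem_nhds hy)).differentiableAt (by simp)

/-- The divergence of `X`, computed in the chart around `x₀`. -/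
def chartDivergence (x₀ : M) (X : ∀ x : M, Tan m x) (y : Model m) : ℝ :=
  (density x₀ y)⁻¹ * ∑ i, partialDeriv i (fun z ↦ density x₀ z * chartField x₀ X z i) y

theorem chartDivergence_eq_trace {x₀ : M} {X : ∀ x : M, Tan m x} {y : Model m}
    {W' : Model m →L[ℝ] Model m}
    (h : HasFDerivAt (fun z ↦ density x₀ z • chartField x₀ X z) W' y) :
    chartDivergence x₀ X y = (density x₀ y)⁻¹ * LinearMap.trace ℝ (Model m) W' := by
  rw [chartDivergence, ← sum_partialDeriv_eq_trace h]
  rfl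

/-- The definition changes chart with the point, so it must be brought to one fixed chart before it
can be integrated. The density-weighted components transform with the Jacobian by
`density_eq_mul_density`, which is the hypothesis of the Piola identity. -/
theorem divergence_eq_chartDivergence {x₀ x : M} {X : ∀ x : M, Tan m x}
    (h₀ : x ∈ (extChartAt (𝓡 m) x₀).source)
    (hX : DifferentiableAt ℝ (chartField x₀ X) (extChartAt (𝓡 m) x₀ x)) :
    divergence X x = chartDivergence x₀ X (extChartAt (𝓡 m) x₀ x) := by
  have h₁ : x ∈ (extChartAt (𝓡 m) x).source := mem_extChartAt_source x
  have hy := (extChartAt (𝓡 m) x₀).map_source h₀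
  have e₀ := (extChartAt (𝓡 m) x₀).left_inv h₀
  have hy' : (extChartAt (𝓡 m) x₀).symm (extChartAt (𝓡 m) x₀ x) ∈ (extChartAt (𝓡 m) x).source := by
    rw [e₀]; exact h₁
  have hW₀ := ((differentiableAt_density hy).smul hX).hasFDerivAt
  have hW₁ := ((differentiableAt_density ((extChartAt (𝓡 m) x).map_source h₁)).smul
    (differentiableAt_chartField h₀ h₁ hX)).hasFDerivAt
  have htr := trace_fderiv_transform
    (τ := fun z ↦ extChartAt (𝓡 m) x ((extChartAt (𝓡 m) x₀).symm z))
    (D := transitionD x₀ x) (A := transitionD x x₀ (extChartAt (𝓡 m) x x))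
    (W₀ := fun z ↦ density x₀ z • chartField x₀ X z)
    (W₁ := fun z ↦ density x z • chartField x X z) (W₀' := _) (W₁' := _)
    ((eventually_mem_source hy hy').mono fun z hz ↦ hasFDerivAt_transition hz.1 hz.2)
    ((contDiffAt_transitionD hy hy').differentiableAt (by simp)).hasFDerivAt
    (transitionD_comp_transitionD h₁ h₀) (transitionD_comp_transitionD h₀ h₁) hW₀
    (by simp only [e₀]; exact hW₁)
    ((eventually_mem_source hy hy').mono fun z hz ↦ by
      rw [map_smul, transitionD_chartField X hz.1 hz.2, density_eq_mul_density hz.2, smul_smul])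
  have hdiv : divergence X x = chartDivergence x X (extChartAt (𝓡 m) x x) := rfl
  rw [hdiv, chartDivergence_eq_trace hW₁, chartDivergence_eq_trace hW₀, htr,
    density_eq_mul_density hy', e₀]
  have hpos : 0 < density x₀ (extChartAt (𝓡 m) x₀ x) := density_pos hy
  rw [density_eq_mul_density hy', e₀] at hpos
  have hne : |(transitionD x₀ x (extChartAt (𝓡 m) x₀ x)).det| ≠ 0 := by
    intro h
    rw [h, zero_mul] at hpos
    exact hpos.false
  rw [mul_inv]
  field_simp

end Divergence

/-! ### The divergence theorem for locally Lipschitz vector fields. -/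

noncomputable section DivergenceTheorem

section Lipschitz

variable {E F : Type*} [NormedAddCommGroup E] [NormedSpace ℝ E] [NormedAddCommGroup F]
  [NormedSpace ℝ F]

theorem locallyLipschitzOn_comp {α β γ : Type*} [PseudoEMetricSpace α] [PseudoEMetricSpace β]
    [PseudoEMetricSpace γ] {g : β → γ} {f : α → β} {s : Set α} (hg : LocallyLipschitz g)
    (hf : LocallyLipschitzOn s f) : LocallyLipschitzOn s fun x ↦ g (f x) := by
  intro x hx
  obtain ⟨K, t, ht, hK⟩ := hf hx
  obtain ⟨K', t', ht', hK'⟩ := hg (f x)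
  refine ⟨K' * K, t ∩ f ⁻¹' t', inter_mem ht ((hf.continuousOn x hx).preimage_mem_nhdsWithin ht'),
    hK'.comp (hK.mono inter_subset_left) fun y hy ↦ hy.2⟩

theorem locallyLipschitzOn_smul {s : Set E} {g : E → ℝ} {f : E → F} (hg : LocallyLipschitzOn s g)
    (hf : LocallyLipschitzOn s f) : LocallyLipschitzOn s fun x ↦ g x • f x := by
  have h : LocallyLipschitz fun q : ℝ × F ↦ q.1 • q.2 :=
    (contDiff_fst.smul contDiff_snd).locallyLipschitz (𝕂 := ℝ)
  refine locallyLipschitzOn_comp (f := fun x ↦ (g x, f x)) h fun x hx ↦ ?_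
  obtain ⟨K, t, ht, hK⟩ := hg hx
  obtain ⟨K', t', ht', hK'⟩ := hf hx
  exact ⟨max K K', t ∩ t', inter_mem ht ht',
    (hK.mono inter_subset_left).prodMk (hK'.mono inter_subset_right)⟩

theorem locallyLipschitzOn_of_contDiffOn {s : Set E} {f : E → F} (hs : IsOpen s)
    (hf : ContDiffOn ℝ 1 f s) : LocallyLipschitzOn s f := fun x hx ↦ by
  obtain ⟨K, t, ht, hK⟩ := (hf.contDiffAt (hs.mem_nhds hx)).exists_lipschitzOnWith
  exact ⟨K, t, mem_nhdsWithin_of_mem_nhds ht, hK⟩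

/-- Rademacher's theorem on small neighbourhoods; a set that is null near each of its points is
null. -/
theorem ae_differentiableAt_of_locallyLipschitzOn [FiniteDimensional ℝ E] [FiniteDimensional ℝ F]
    [MeasurableSpace E] [BorelSpace E] {μ : Measure E} [μ.IsAddHaarMeasure] {s : Set E} {f : E → F}
    (hs : IsOpen s) (hf : LocallyLipschitzOn s f) :
    ∀ᵐ x ∂μ, x ∈ s → DifferentiableAt ℝ f x := by
  have := FiniteDimensional.proper ℝ E
  refine measure_null_of_locally_null _ fun x hx ↦ ?_
  have hx' : ¬ (x ∈ s → DifferentiableAt ℝ f x) := hx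
  push Not at hx'
  obtain ⟨K, t, ht, hK⟩ := hf hx'.1
  rw [hs.nhdsWithin_eq hx'.1] at ht
  refine ⟨interior t ∩ {x | ¬ (x ∈ s → DifferentiableAt ℝ f x)}, inter_mem
    (mem_nhdsWithin_of_mem_nhds (interior_mem_nhds.2 ht)) self_mem_nhdsWithin, ?_⟩
  have := (hK.mono (interior_subset (s := t))).ae_differentiableWithinAt_of_mem (μ := μ)
  refine measure_mono_null (fun y hy ↦ ?_) this
  intro h
  refine hy.2 fun _ ↦ (h hy.1).differentiableAt (isOpen_interior.mem_nhds hy.1)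

/-- On a ball containing the unit neighbourhood of K, compactness gives a Lipschitz constant. A
point outside is at distance at least 1 from K, where the supremum of ‖f‖ serves as the constant. -/
theorem exists_lipschitzWith_of_compact_support [FiniteDimensional ℝ E] {s K : Set E} {f : E → F}
    (hs : IsOpen s) (hf : LocallyLipschitzOn s f) (hK : IsCompact K) (hKs : K ⊆ s)
    (h0 : ∀ x ∉ K, f x = 0) : ∃ C, LipschitzWith C f := by
  have := FiniteDimensional.proper ℝ E
  have hloc : LocallyLipschitz f := by
    intro x
    by_cases hx : x ∈ K
    · obtain ⟨C, t, ht, hC⟩ := hf (hKs hx)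
      rw [hs.nhdsWithin_eq (hKs hx)] at ht
      exact ⟨C, t, ht, hC⟩
    · refine ⟨0, Kᶜ, hK.isClosed.isOpen_compl.mem_nhds hx, fun y hy z hz ↦ ?_⟩
      simp [h0 y hy, h0 z hz]
  have hc : Continuous f := hloc.continuous
  obtain ⟨R, hR⟩ := hK.isBounded.subset_closedBall 0
  obtain ⟨L, hL⟩ := hloc.locallyLipschitzOn.exists_lipschitzOnWith_of_compact
    (isCompact_closedBall (0 : E) (R + 1))
  obtain ⟨B, hB⟩ := hK.exists_bound_of_continuousOn hc.continuousOn
  have hB0 : ∀ x, ‖f x‖ ≤ max B 0 := fun x ↦ by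
    by_cases hx : x ∈ K
    · exact (hB x hx).trans (le_max_left _ _)
    · simp [h0 x hx]
  have key : ∀ x ∈ K, ∀ y, dist (f x) (f y) ≤ (L + max B 0) * dist x y := by
    intro x hx y
    by_cases hy : y ∈ closedBall (0 : E) (R + 1)
    · refine (hL.dist_le_mul x (closedBall_subset_closedBall (by linarith) (hR hx)) y hy).trans ?_
      gcongr
      exact le_add_of_nonneg_right (le_max_right _ _)
    · have hyK : y ∉ K := fun h ↦ hy (closedBall_subset_closedBall (by linarith) (hR h))
      have h1 : 1 ≤ dist x y := by
        have e1 : ‖x‖ ≤ R := by simpa using hR hx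
        have e2 : R + 1 < ‖y‖ := by simpa using hy
        have e3 := norm_sub_norm_le y x
        rw [dist_eq_norm, norm_sub_rev]
        linarith
      rw [h0 y hyK, dist_zero_right]
      have h2 := hB0 x
      have h3 : (0 : ℝ) ≤ L := L.2
      have h4 : 0 ≤ max B 0 := le_max_right _ _
      nlinarith
  refine ⟨L + B.toNNReal, LipschitzWith.of_dist_le_mul fun x y ↦ ?_⟩
  rw [NNReal.coe_add, Real.coe_toNNReal']
  by_cases hx : x ∈ K
  · exact key x hx y
  by_cases hy : y ∈ K
  · rw [dist_comm, dist_comm x y]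
    exact key y hy x
  · rw [h0 x hx, h0 y hy, dist_self]
    positivity

/-- Integration by parts against the constant function 1, with line derivatives replaced by `fderiv`
almost everywhere through Rademacher's theorem. -/
theorem integral_fderiv_eq_zero [FiniteDimensional ℝ E] [MeasurableSpace E] [BorelSpace E]
    {μ : Measure E} [μ.IsAddHaarMeasure] {f : E → ℝ} {C : ℝ≥0} (hf : LipschitzWith C f)
    (hc : HasCompactSupport f) (v : E) :
    Integrable (fun x ↦ fderiv ℝ f x v) μ ∧ ∫ x, fderiv ℝ f x v ∂μ = 0 := by
  constructor
  · have hs : Function.support (fun x ↦ fderiv ℝ f x v) ⊆ tsupport f := fun x hx ↦ by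
      refine support_fderiv_subset ℝ fun h0 ↦ hx ?_
      simp only [h0, zero_apply]
    rw [← integrableOn_iff_integrable_of_support_subset hs]
    refine Measure.integrableOn_of_bounded (M := C * ‖v‖) (hc.measure_lt_top.ne)
      (measurable_fderiv_apply_const ℝ f v).aestronglyMeasurable
      (Eventually.of_forall fun x ↦ ?_)
    exact (ContinuousLinearMap.le_opNorm _ _).trans
      (by gcongr; exact norm_fderiv_le_of_lipschitz ℝ hf)
  · have h := (LipschitzWith.const (1 : ℝ)).integral_lineDeriv_mul_eq (μ := μ) hf hc (-v)
    simp only [neg_neg, mul_one] at h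
    rw [← integral_congr_ae (f := fun x ↦ lineDeriv ℝ f x v)]
    · rw [← h]
      simp [lineDeriv]
    · filter_upwards [hf.ae_differentiableAt] with x hx
      exact hx.lineDeriv_eq_fderiv

end Lipschitz

variable {m : ℕ} {M : Type*} [TopologicalSpace M] [ChartedSpace (Model m) M]

/-- A vector field with locally Lipschitz components. -/
def LocLipField (X : ∀ x : M, Tan m x) : Prop :=
  ∀ x₀ : M, LocallyLipschitzOn (extChartAt (𝓡 m) x₀).target (chartField x₀ X)

/-- A function which is locally Lipschitz in charts. -/
def LocLip (m : ℕ) [ChartedSpace (Model m) M] (h : M → ℝ) : Prop :=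
  ∀ x₀ : M, LocallyLipschitzOn (extChartAt (𝓡 m) x₀).target
    fun y ↦ h ((extChartAt (𝓡 m) x₀).symm y)

theorem chartField_smul (x₀ : M) (h : M → ℝ) (X : ∀ x : M, Tan m x) :
    chartField x₀ (fun x ↦ h x • X x)
      = fun y ↦ h ((extChartAt (𝓡 m) x₀).symm y) • chartField x₀ X y := by
  ext1 y
  simp only [chartField, map_smul]

theorem LocLip.smul {h : M → ℝ} {X : ∀ x : M, Tan m x} (hh : LocLip m h) (hX : LocLipField X) :
    LocLipField fun x ↦ h x • X x := fun x₀ ↦ by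
  rw [chartField_smul]
  exact locallyLipschitzOn_smul (hh x₀) (hX x₀)

theorem LocLip.mul {g h : M → ℝ} (hg : LocLip m g) (hh : LocLip m h) :
    LocLip m fun x ↦ g x * h x := fun x₀ ↦ locallyLipschitzOn_smul (hg x₀) (hh x₀)

variable [IsManifold (𝓡 m) ∞ M]

theorem contDiffOn_comp_symm {h : M → ℝ} (hh : ContMDiff (𝓡 m) 𝓘(ℝ, ℝ) ∞ h) (x₀ : M) :
    ContDiffOn ℝ ∞ (fun y ↦ h ((extChartAt (𝓡 m) x₀).symm y)) (extChartAt (𝓡 m) x₀).target :=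
  contMDiffOn_iff_contDiffOn.1
    (hh.comp_contMDiffOn (contMDiffOn_extChartAt_symm x₀))

theorem locLip_of_contMDiff {h : M → ℝ} (hh : ContMDiff (𝓡 m) 𝓘(ℝ, ℝ) ∞ h) : LocLip m h :=
  fun x₀ ↦ locallyLipschitzOn_of_contDiffOn (isOpen_target x₀)
    ((contDiffOn_comp_symm hh x₀).of_le (by exact_mod_cast le_top))

theorem differentiableAt_comp_symm {x₀ x₁ x : M} {h : M → ℝ}
    (h₀ : x ∈ (extChartAt (𝓡 m) x₀).source) (h₁ : x ∈ (extChartAt (𝓡 m) x₁).source)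
    (hh : DifferentiableAt ℝ (fun y ↦ h ((extChartAt (𝓡 m) x₀).symm y)) (extChartAt (𝓡 m) x₀ x)) :
    DifferentiableAt ℝ (fun y ↦ h ((extChartAt (𝓡 m) x₁).symm y)) (extChartAt (𝓡 m) x₁ x) := by
  have e₁ := (extChartAt (𝓡 m) x₁).left_inv h₁
  have hw := (extChartAt (𝓡 m) x₁).map_source h₁
  have hw' : (extChartAt (𝓡 m) x₁).symm (extChartAt (𝓡 m) x₁ x) ∈ (extChartAt (𝓡 m) x₀).source := by
    rw [e₁]; exact h₀
  have hσ := (hasFDerivAt_transition hw hw').differentiableAt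
  have hh' : DifferentiableAt ℝ (fun y ↦ h ((extChartAt (𝓡 m) x₀).symm y))
      (extChartAt (𝓡 m) x₀ ((extChartAt (𝓡 m) x₁).symm (extChartAt (𝓡 m) x₁ x))) := by
    rw [e₁]; exact hh
  refine (hh'.comp (extChartAt (𝓡 m) x₁ x) hσ).congr_of_eventuallyEq ?_
  filter_upwards [eventually_mem_source hw hw'] with z hz
  simp only [Function.comp]
  rw [(extChartAt (𝓡 m) x₀).left_inv hz.2]

variable [RiemannianBundle (fun x : M ↦ Tan m x)]
  [IsContMDiffRiemannianBundle (𝓡 m) ∞ (Model m) (fun x : M ↦ Tan m x)]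

theorem divergence_eq_trace {X : ∀ x : M, Tan m x} {x : M} {W' : Model m →L[ℝ] Model m}
    (h : HasFDerivAt (fun z ↦ density x z • chartField x X z) W' (extChartAt (𝓡 m) x x)) :
    divergence X x
      = (density x (extChartAt (𝓡 m) x x))⁻¹ * LinearMap.trace ℝ (Model m) W' :=
  chartDivergence_eq_trace h

theorem divergence_sum {ι : Type*} (s : Finset ι) {X : ι → ∀ x : M, Tan m x} {x : M}
    (h : ∀ i ∈ s, DifferentiableAt ℝ (chartField x (X i)) (extChartAt (𝓡 m) x x)) :
    divergence (fun y ↦ ∑ i ∈ s, X i y) x = ∑ i ∈ s, divergence (X i) x := by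
  have hd := differentiableAt_density (mem_extChartAt_target (I := 𝓡 m) x)
  have hW : ∀ i ∈ s, HasFDerivAt (fun z ↦ density x z • chartField x (X i) z)
      (fderiv ℝ (fun z ↦ density x z • chartField x (X i) z) (extChartAt (𝓡 m) x x))
      (extChartAt (𝓡 m) x x) := fun i hi ↦ (hd.smul (h i hi)).hasFDerivAt
  have hs : HasFDerivAt (fun z ↦ density x z • chartField x (fun y ↦ ∑ i ∈ s, X i y) z)
      (∑ i ∈ s, fderiv ℝ (fun z ↦ density x z • chartField x (X i) z) (extChartAt (𝓡 m) x x))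
      (extChartAt (𝓡 m) x x) := by
    refine (HasFDerivAt.fun_sum hW).congr_of_eventuallyEq (Eventually.of_forall fun z ↦ ?_)
    simp only [chartField, map_sum, Finset.smul_sum]
  rw [divergence_eq_trace hs, Finset.sum_congr rfl fun i hi ↦ divergence_eq_trace (hW i hi),
    ← Finset.mul_sum]
  congr 1
  rw [← map_sum]
  congr 1
  ext v
  simp

/-- Leibniz rule, needed only at points of differentiability because it will be used almost
everywhere. -/
theorem divergence_smul {h : M → ℝ} {X : ∀ x : M, Tan m x} {x : M}
    (hh : DifferentiableAt ℝ (fun y ↦ h ((extChartAt (𝓡 m) x).symm y)) (extChartAt (𝓡 m) x x))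
    (hX : DifferentiableAt ℝ (chartField x X) (extChartAt (𝓡 m) x x)) :
    divergence (fun y ↦ h y • X y) x = h x * divergence X x
      + fderiv ℝ (fun y ↦ h ((extChartAt (𝓡 m) x).symm y)) (extChartAt (𝓡 m) x x)
        (chartField x X (extChartAt (𝓡 m) x x)) := by
  have hpos := density_pos (mem_extChartAt_target (I := 𝓡 m) x)
  have hd := differentiableAt_density (mem_extChartAt_target (I := 𝓡 m) x)
  have hW := (hd.smul hX).hasFDerivAt
  have hs := (hh.hasFDerivAt.smul hW).congr_of_eventuallyEq
    (f₁ := fun z ↦ density x z • chartField x (fun y ↦ h y • X y) z)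
    (Eventually.of_forall fun z ↦ by
      rw [chartField_smul]
      exact smul_comm _ _ _)
  rw [divergence_eq_trace hs, divergence_eq_trace hW]
  have hlin : ∀ (a : ℝ) (L : Model m →L[ℝ] Model m) (f : Model m →L[ℝ] ℝ) (v : Model m),
      LinearMap.trace ℝ (Model m) (a • L + f.smulRight v : Model m →L[ℝ] Model m)
        = a * LinearMap.trace ℝ (Model m) L + f v := fun a L f v ↦ by
    calc _ = LinearMap.trace ℝ (Model m) (a • (L : Model m →ₗ[ℝ] Model m)
          + (f : Model m →ₗ[ℝ] ℝ).smulRight v) := rfl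
      _ = _ := by rw [map_add, map_smul, LinearMap.trace_smulRight]; rfl
  rw [hlin, extChartAt_to_inv, Pi.smul_apply', map_smul, smul_eq_mul]
  field_simp

theorem divergence_eq_zero {X : ∀ x : M, Tan m x} {x : M} (h : ∀ᶠ y in 𝓝 x, X y = 0) :
    divergence X x = 0 := by
  have hev : ∀ᶠ z in 𝓝 (extChartAt (𝓡 m) x x), X ((extChartAt (𝓡 m) x).symm z) = 0 := by
    have := continuousAt_extChartAt_symm (I := 𝓡 m) x
    rw [ContinuousAt, extChartAt_to_inv] at this
    exact this.eventually h
  have hs : HasFDerivAt (fun z ↦ density x z • chartField x X z) (0 : Model m →L[ℝ] Model m)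
      (extChartAt (𝓡 m) x x) := by
    refine (hasFDerivAt_const (0 : Model m) _).congr_of_eventuallyEq ?_
    filter_upwards [hev] with z hz
    rw [chartField, hz, map_zero, smul_zero]
  rw [divergence_eq_trace hs]
  simp

variable [SecondCountableTopology M] [MeasurableSpace M] [BorelSpace M] [Nonempty M]

theorem LocLipField.ae_differentiableAt {X : ∀ x : M, Tan m x} (hX : LocLipField X) :
    ∀ᵐ x ∂vol m M, DifferentiableAt ℝ (chartField x X) (extChartAt (𝓡 m) x x) := by
  refine ae_of_forall_ae_chart fun x₀ ↦ ?_
  filter_upwards [ae_differentiableAt_of_locallyLipschitzOn (μ := volume) (isOpen_target x₀)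
    (hX x₀)] with y hy hyt
  refine differentiableAt_chartField ((extChartAt (𝓡 m) x₀).map_target hyt)
    (mem_extChartAt_source _) ?_
  rw [(extChartAt (𝓡 m) x₀).right_inv hyt]
  exact hy hyt

theorem LocLip.ae_differentiableAt {h : M → ℝ} (hh : LocLip m h) :
    ∀ᵐ x ∂vol m M, DifferentiableAt ℝ (fun y ↦ h ((extChartAt (𝓡 m) x).symm y))
      (extChartAt (𝓡 m) x x) := by
  refine ae_of_forall_ae_chart fun x₀ ↦ ?_
  filter_upwards [ae_differentiableAt_of_locallyLipschitzOn (μ := volume) (isOpen_target x₀)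
    (hh x₀)] with y hy hyt
  refine differentiableAt_comp_symm ((extChartAt (𝓡 m) x₀).map_target hyt)
    (mem_extChartAt_source _) ?_
  rw [(extChartAt (𝓡 m) x₀).right_inv hyt]
  exact hy hyt

theorem LocLipField.ae_divergence_eq {X : ∀ x : M, Tan m x} (hX : LocLipField X) (x₀ : M) :
    ∀ᵐ y : Model m, y ∈ (extChartAt (𝓡 m) x₀).target →
      divergence X ((extChartAt (𝓡 m) x₀).symm y) = chartDivergence x₀ X y := by
  filter_upwards [ae_differentiableAt_of_locallyLipschitzOn (μ := volume) (isOpen_target x₀)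
    (hX x₀)] with y hy hyt
  rw [divergence_eq_chartDivergence ((extChartAt (𝓡 m) x₀).map_target hyt),
    (extChartAt (𝓡 m) x₀).right_inv hyt]
  rw [(extChartAt (𝓡 m) x₀).right_inv hyt]
  exact hy hyt

/-- Measurability is not evident from a definition whose chart varies with the point. Over each of
countably many charts the divergence agrees almost everywhere with a fixed coordinate expression,
and derivatives are measurable. -/
theorem LocLipField.aemeasurable_divergence {X : ∀ x : M, Tan m x} (hX : LocLipField X) :
    AEMeasurable (divergence X) (vol m M) := by
  obtain ⟨a, ha⟩ := exists_seq_iUnion_source m M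
  have key : ∀ x₀ : M, AEMeasurable (divergence X)
      ((vol m M).restrict (extChartAt (𝓡 m) x₀).source) := by
    intro x₀
    have h1 : AEMeasurable (fun x ↦ chartDivergence x₀ X (extChartAt (𝓡 m) x₀ x))
        ((vol m M).restrict (extChartAt (𝓡 m) x₀).source) := by
      have hφ : AEMeasurable (extChartAt (𝓡 m) x₀)
          ((vol m M).restrict (extChartAt (𝓡 m) x₀).source) :=
        (continuousOn_extChartAt x₀).aemeasurable (measurableSet_source x₀)
      have hdens : AEMeasurable (fun x ↦ (density x₀ (extChartAt (𝓡 m) x₀ x))⁻¹)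
          ((vol m M).restrict (extChartAt (𝓡 m) x₀).source) := by
        refine AEMeasurable.inv ?_
        exact ((contDiffOn_density x₀).continuousOn.comp (continuousOn_extChartAt x₀)
          fun x hx ↦ (extChartAt (𝓡 m) x₀).map_source hx).aemeasurable (measurableSet_source x₀)
      refine hdens.mul ?_
      refine Measurable.comp_aemeasurable
        (g := fun y ↦ ∑ i, partialDeriv i (fun z ↦ density x₀ z * chartField x₀ X z i) y) ?_ hφ
      exact Finset.measurable_sum _ fun i _ ↦ measurable_fderiv_apply_const ℝ _ _
    refine h1.congr ?_
    rw [EventuallyEq, ae_restrict_iff' (measurableSet_source x₀)]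
    refine ae_of_ae_chart ?_
    filter_upwards [hX.ae_divergence_eq x₀] with y hy hyt
    rw [hy hyt, (extChartAt (𝓡 m) x₀).right_inv hyt]
  have := aemeasurable_iUnion_iff.2 fun n ↦ key (a n)
  rwa [ha, Measure.restrict_univ] at this

theorem integrable_vol_iff {x₀ : M} {F : M → ℝ} (hF : AEStronglyMeasurable F (vol m M))
    (h0 : ∀ x ∉ (extChartAt (𝓡 m) x₀).source, F x = 0) :
    Integrable F (vol m M) ↔ IntegrableOn (fun y ↦ density x₀ y *
      F ((extChartAt (𝓡 m) x₀).symm y)) (extChartAt (𝓡 m) x₀).target := by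
  have hs : Function.support F ⊆ (extChartAt (𝓡 m) x₀).source := fun x hx ↦ by
    by_contra h
    exact hx (h0 x h)
  rw [← integrableOn_iff_integrable_of_support_subset hs, IntegrableOn, vol_restrict_source]
  have hF' := hF.mono_measure (Measure.restrict_le_self (s := (extChartAt (𝓡 m) x₀).source))
  rw [vol_restrict_source] at hF'
  have hac := withDensity_absolutelyContinuous
    ((volume : Measure (Model m)).restrict (extChartAt (𝓡 m) x₀).target)
    (fun y ↦ ENNReal.ofReal (density x₀ y))
  rw [chartVolume, integrable_map_measure hF'
    ((aemeasurable_extChartAt_symm (m := m) x₀).mono_ac hac)]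
  have := integrable_withDensity_iff_integrable_smul₀
    (aemeasurable_density (m := m) x₀).real_toNNReal (g := fun y ↦ F ((extChartAt (𝓡 m) x₀).symm y))
  refine this.trans ?_
  refine integrableOn_congr_fun (fun y hy ↦ ?_) (isOpen_target x₀).measurableSet
  simp [NNReal.smul_def, Real.coe_toNNReal _ (Real.sqrt_nonneg _), density]

/-- The divergence theorem for vector fields supported in a chart. -/
theorem LocLipField.integral_divergence_of_subset [T2Space M] {X : ∀ x : M, Tan m x}
    (hX : LocLipField X) {x₀ : M} {K : Set M} (hK : IsCompact K)
    (hKs : K ⊆ (extChartAt (𝓡 m) x₀).source) (h0 : ∀ x ∉ K, X x = 0) :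
    Integrable (divergence X) (vol m M) ∧ ∫ x, divergence X x ∂vol m M = 0 := by
  set φ := extChartAt (𝓡 m) x₀ with hφ
  have hdiv0 : ∀ x ∉ φ.source, divergence X x = 0 := fun x hx ↦ divergence_eq_zero <| by
    filter_upwards [hK.isClosed.isOpen_compl.mem_nhds fun h ↦ hx (hKs h)] with y hy
    exact h0 y hy
  have hKc : IsCompact (φ '' K) := hK.image_of_continuousOn ((continuousOn_extChartAt x₀).mono hKs)
  have hKt : φ '' K ⊆ φ.target := by
    rintro _ ⟨x, hx, rfl⟩
    exact φ.map_source (hKs hx)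
  -- Extension by zero: outside the target the coordinate expression has no meaning.
  let Φ : Fin m → Model m → ℝ := fun i ↦
    φ.target.indicator fun z ↦ density x₀ z * chartField x₀ X z i
  have hΦ0 : ∀ i, ∀ y ∉ φ '' K, Φ i y = 0 := fun i y hy ↦ by
    by_cases hyt : y ∈ φ.target
    · have : φ.symm y ∉ K := fun h ↦ hy ⟨_, h, φ.right_inv hyt⟩
      simp only [Φ, indicator_of_mem hyt, chartField]
      rw [h0 _ this, map_zero]
      simp
    · exact indicator_of_notMem hyt _
  have hΦl : ∀ i, LocallyLipschitzOn φ.target (Φ i) := fun i ↦ by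
    have h1 : LocallyLipschitzOn φ.target fun z ↦ density x₀ z * chartField x₀ X z i :=
      locallyLipschitzOn_smul (locallyLipschitzOn_of_contDiffOn (isOpen_target x₀)
        ((contDiffOn_density x₀).of_le (by exact_mod_cast le_top)))
        (locallyLipschitzOn_comp
          (EuclideanSpace.proj (𝕜 := ℝ) i : Model m →L[ℝ] ℝ).lipschitz.locallyLipschitz (hX x₀))
    intro y hy
    obtain ⟨C, t, ht, hC⟩ := h1 hy
    refine ⟨C, t ∩ φ.target, inter_mem ht self_mem_nhdsWithin, fun z hz w hw ↦ ?_⟩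
    simp only [Φ, indicator_of_mem hz.2, indicator_of_mem hw.2]
    exact hC hz.1 hw.1
  have hΦ : ∀ i, Integrable (fun y ↦ fderiv ℝ (Φ i) y (EuclideanSpace.single i 1)) ∧
      ∫ y, fderiv ℝ (Φ i) y (EuclideanSpace.single i 1) = 0 := fun i ↦ by
    obtain ⟨C, hC⟩ := exists_lipschitzWith_of_compact_support (isOpen_target x₀) (hΦl i) hKc hKt
      (hΦ0 i)
    exact integral_fderiv_eq_zero hC (HasCompactSupport.intro hKc (hΦ0 i)) _
  have hΦs : ∀ i, ∀ y ∉ φ.target, fderiv ℝ (Φ i) y (EuclideanSpace.single i 1) = 0 := by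
    intro i y hy
    have : Φ i =ᶠ[𝓝 y] fun _ ↦ 0 := by
      filter_upwards [hKc.isClosed.isOpen_compl.mem_nhds fun h ↦ hy (hKt h)] with z hz
      exact hΦ0 i z hz
    rw [this.fderiv_eq]
    simp
  -- The volume density cancels the prefactor of the divergence, leaving a sum of partial
  -- derivatives of compactly supported Lipschitz functions.
  have hae : ∀ᵐ y ∂(volume : Measure (Model m)).restrict φ.target,
      density x₀ y * divergence X (φ.symm y)
        = ∑ i, fderiv ℝ (Φ i) y (EuclideanSpace.single i 1) := by
    rw [ae_restrict_iff' (isOpen_target x₀).measurableSet]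
    filter_upwards [hX.ae_divergence_eq x₀] with y hy hyt
    rw [hy hyt, chartDivergence, mul_inv_cancel_left₀ (density_pos hyt).ne']
    refine Finset.sum_congr rfl fun i _ ↦ ?_
    have : Φ i =ᶠ[𝓝 y] fun z ↦ density x₀ z * chartField x₀ X z i := by
      filter_upwards [(isOpen_target x₀).mem_nhds hyt] with z hz
      exact indicator_of_mem hz _
    rw [this.fderiv_eq]
    rfl
  have hm := hX.aemeasurable_divergence.aestronglyMeasurable
  constructor
  · rw [integrable_vol_iff hm hdiv0]
    exact ((integrable_finsetSum _ fun i _ ↦ (hΦ i).1).integrableOn).congr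
      (hae.mono fun _ h ↦ h.symm)
  · rw [integral_vol_eq hm hdiv0, integral_congr_ae hae,
      setIntegral_eq_integral_of_forall_compl_eq_zero
        (fun y hy ↦ Finset.sum_eq_zero fun i _ ↦ hΦs i y hy),
      integral_finsetSum _ fun i _ ↦ (hΦ i).1]
    exact Finset.sum_eq_zero fun i _ ↦ (hΦ i).2

/-- The divergence theorem for compactly supported locally Lipschitz vector fields. -/
theorem LocLipField.integral_divergence [T2Space M] {X : ∀ x : M, Tan m x} (hX : LocLipField X)
    {K : Set M} (hK : IsCompact K) (h0 : ∀ x ∉ K, X x = 0) :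
    Integrable (divergence X) (vol m M) ∧ ∫ x, divergence X x ∂vol m M = 0 := by
  have : LocallyCompactSpace M := ChartedSpace.locallyCompactSpace (Model m) M
  obtain ⟨t, -, htK⟩ := hK.elim_nhds_subcover (fun x ↦ (extChartAt (𝓡 m) x).source)
    fun x _ ↦ extChartAt_source_mem_nhds x
  obtain ⟨f, hf⟩ := SmoothPartitionOfUnity.exists_isSubordinate (𝓡 m) hK.isClosed
    (fun i : t ↦ (extChartAt (𝓡 m) (i : M)).source) (fun i ↦ isOpen_extChartAt_source _)
    (fun x hx ↦ by
      obtain ⟨i, hi, hxi⟩ := mem_iUnion₂.1 (htK hx)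
      exact mem_iUnion.2 ⟨⟨i, hi⟩, hxi⟩)
  have hLip : ∀ i, LocLipField fun x ↦ f i x • X x := fun i ↦
    (locLip_of_contMDiff (f i).contMDiff).smul hX
  have hXs : X = fun x ↦ ∑ i, f i x • X x := by
    ext1 x
    by_cases hx : x ∈ K
    · rw [← Finset.sum_smul, ← finsum_eq_sum_of_fintype, f.sum_eq_one hx, one_smul]
    · rw [h0 x hx]
      simp
  have hi : ∀ i, Integrable (divergence fun x ↦ f i x • X x) (vol m M) ∧
      ∫ x, divergence (fun x ↦ f i x • X x) x ∂vol m M = 0 := fun i ↦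
    (hLip i).integral_divergence_of_subset (x₀ := (i : M))
      (hK.inter_right (isClosed_tsupport (f i))) (fun x hx ↦ hf i hx.2) fun x hx ↦ by
      by_cases hxK : x ∈ K
      · rw [image_eq_zero_of_notMem_tsupport fun h ↦ hx ⟨hxK, h⟩, zero_smul]
      · rw [h0 x hxK, smul_zero]
  -- Additivity of the divergence holds where all the pieces are differentiable, hence almost
  -- everywhere.
  have hae : divergence X =ᵐ[vol m M] fun x ↦ ∑ i, divergence (fun x ↦ f i x • X x) x := by
    filter_upwards [ae_all_iff.2 fun i ↦ (hLip i).ae_differentiableAt] with x hx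
    conv_lhs => rw [hXs]
    exact divergence_sum Finset.univ fun i _ ↦ hx i
  refine ⟨(integrable_finsetSum _ fun i _ ↦ (hi i).1).congr hae.symm, ?_⟩
  rw [integral_congr_ae hae, integral_finsetSum _ fun i _ ↦ (hi i).1]
  exact Finset.sum_eq_zero fun i _ ↦ (hi i).2

end DivergenceTheorem

/-! ### Regularity of the gradient and of the flux |∇u|^(p-2) ∇u. -/

noncomputable section PLaplacian

section Local

variable {E : Type*} [NormedAddCommGroup E] [NormedSpace ℝ E]

/-- At a common zero the product is o(1) · O(z - y), even where the power itself is not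
differentiable. -/
theorem hasFDerivAt_rpow_smul_zero {q : E → ℝ} {X : E → E} {α : ℝ} {y : E} (hα : 0 < α)
    (hq : ContinuousAt q y) (hq0 : q y = 0) (hX : DifferentiableAt ℝ X y) (hX0 : X y = 0) :
    HasFDerivAt (fun z ↦ q z ^ α • X z) (0 : E →L[ℝ] E) y := by
  have h1 : (fun z ↦ q z ^ α) =o[𝓝 y] fun _ ↦ (1 : ℝ) := by
    rw [Asymptotics.isLittleO_one_iff]
    have := hq.rpow_const (p := α) (Or.inr hα.le)
    rwa [ContinuousAt, hq0, Real.zero_rpow hα.ne'] at this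
  have h2 : X =O[𝓝 y] fun z ↦ z - y := by
    simpa [hX0] using hX.isBigO_sub
  have h3 := h1.smul_isBigO h2
  refine HasFDerivAt.of_isLittleO ?_
  simpa [hX0] using h3

variable {U : Set E} {G : E → E →L[ℝ] E →L[ℝ] ℝ} {Γ : E → E →L[ℝ] E →L[ℝ] E}

theorem LocalMetric.exists_hasFDerivAt_apply_self (hG : LocalMetric U G Γ) {X : E → E}
    {X' : E →L[ℝ] E} {y : E} (hy : y ∈ U) (hX : HasFDerivAt X X' y) :
    ∃ L : E →L[ℝ] ℝ, HasFDerivAt (fun z ↦ G z (X z) (X z)) L y ∧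
      ∀ v, L v = fderiv ℝ G y v (X y) (X y) + 2 * G y (X' v) (X y) := by
  refine ⟨_, ((hG.differentiableAt hy).hasFDerivAt.clm_apply hX).clm_apply hX, fun v ↦ ?_⟩
  simp [hG.symm y hy (X y) (X' v)]
  ring

/-- Write q = G(X, X). Where q > 0, the dangerous term of the derivative is α q^(α-1) dq ⊗ X. Since
‖dq‖ ≤ C ‖X‖ and ‖X‖² ≤ q / l, it is at most α (C/l) q^α, which stays bounded as q → 0. Where q = 0
the derivative vanishes, so the mean value inequality applies on a ball. -/
theorem LocalMetric.locallyLipschitzOn_rpow_smul [FiniteDimensional ℝ E] (hG : LocalMetric U G Γ)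
    {X : E → E} (hX : ContDiffOn ℝ 1 X U) {α : ℝ} (hα : 0 < α) :
    LocallyLipschitzOn U fun z ↦ G z (X z) (X z) ^ α • X z := by
  intro y₀ hy₀
  obtain ⟨R, hR, l, hl, -, -, hRU, hlG, -, -⟩ := hG.exists_bounds hy₀
  have hU := hG.isOpen.mem_nhds hy₀
  have bound : ∀ {F : Type _} [NormedAddCommGroup F] (f : E → F), ContinuousAt f y₀ →
      ∀ᶠ y in 𝓝 y₀, ‖f y‖ ≤ ‖f y₀‖ + 1 := fun f hf ↦
    (hf.norm.eventually (gt_mem_nhds (lt_add_one _))).mono fun _ h ↦ le_of_lt h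
  have b1 := bound (fderiv ℝ G) ((hG.contDiffOn_metric.continuousOn_fderiv_of_isOpen hG.isOpen
    (by norm_num)).continuousAt hU)
  have b2 := bound G (hG.contDiffOn_metric.continuousOn.continuousAt hU)
  have b3 := bound (fderiv ℝ X) ((hX.continuousOn_fderiv_of_isOpen hG.isOpen
    le_rfl).continuousAt hU)
  have b4 := bound X (hX.continuousOn.continuousAt hU)
  set A := ‖fderiv ℝ G y₀‖ + 1 with hA
  set B := ‖G y₀‖ + 1 with hB
  set D := ‖fderiv ℝ X y₀‖ + 1 with hD
  set N := ‖X y₀‖ + 1 with hN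
  obtain ⟨r, hr, hrs⟩ := Metric.mem_nhds_iff.1
    (inter_mem (closedBall_mem_nhds y₀ hR) (b1.and (b2.and (b3.and b4))))
  set Q := B * N * N with hQ
  set C := A * N + 2 * (B * D) with hC
  have hA0 : 0 ≤ A := by positivity
  have hB0 : 0 ≤ B := by positivity
  have hD0 : 0 ≤ D := by positivity
  have hN0 : 0 ≤ N := by positivity
  have hQ0 : 0 ≤ Q := by positivity
  have hC0 : 0 ≤ C := by positivity
  set K := Q ^ α * D + α * (C / l) * Q ^ α with hK
  have hK0 : 0 ≤ K := by positivity
  have key : ∀ y ∈ ball y₀ r, ∃ f' : E →L[ℝ] E,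
      HasFDerivAt (fun z ↦ G z (X z) (X z) ^ α • X z) f' y ∧ ‖f'‖ ≤ K := by
    intro y hy
    obtain ⟨hyR, h1, h2, h3, h4⟩ := hrs hy
    have hyU := hRU hyR
    have hX' : HasFDerivAt X (fderiv ℝ X y) y :=
      ((hX.contDiffAt (hG.isOpen.mem_nhds hyU)).differentiableAt one_ne_zero).hasFDerivAt
    obtain ⟨L, hL, hLv⟩ := hG.exists_hasFDerivAt_apply_self hyU hX'
    have hqQ : G y (X y) (X y) ≤ Q :=
      (le_abs_self _).trans (((G y).le_opNorm₂ _ _).trans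
        (mul_le_mul (mul_le_mul h2 h4 (norm_nonneg _) hB0) h4 (norm_nonneg _) (by positivity)))
    rcases (hG.nonneg hyU (X y)).eq_or_lt with hq | hq
    · have hX0 : X y = 0 := by
        by_contra h
        exact (hG.pos y hyU _ h).ne hq
      exact ⟨0, hasFDerivAt_rpow_smul_zero hα hL.continuousAt hq.symm hX'.differentiableAt hX0,
        by simpa using hK0⟩
    · refine ⟨_, (hL.rpow_const (Or.inl hq.ne')).smul hX', ?_⟩
      have hLn : ‖L‖ ≤ C * ‖X y‖ := by
        refine L.opNorm_le_bound (by positivity) fun v ↦ ?_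
        rw [hLv]
        refine (norm_add_le _ _).trans ?_
        have e1 : ‖fderiv ℝ G y v (X y) (X y)‖ ≤ A * ‖v‖ * ‖X y‖ * N := by
          refine ((fderiv ℝ G y v).le_opNorm₂ _ _).trans ?_
          gcongr
          exact (ContinuousLinearMap.le_opNorm _ _).trans (by gcongr)
        have e2 : ‖2 * G y (fderiv ℝ X y v) (X y)‖ ≤ 2 * (B * (D * ‖v‖) * ‖X y‖) := by
          rw [norm_mul, Real.norm_ofNat]
          gcongr
          refine ((G y).le_opNorm₂ _ _).trans ?_
          gcongr
          exact (ContinuousLinearMap.le_opNorm _ _).trans (by gcongr)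
        refine (add_le_add e1 e2).trans_eq ?_
        rw [hC]
        ring
      refine (norm_add_le _ _).trans ?_
      rw [norm_smul, ContinuousLinearMap.norm_smulRight_apply, norm_smul, Real.norm_of_nonneg,
        Real.norm_of_nonneg]
      · rw [hK]
        have e1 : G y (X y) (X y) ^ α ≤ Q ^ α := Real.rpow_le_rpow hq.le hqQ hα.le
        refine add_le_add (mul_le_mul e1 h3 (norm_nonneg _) (by positivity)) ?_
        have e2 : ‖X y‖ ^ 2 ≤ G y (X y) (X y) / l := by
          rw [le_div_iff₀ hl, mul_comm]
          exact hlG y hyR (X y)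
        calc α * G y (X y) (X y) ^ (α - 1) * ‖L‖ * ‖X y‖
            ≤ α * G y (X y) (X y) ^ (α - 1) * (C * ‖X y‖) * ‖X y‖ := by gcongr
          _ = α * G y (X y) (X y) ^ (α - 1) * C * ‖X y‖ ^ 2 := by ring
          _ ≤ α * G y (X y) (X y) ^ (α - 1) * C * (G y (X y) (X y) / l) := by gcongr
          _ = α * (C / l) * (G y (X y) (X y) ^ (α - 1) * G y (X y) (X y)) := by ring
          _ = α * (C / l) * G y (X y) (X y) ^ α := by
            rw [Real.rpow_sub_one hq.ne', div_mul_cancel₀ _ hq.ne']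
          _ ≤ _ := by gcongr
      · positivity
      · positivity
  refine ⟨K.toNNReal, ball y₀ r, mem_nhdsWithin_of_mem_nhds (ball_mem_nhds _ hr), ?_⟩
  refine (convex_ball y₀ r).lipschitzOnWith_of_nnnorm_fderiv_le (𝕜 := ℝ) (fun y hy ↦ ?_)
    fun y hy ↦ ?_
  · obtain ⟨f', hf', -⟩ := key y hy
    exact hf'.differentiableAt
  · obtain ⟨f', hf', hb⟩ := key y hy
    rw [hf'.fderiv]
    rw [← NNReal.coe_le_coe, Real.coe_toNNReal _ hK0]
    exact hb

end Local

variable {m : ℕ} {M : Type*} [TopologicalSpace M] [ChartedSpace (Model m) M]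
  [IsManifold (𝓡 m) ∞ M] [RiemannianBundle (fun x : M ↦ Tan m x)]
  [IsContMDiffRiemannianBundle (𝓡 m) ∞ (Model m) (fun x : M ↦ Tan m x)]

theorem inner_grad (u : M → ℝ) (x : M) (v : Tan m x) :
    inner ℝ (grad u x) v = (mfderiv (𝓡 m) 𝓘(ℝ, ℝ) u x : Tan m x →L[ℝ] ℝ) v := by
  have : CompleteSpace (Tan m x) := FiniteDimensional.complete ℝ _
  exact InnerProductSpace.toDual_symm_apply

theorem fderiv_comp_symm {u : M → ℝ} {x₀ : M} {y : Model m}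
    (hy : y ∈ (extChartAt (𝓡 m) x₀).target)
    (hu : MDifferentiableAt (𝓡 m) 𝓘(ℝ, ℝ) u ((extChartAt (𝓡 m) x₀).symm y)) (w : Model m) :
    fderiv ℝ (fun z ↦ u ((extChartAt (𝓡 m) x₀).symm z)) y w
      = inner ℝ (grad u ((extChartAt (𝓡 m) x₀).symm y)) (chartDSymm x₀ y w) := by
  rw [inner_grad]
  have h := hu.hasMFDerivAt.comp y (mdifferentiableAt_symm hy).hasMFDerivAt
  obtain ⟨L, hL, hLw⟩ : ∃ L : Model m →L[ℝ] ℝ,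
      HasFDerivAt (fun z ↦ u ((extChartAt (𝓡 m) x₀).symm z)) L y ∧
      ∀ w, L w = (mfderiv (𝓡 m) 𝓘(ℝ, ℝ) u ((extChartAt (𝓡 m) x₀).symm y) :
        Tan m ((extChartAt (𝓡 m) x₀).symm y) →L[ℝ] ℝ) (chartDSymm x₀ y w) :=
    ⟨_, hasMFDerivAt_iff_hasFDerivAt.1 h, fun _ ↦ rfl⟩
  rw [hL.fderiv, hLw]

theorem metricForm_chartField_grad {u : M → ℝ} {x₀ : M} {y : Model m}
    (hy : y ∈ (extChartAt (𝓡 m) x₀).target)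
    (hu : MDifferentiableAt (𝓡 m) 𝓘(ℝ, ℝ) u ((extChartAt (𝓡 m) x₀).symm y)) (w : Model m) :
    metricForm x₀ y (chartField x₀ (fun x ↦ grad u x) y) w
      = fderiv ℝ (fun z ↦ u ((extChartAt (𝓡 m) x₀).symm z)) y w := by
  rw [fderiv_comp_symm hy hu, ← inner_chartDSymm, chartField, chartDSymm_chartD hy]

theorem metricForm_chartField_self {X : ∀ x : M, Tan m x} {x₀ : M} {y : Model m}
    (hy : y ∈ (extChartAt (𝓡 m) x₀).target) :
    metricForm x₀ y (chartField x₀ X y) (chartField x₀ X y)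
      = ‖X ((extChartAt (𝓡 m) x₀).symm y)‖ ^ 2 := by
  rw [← inner_chartDSymm, chartField, chartDSymm_chartD hy, real_inner_self_eq_norm_sq]

/-- In coordinates the gradient is the inverse gram matrix applied to the partial derivatives of u.
-/
theorem contDiffOn_chartField_grad {u : M → ℝ} (hu : ContMDiff (𝓡 m) 𝓘(ℝ, ℝ) ∞ u) (x₀ : M) :
    ContDiffOn ℝ ∞ (chartField x₀ fun x ↦ grad u x) (extChartAt (𝓡 m) x₀).target := by
  rw [contDiffOn_euclidean]
  intro k
  have hpd : ∀ l, ContDiffOn ℝ ∞ (partialDeriv l fun z ↦ u ((extChartAt (𝓡 m) x₀).symm z))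
      (extChartAt (𝓡 m) x₀).target := fun l ↦
    contDiffOn_partialDeriv (isOpen_target x₀) (contDiffOn_comp_symm hu x₀) l
  have : ContDiffOn ℝ ∞ (fun y ↦ ∑ l, (gram x₀ y)⁻¹ k l *
      partialDeriv l (fun z ↦ u ((extChartAt (𝓡 m) x₀).symm z)) y) (extChartAt (𝓡 m) x₀).target :=
    ContDiffOn.sum fun l _ ↦ (contDiffOn_gram_inv x₀ k l).mul (hpd l)
  refine this.congr fun y hy ↦ ?_
  set V : Fin m → ℝ := fun i ↦ chartField x₀ (fun x ↦ grad u x) y i with hV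
  have h1 : (gram x₀ y).mulVec V
      = fun l ↦ partialDeriv l (fun z ↦ u ((extChartAt (𝓡 m) x₀).symm z)) y := by
    ext l
    rw [partialDeriv, ← metricForm_chartField_grad hy (hu.mdifferentiable (by simp) _),
      metricForm_apply, Matrix.mulVec, dotProduct]
    refine Finset.sum_congr rfl fun i _ ↦ ?_
    simp [gram_symm x₀ y l i, hV]
  have h2 : (gram x₀ y)⁻¹.mulVec ((gram x₀ y).mulVec V) = V := by
    rw [Matrix.mulVec_mulVec, Matrix.nonsing_inv_mul _ (det_gram_pos hy).ne'.isUnit,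
      Matrix.one_mulVec]
  rw [h1] at h2
  exact congrFun h2.symm k

theorem rpow_gradNorm (u : M → ℝ) (p : ℝ) {x₀ : M} {y : Model m}
    (hy : y ∈ (extChartAt (𝓡 m) x₀).target) :
    gradNorm m u ((extChartAt (𝓡 m) x₀).symm y) ^ (p - 2)
      = metricForm x₀ y (chartField x₀ (fun x ↦ grad u x) y) (chartField x₀ (fun x ↦ grad u x) y)
        ^ ((p - 2) / 2) := by
  rw [metricForm_chartField_self hy, gradNorm, ← Real.rpow_natCast, ← Real.rpow_mul (norm_nonneg _)]
  congr 1
  push_cast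
  ring

theorem continuous_gradNorm {u : M → ℝ} (hu : ContMDiff (𝓡 m) 𝓘(ℝ, ℝ) ∞ u) :
    Continuous (gradNorm m u) := by
  rw [continuous_iff_continuousAt]
  intro x
  have hx := mem_extChartAt_source (I := 𝓡 m) x
  have hX := (contDiffOn_chartField_grad hu x).continuousOn
  have h1 : ContinuousOn (fun y ↦ √(metricForm x y (chartField x (fun x ↦ grad u x) y)
      (chartField x (fun x ↦ grad u x) y))) (extChartAt (𝓡 m) x).target :=
    Real.continuous_sqrt.comp_continuousOn
      (((contDiffOn_metricForm x).continuousOn.clm_apply hX).clm_apply hX)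
  have h2 : ContinuousAt (fun z ↦ √(metricForm x (extChartAt (𝓡 m) x z)
      (chartField x (fun x ↦ grad u x) (extChartAt (𝓡 m) x z))
      (chartField x (fun x ↦ grad u x) (extChartAt (𝓡 m) x z)))) x :=
    ContinuousAt.comp (f := extChartAt (𝓡 m) x)
      (h1.continuousAt ((isOpen_target x).mem_nhds (mem_extChartAt_target x)))
      (continuousAt_extChartAt x)
  refine h2.congr ?_
  filter_upwards [(isOpen_extChartAt_source x).mem_nhds hx] with z hz
  rw [metricForm_chartField_self ((extChartAt (𝓡 m) x).map_source hz), Real.sqrt_sq (norm_nonneg _),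
    (extChartAt (𝓡 m) x).left_inv hz]
  rfl

theorem locLipField_grad {u : M → ℝ} (hu : ContMDiff (𝓡 m) 𝓘(ℝ, ℝ) ∞ u) :
    LocLipField fun x : M ↦ (grad u x : Tan m x) := fun x₀ ↦
  locallyLipschitzOn_of_contDiffOn (isOpen_target x₀)
    ((contDiffOn_chartField_grad hu x₀).of_le (by exact_mod_cast le_top))

/-- `LocalMetric.locallyLipschitzOn_rpow_smul` requires a positive exponent, here (p - 2)/2 because
the metric form gives the square of the norm; for p = 2 the field is the gradient itself. -/
theorem locLipField_rpow_smul_grad {u : M → ℝ} (hu : ContMDiff (𝓡 m) 𝓘(ℝ, ℝ) ∞ u) {p : ℝ}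
    (hp : 2 ≤ p) : LocLipField fun x : M ↦ (gradNorm m u x ^ (p - 2) • grad u x : Tan m x) := by
  rcases hp.eq_or_lt with rfl | hp
  · simp only [sub_self, Real.rpow_zero, one_smul]
    exact locLipField_grad hu
  · intro x₀
    have h := (localMetric x₀).locallyLipschitzOn_rpow_smul
      ((contDiffOn_chartField_grad hu x₀).of_le (by exact_mod_cast le_top))
      (show 0 < (p - 2) / 2 by linarith)
    intro y hy
    obtain ⟨K, t, ht, hK⟩ := h hy
    refine ⟨K, t ∩ (extChartAt (𝓡 m) x₀).target, inter_mem ht self_mem_nhdsWithin,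
      fun z hz w hw ↦ ?_⟩
    rw [chartField_smul]
    dsimp only
    rw [rpow_gradNorm u p hz.2, rpow_gradNorm u p hw.2]
    exact hK hz.1 hw.1

end PLaplacian

/-! ### The Hessian, and the p-Laplacian in terms of it. -/

noncomputable section Hessian

/-- Cauchy-Schwarz for the matrix entries of B against the products of coordinates of v. -/
theorem abs_apply_self_le {V ι : Type*} [NormedAddCommGroup V] [InnerProductSpace ℝ V] [Fintype ι]
    (e : OrthonormalBasis ι ℝ V) (B : V →ₗ[ℝ] V →ₗ[ℝ] ℝ) (v : V) :
    |B v v| ≤ √(∑ i, ∑ j, B (e i) (e j) ^ 2) * ‖v‖ ^ 2 := by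
  set a := fun i ↦ inner ℝ (e i) v with ha
  have hv : v = ∑ i, a i • e i := (e.sum_repr' v).symm
  have hexp : B v v = ∑ i, ∑ j, (a i * a j) * B (e i) (e j) := by
    conv_lhs => rw [hv]
    simp only [map_sum, map_smul, LinearMap.sum_apply, LinearMap.smul_apply, smul_eq_mul,
      Finset.mul_sum]
    rw [Finset.sum_comm]
    exact Finset.sum_congr rfl fun i _ ↦ Finset.sum_congr rfl fun j _ ↦ by ring
  have hnorm : ∑ i, a i ^ 2 = ‖v‖ ^ 2 := by
    have := e.sum_sq_norm_inner_right v
    simpa using this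
  have hcs := Finset.sum_mul_sq_le_sq_mul_sq Finset.univ (fun ij : ι × ι ↦ a ij.1 * a ij.2)
    fun ij ↦ B (e ij.1) (e ij.2)
  simp only [Fintype.sum_prod_type, mul_pow] at hcs
  have h1 : ∑ i, ∑ j, a i ^ 2 * a j ^ 2 = (‖v‖ ^ 2) ^ 2 := by
    rw [← hnorm, sq (∑ i, a i ^ 2), Finset.sum_mul_sum]
  rw [← hexp, h1] at hcs
  refine abs_le_of_sq_le_sq ?_ (by positivity)
  rw [mul_pow, Real.sq_sqrt (Finset.sum_nonneg fun i _ ↦ Finset.sum_nonneg fun j _ ↦ sq_nonneg _)]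
  linarith

variable {m : ℕ} {M : Type*} [TopologicalSpace M] [ChartedSpace (Model m) M]
  [IsManifold (𝓡 m) ∞ M] [RiemannianBundle (fun x : M ↦ Tan m x)]
  [IsContMDiffRiemannianBundle (𝓡 m) ∞ (Model m) (fun x : M ↦ Tan m x)]

theorem chartD_covDeriv {X : ∀ x : M, Tan m x} {x : M} {X' : Model m →L[ℝ] Model m}
    (hX : HasFDerivAt (chartField x X) X' (extChartAt (𝓡 m) x x)) (v : Tan m x) :
    chartD x x (covDeriv X x v) = X' (chartD x x v)
      + christoffelForm x (extChartAt (𝓡 m) x x) (chartD x x v)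
        (chartField x X (extChartAt (𝓡 m) x x)) := by
  rw [chartD_self]
  ext k
  have h := ((EuclideanSpace.proj (𝕜 := ℝ) k : Model m →L[ℝ] ℝ).hasFDerivAt
    (x := chartField x X (extChartAt (𝓡 m) x x))).comp _ hX
  have h2 : X' (chartD x x v) k = fderiv ℝ (fun z ↦ component x k
      (X ((extChartAt (𝓡 m) x).symm z))) (extChartAt (𝓡 m) x x) (chartD x x v) := by
    rw [show (fun z ↦ component x k (X ((extChartAt (𝓡 m) x).symm z)))
      = (EuclideanSpace.proj (𝕜 := ℝ) k : Model m →L[ℝ] ℝ) ∘ chartField x X from rfl, h.fderiv]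
    rfl
  rw [PiLp.add_apply, christoffelForm_apply, h2, fderiv_eq_sum_partialDeriv,
    chartField_apply X (mem_extChartAt_source x)]
  rfl

theorem differentiableAt_chartField_grad {u : M → ℝ} (hu : ContMDiff (𝓡 m) 𝓘(ℝ, ℝ) ∞ u) (x : M) :
    DifferentiableAt ℝ (chartField x fun x ↦ grad u x) (extChartAt (𝓡 m) x x) :=
  ((contDiffOn_chartField_grad hu x).contDiffAt
    ((isOpen_target x).mem_nhds (mem_extChartAt_target x))).differentiableAt (by simp)

theorem hessian_eq {u : M → ℝ} (hu : ContMDiff (𝓡 m) 𝓘(ℝ, ℝ) ∞ u) (x : M) (v w : Tan m x) :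
    hessian u x v w = metricForm x (extChartAt (𝓡 m) x x)
      (fderiv ℝ (chartField x fun x ↦ grad u x) (extChartAt (𝓡 m) x x) (chartD x x v)
        + christoffelForm x (extChartAt (𝓡 m) x x) (chartD x x v)
          (chartField x (fun x ↦ grad u x) (extChartAt (𝓡 m) x x))) (chartD x x w) := by
  rw [hessian, inner_eq_metricForm (mem_extChartAt_source x),
    chartD_covDeriv (differentiableAt_chartField_grad hu x).hasFDerivAt]

theorem abs_hessian_self_le {u : M → ℝ} (hu : ContMDiff (𝓡 m) 𝓘(ℝ, ℝ) ∞ u) (x : M) (v : Tan m x) :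
    |hessian u x v v| ≤ hessianNorm m u x * ‖v‖ ^ 2 := by
  let B : Tan m x →ₗ[ℝ] Tan m x →ₗ[ℝ] ℝ := LinearMap.mk₂ ℝ (hessian u x)
    (fun v v' w ↦ by
      simp only [hessian_eq hu, map_add, add_apply]
      ring)
    (fun c v w ↦ by
      simp only [hessian_eq hu, map_smul, map_add, add_apply, smul_apply, smul_eq_mul]
      ring)
    (fun v w w' ↦ by
      simp only [hessian_eq hu, map_add])
    (fun c v w ↦ by
      simp only [hessian_eq hu, map_smul])
  exact abs_apply_self_le (stdOrthonormalBasis ℝ (Tan m x)) B v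

/-- Metric compatibility: d|∇u|²(∇u) = 2 (∇_{∇u} ∇u, ∇u), the Koszul identity turning the derivative
of the metric into the Christoffel term. -/
theorem hessian_grad_grad {u : M → ℝ} (hu : ContMDiff (𝓡 m) 𝓘(ℝ, ℝ) ∞ u) (x : M)
    {L : Model m →L[ℝ] ℝ} (hL : HasFDerivAt (fun z ↦ metricForm x z
      (chartField x (fun x ↦ grad u x) z) (chartField x (fun x ↦ grad u x) z)) L
      (extChartAt (𝓡 m) x x)) :
    L (chartField x (fun x ↦ grad u x) (extChartAt (𝓡 m) x x))
      = 2 * hessian u x (grad u x : Tan m x) (grad u x) := by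
  have hy := mem_extChartAt_target (I := 𝓡 m) x
  obtain ⟨L', hL', hv⟩ := (localMetric x).exists_hasFDerivAt_apply_self hy
    (differentiableAt_chartField_grad hu x).hasFDerivAt
  rw [hL.unique hL', hv, hessian_eq hu,
    ← chartField_apply (fun x : M ↦ (grad u x : Tan m x)) (mem_extChartAt_source x)]
  have hk := (localMetric x).koszul _ hy (chartField x (fun x ↦ grad u x) (extChartAt (𝓡 m) x x))
    (chartField x (fun x ↦ grad u x) (extChartAt (𝓡 m) x x))
    (chartField x (fun x ↦ grad u x) (extChartAt (𝓡 m) x x))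
  simp only [map_add, add_apply]
  linarith

/-- The `p`-Laplacian differs from `|∇u|^(p-2) Δu` by a term controlled by the Hessian. -/
theorem abs_pLaplacian_sub_le {u : M → ℝ} (hu : ContMDiff (𝓡 m) 𝓘(ℝ, ℝ) ∞ u) {p : ℝ} (hp : 2 ≤ p)
    (x : M) :
    |pLaplacian m p u x - gradNorm m u x ^ (p - 2) * laplacian m u x|
      ≤ (p - 2) * (gradNorm m u x ^ (p - 2) * hessianNorm m u x) := by
  rcases hp.eq_or_lt with rfl | hp
  · simp [pLaplacian, laplacian]
  have hy := mem_extChartAt_target (I := 𝓡 m) x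
  have hX := differentiableAt_chartField_grad hu x
  have hXy := chartField_apply (fun x : M ↦ (grad u x : Tan m x))
    (mem_extChartAt_source (I := 𝓡 m) x)
  obtain ⟨L, hL, -⟩ := (localMetric x).exists_hasFDerivAt_apply_self hy hX.hasFDerivAt
  have hq : metricForm x (extChartAt (𝓡 m) x x)
      (chartField x (fun x ↦ grad u x) (extChartAt (𝓡 m) x x))
      (chartField x (fun x ↦ grad u x) (extChartAt (𝓡 m) x x)) = gradNorm m u x ^ 2 := by
    rw [metricForm_chartField_self hy, extChartAt_to_inv]
    rfl
  have hev : ∀ᶠ z in 𝓝 (extChartAt (𝓡 m) x x), z ∈ (extChartAt (𝓡 m) x).target :=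
    (isOpen_target x).mem_nhds hy
  -- At a critical point the flux vanishes together with its derivative, so the p-Laplacian is 0,
  -- and so is |∇u|^(p-2) as p > 2. Elsewhere the power is differentiable and the Leibniz rule
  -- applies.
  rcases eq_or_ne (grad u x : Tan m x) 0 with h0 | h0
  · have hg : gradNorm m u x = 0 := by rw [gradNorm, h0, norm_zero]
    have hX0 : chartField x (fun x ↦ grad u x) (extChartAt (𝓡 m) x x) = 0 := by
      rw [hXy, h0, map_zero]
    have hd := hasFDerivAt_rpow_smul_zero (show 0 < (p - 2) / 2 by linarith) hL.continuousAt
      (by rw [hq, hg]; simp) hX hX0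
    have hd' : HasFDerivAt (chartField x fun x ↦ gradNorm m u x ^ (p - 2) • grad u x)
        (0 : Model m →L[ℝ] Model m) (extChartAt (𝓡 m) x x) := by
      refine hd.congr_of_eventuallyEq ?_
      filter_upwards [hev] with z hz
      rw [chartField_smul]
      dsimp only
      rw [rpow_gradNorm u p hz]
    have hY0 : chartField x (fun x ↦ gradNorm m u x ^ (p - 2) • grad u x) (extChartAt (𝓡 m) x x)
        = 0 := by
      rw [chartField_smul]
      change _ • chartField x (fun x ↦ grad u x) _ = _
      rw [hX0, smul_zero]
    have hW := (differentiableAt_density hy).hasFDerivAt.smul hd'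
    have hpl : pLaplacian m p u x = 0 := by
      rw [pLaplacian, divergence_eq_trace hW, hY0]
      simp
    rw [hpl, hg, Real.zero_rpow (by linarith)]
    simp
  · have hg : 0 < gradNorm m u x := norm_pos_iff.2 h0
    have hqpos : metricForm x (extChartAt (𝓡 m) x x)
        (chartField x (fun x ↦ grad u x) (extChartAt (𝓡 m) x x))
        (chartField x (fun x ↦ grad u x) (extChartAt (𝓡 m) x x)) ≠ 0 := by
      rw [hq]; positivity
    have hh : HasFDerivAt (fun z ↦ gradNorm m u ((extChartAt (𝓡 m) x).symm z) ^ (p - 2)) _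
        (extChartAt (𝓡 m) x x) :=
      (hL.rpow_const (p := (p - 2) / 2) (Or.inl hqpos)).congr_of_eventuallyEq (by
        filter_upwards [hev] with z hz
        exact rpow_gradNorm u p hz)
    have hdiv := divergence_smul (h := fun x ↦ gradNorm m u x ^ (p - 2)) hh.differentiableAt hX
    have hpow : (p - 2) / 2 * (gradNorm m u x ^ 2) ^ ((p - 2) / 2 - 1)
        = (p - 2) / 2 * (gradNorm m u x ^ (p - 2) / gradNorm m u x ^ 2) := by
      rw [← Real.rpow_natCast, ← Real.rpow_mul hg.le, ← Real.rpow_sub hg]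
      congr 2
      push_cast
      ring
    rw [hh.fderiv, smul_apply, hessian_grad_grad hu x hL, hq, smul_eq_mul, hpow] at hdiv
    have hpl : pLaplacian m p u x - gradNorm m u x ^ (p - 2) * laplacian m u x
        = -((p - 2) * (gradNorm m u x ^ (p - 2)
          * (hessian u x (grad u x : Tan m x) (grad u x) / gradNorm m u x ^ 2))) := by
      rw [pLaplacian, hdiv, laplacian]
      field_simp
      ring
    rw [hpl, abs_neg, abs_mul, abs_mul, abs_of_nonneg (show 0 ≤ p - 2 by linarith),
      abs_of_nonneg (show 0 ≤ gradNorm m u x ^ (p - 2) by positivity)]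
    gcongr
    rw [abs_div, abs_of_pos (show 0 < gradNorm m u x ^ 2 by positivity),
      div_le_iff₀ (by positivity)]
    exact abs_hessian_self_le hu x _

end Hessian

/-! ### Distance cutoffs and the pointwise inequality. -/

noncomputable section Cutoff

/-- Young's inequality with a crude constant: replace the smaller number by the larger. The constant
is irrelevant, as the term carries a factor p/R. -/
theorem mul_rpow_sub_one_le_add {a b p : ℝ} (ha : 0 ≤ a) (hb : 0 ≤ b) (hp : 1 ≤ p) :
    a * b ^ (p - 1) ≤ a ^ p + b ^ p := by
  have hpow : ∀ {c : ℝ}, 0 ≤ c → c * c ^ (p - 1) = c ^ p := fun {c} hc ↦ by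
    have := Real.rpow_add_of_nonneg hc zero_le_one (sub_nonneg.2 hp)
    rw [Real.rpow_one] at this
    rw [← this, add_sub_cancel]
  have ha' := Real.rpow_nonneg ha p
  have hb' := Real.rpow_nonneg hb p
  rcases le_total a b with h | h
  · have := mul_le_mul_of_nonneg_right h (Real.rpow_nonneg hb (p - 1))
    rw [hpow hb] at this
    linarith
  · have := mul_le_mul_of_nonneg_left (Real.rpow_le_rpow hb h (sub_nonneg.2 hp)) ha
    rw [hpow ha] at this
    linarith

variable {m : ℕ} {M : Type*} [TopologicalSpace M] [ChartedSpace (Model m) M]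
  [IsManifold (𝓡 m) ∞ M] [RiemannianBundle (fun x : M ↦ Tan m x)]
  [IsContMDiffRiemannianBundle (𝓡 m) ∞ (Model m) (fun x : M ↦ Tan m x)]
  [ConnectedSpace M] [T2Space M]

/-- A function which is Lipschitz for the Riemannian distance is locally Lipschitz in charts. -/
theorem locLip_of_abs_sub_le {f : M → ℝ} {C : ℝ} (hC : 0 ≤ C)
    (hf : ∀ x y, |f x - f y| ≤ C * rdist m x y) : LocLip m f := by
  intro x₀ y₀ hy₀
  obtain ⟨r, hr, hrd⟩ := eventually_rdist_symm_le hy₀ one_pos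
  set G := metricForm x₀ y₀ with hG
  refine ⟨Real.toNNReal (C * (2 * √‖G‖)), ball y₀ r,
    mem_nhdsWithin_of_mem_nhds (ball_mem_nhds _ hr), LipschitzOnWith.of_dist_le_mul ?_⟩
  intro y hy z hz
  rw [Real.coe_toNNReal _ (by positivity), dist_comm y z, dist_eq_norm z y, Real.dist_eq]
  refine (hf _ _).trans ?_
  rw [mul_assoc]
  refine mul_le_mul_of_nonneg_left ((hrd y hy z hz).trans ?_) hC
  have h1 : √(G (z - y) (z - y)) ≤ √‖G‖ * ‖z - y‖ := by
    rw [← Real.sqrt_sq (norm_nonneg (z - y)), ← Real.sqrt_mul (norm_nonneg _)]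
    refine Real.sqrt_le_sqrt ?_
    rw [pow_two, ← mul_assoc]
    exact (le_abs_self _).trans (G.le_opNorm₂ (z - y) (z - y))
  rw [mul_assoc]
  linarith

/-- Difference quotients along a coordinate line, where the distance is at most 1 + ε times the
metric norm; then ε → 0. The bound is in the metric norm, so the cutoff has gradient at most 1/R
wherever it is differentiable. -/
theorem abs_fderiv_le_of_abs_sub_le {f : M → ℝ} {C : ℝ} (hC : 0 ≤ C)
    (hf : ∀ x y, |f x - f y| ≤ C * rdist m x y) {x : M}
    (hd : DifferentiableAt ℝ (fun y ↦ f ((extChartAt (𝓡 m) x).symm y)) (extChartAt (𝓡 m) x x))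
    (w : Model m) :
    |fderiv ℝ (fun y ↦ f ((extChartAt (𝓡 m) x).symm y)) (extChartAt (𝓡 m) x x) w|
      ≤ C * √(metricForm x (extChartAt (𝓡 m) x x) w w) := by
  set y₀ := extChartAt (𝓡 m) x x with hy₀
  set G := metricForm x y₀ with hG
  have hline : HasDerivAt (fun t : ℝ ↦ y₀ + t • w) w 0 := by
    simpa using ((hasDerivAt_id (0 : ℝ)).smul_const w).const_add y₀
  have hder : HasDerivAt (fun t : ℝ ↦ f ((extChartAt (𝓡 m) x).symm (y₀ + t • w)))
      (fderiv ℝ (fun y ↦ f ((extChartAt (𝓡 m) x).symm y)) y₀ w) 0 := by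
    have h0 : y₀ = y₀ + (0 : ℝ) • w := by simp
    have hd' := hd.hasFDerivAt
    rw [h0] at hd'
    have := hd'.comp_hasDerivAt (0 : ℝ) hline
    rw [← h0] at this
    exact this
  have key : ∀ ε > 0, |fderiv ℝ (fun y ↦ f ((extChartAt (𝓡 m) x).symm y)) y₀ w|
      ≤ C * ((1 + ε) * √(G w w)) := by
    intro ε hε
    obtain ⟨r, hr, hrd⟩ := eventually_rdist_symm_le (mem_extChartAt_target (I := 𝓡 m) x) hε
    refine hder.le_of_lip' (by positivity) ?_
    have hev : ∀ᶠ t : ℝ in 𝓝 0, y₀ + t • w ∈ ball y₀ r :=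
      hline.continuousAt.eventually_mem (by simpa using ball_mem_nhds y₀ hr)
    filter_upwards [hev] with t ht
    rw [Real.norm_eq_abs, sub_zero, zero_smul, add_zero, abs_sub_comm]
    refine (hf _ _).trans ?_
    rw [mul_assoc]
    refine mul_le_mul_of_nonneg_left ((hrd _ (mem_ball_self hr) _ ht).trans (le_of_eq ?_)) hC
    rw [add_sub_cancel_left, map_smul, map_smul, smul_apply, smul_eq_mul,
      smul_eq_mul, ← mul_assoc, Real.sqrt_mul (mul_self_nonneg t), Real.sqrt_mul_self_eq_abs,
      Real.norm_eq_abs]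
    ring
  have hlim : Tendsto (fun ε : ℝ ↦ C * ((1 + ε) * √(G w w))) (𝓝[>] 0)
      (𝓝 (C * ((1 + 0) * √(G w w)))) := by
    refine Tendsto.mono_left (Continuous.tendsto ?_ 0) nhdsWithin_le_nhds
    fun_prop
  rw [add_zero, one_mul] at hlim
  exact ge_of_tendsto hlim (by filter_upwards [self_mem_nhdsWithin] with ε hε using key ε hε)

/-- A cutoff function which is `1` where `rdist m o x ≤ R` and `0` where `rdist m o x ≥ 2 * R`. -/
def cutoff (m : ℕ) [ChartedSpace (Model m) M] [RiemannianBundle (fun x : M ↦ Tan m x)]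
    (o : M) (R : ℝ) (x : M) : ℝ :=
  max 0 (min 1 (2 - rdist m o x / R))

theorem cutoff_nonneg (o : M) (R : ℝ) (x : M) : 0 ≤ cutoff m o R x := le_max_left _ _

theorem cutoff_le_one (o : M) (R : ℝ) (x : M) : cutoff m o R x ≤ 1 :=
  max_le zero_le_one (min_le_left _ _)

theorem cutoff_eq_one {o : M} {R : ℝ} (hR : 0 < R) {x : M} (h : rdist m o x ≤ R) :
    cutoff m o R x = 1 := by
  have : rdist m o x / R ≤ 1 := (div_le_one hR).2 h
  rw [cutoff, min_eq_left (by linarith), max_eq_right zero_le_one]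

theorem cutoff_eq_zero {o : M} {R : ℝ} (hR : 0 < R) {x : M} (h : 2 * R < rdist m o x) :
    cutoff m o R x = 0 := by
  have : 2 < rdist m o x / R := (lt_div_iff₀ hR).2 h
  rw [cutoff, max_eq_left]
  exact (min_le_right _ _).trans (by linarith)

theorem abs_cutoff_sub_le {o : M} {R : ℝ} (hR : 0 < R) (x y : M) :
    |cutoff m o R x - cutoff m o R y| ≤ R⁻¹ * rdist m x y := by
  have h1 : |cutoff m o R x - cutoff m o R y|
      ≤ |(2 - rdist m o x / R) - (2 - rdist m o y / R)| := by
    refine (abs_max_sub_max_le_max _ _ _ _).trans ?_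
    rw [sub_self, abs_zero, max_eq_right (abs_nonneg _)]
    refine (abs_min_sub_min_le_max _ _ _ _).trans ?_
    rw [sub_self, abs_zero, max_eq_right (abs_nonneg _)]
  refine h1.trans ?_
  have h2 : (2 - rdist m o x / R) - (2 - rdist m o y / R)
      = R⁻¹ * (rdist m o y - rdist m o x) := by
    field_simp
    ring
  rw [h2, abs_mul, abs_of_pos (inv_pos.2 hR), abs_sub_comm]
  exact mul_le_mul_of_nonneg_left (abs_rdist_sub_le o x y) (inv_pos.2 hR).le

theorem continuous_cutoff (o : M) (R : ℝ) : Continuous (cutoff m o R) := by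
  have := continuous_rdist (m := m) o
  unfold cutoff
  fun_prop

theorem locLip_cutoff {o : M} {R : ℝ} (hR : 0 < R) : LocLip m (cutoff m o R) :=
  locLip_of_abs_sub_le (inv_pos.2 hR).le (abs_cutoff_sub_le hR)

theorem LocLip.rpow {h : M → ℝ} (hh : LocLip m h) {p : ℝ} (hp : 1 ≤ p) :
    LocLip m fun x ↦ h x ^ p := fun x₀ ↦
  locallyLipschitzOn_comp
    ((Real.contDiff_rpow_const_of_le (n := 1) (by exact_mod_cast hp)).locallyLipschitz) (hh x₀)

/-- By the Leibniz rule, with c the cutoff and g = |∇u|, the divergence is (c g)^p - c^p u Δ_p u + p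
c^(p-1) u g^(p-2) dc(∇u). The second term is bounded using c ≤ 1, the third by Young's inequality.
-/
theorem divergence_cutoff_smul_ge {u : M → ℝ} (hu : ContMDiff (𝓡 m) 𝓘(ℝ, ℝ) ∞ u) {p : ℝ}
    (hp : 2 ≤ p) {o : M} {R : ℝ} (hR : 0 < R) {x : M}
    (hc : DifferentiableAt ℝ (fun y ↦ cutoff m o R ((extChartAt (𝓡 m) x).symm y))
      (extChartAt (𝓡 m) x x))
    (hY : DifferentiableAt ℝ
      (chartField x fun y ↦ (gradNorm m u y ^ (p - 2) • grad u y : Tan m y))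
      (extChartAt (𝓡 m) x x)) :
    (1 - p / R) * (cutoff m o R x * gradNorm m u x) ^ p
      ≤ divergence (fun y ↦ ((cutoff m o R y ^ p * u y) •
          (gradNorm m u y ^ (p - 2) • grad u y) : Tan m y)) x
        + |u x * pLaplacian m p u x| + p / R * |u x| ^ p := by
  set φ := extChartAt (𝓡 m) x with hφ
  have hxs : x ∈ φ.source := mem_extChartAt_source x
  have hxt : φ x ∈ φ.target := mem_extChartAt_target x
  have hinv : φ.symm (φ x) = x := extChartAt_to_inv x
  set c := cutoff m o R x with hcdef
  set g := gradNorm m u x with hg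
  have hc0 : 0 ≤ c := cutoff_nonneg o R x
  have hc1 : c ≤ 1 := cutoff_le_one o R x
  have hg0 : 0 ≤ g := norm_nonneg _
  set W := chartField x (fun y ↦ (grad u y : Tan m y)) (φ x) with hW
  have hWW : metricForm x (φ x) W W = g ^ 2 := by
    rw [hW, metricForm_chartField_self hxt, hinv]
    rfl
  have hdu : DifferentiableAt ℝ (fun y ↦ u (φ.symm y)) (φ x) :=
    ((contDiffOn_comp_symm hu x).differentiableOn (by simp)).differentiableAt
      ((isOpen_target x).mem_nhds hxt)
  have hduW : fderiv ℝ (fun y ↦ u (φ.symm y)) (φ x) W = g ^ 2 := by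
    rw [← metricForm_chartField_grad hxt (hu.mdifferentiableAt (by simp)), ← hW, hWW]
  have hdcW : |fderiv ℝ (fun y ↦ cutoff m o R (φ.symm y)) (φ x) W| ≤ R⁻¹ * g := by
    have := abs_fderiv_le_of_abs_sub_le (inv_pos.2 hR).le (abs_cutoff_sub_le hR) hc W
    rwa [← hφ, hWW, Real.sqrt_sq hg0] at this
  set D := fderiv ℝ (fun y ↦ cutoff m o R (φ.symm y)) (φ x) W with hD
  have hderiv : HasFDerivAt (fun y ↦ cutoff m o R (φ.symm y) ^ p * u (φ.symm y))
      (c ^ p • fderiv ℝ (fun y ↦ u (φ.symm y)) (φ x)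
        + u x • ((p * c ^ (p - 1)) • fderiv ℝ (fun y ↦ cutoff m o R (φ.symm y)) (φ x))) (φ x) := by
    have h1 := (hc.hasFDerivAt.rpow_const (p := p) (Or.inr (by linarith))).mul hdu.hasFDerivAt
    rw [hinv] at h1
    exact h1
  have hYW : chartField x (fun y ↦ (gradNorm m u y ^ (p - 2) • grad u y : Tan m y)) (φ x)
      = g ^ (p - 2) • W := by
    rw [chartField_smul]
    simp only [← hφ, hinv, ← hW, ← hg]
  rw [divergence_smul hderiv.differentiableAt hY, ← hφ, hderiv.fderiv, hYW]
  simp only [add_apply, smul_apply, map_smul, smul_eq_mul,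
    hduW, ← hD, ← hcdef]
  have hg2 : g ^ (p - 2) * g ^ 2 = g ^ p := by
    have := Real.rpow_add_of_nonneg hg0 (sub_nonneg.2 hp) zero_le_two
    rw [sub_add_cancel] at this
    rw [this]
    norm_num
  have hg1 : g ^ (p - 2) * g = g ^ (p - 1) := by
    have := Real.rpow_add_of_nonneg hg0 (sub_nonneg.2 hp) zero_le_one
    rw [Real.rpow_one] at this
    rw [← this]
    ring_nf
  have hpLap : divergence (fun y ↦ (gradNorm m u y ^ (p - 2) • grad u y : Tan m y)) x
      = -pLaplacian m p u x := (neg_neg _).symm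
  rw [hpLap, Real.mul_rpow hc0 hg0]
  have hcp : 0 ≤ c ^ p := Real.rpow_nonneg hc0 p
  have hcp1 : c ^ p ≤ 1 := Real.rpow_le_one hc0 hc1 (by linarith)
  have e1 : c ^ p * (u x * pLaplacian m p u x) ≤ |u x * pLaplacian m p u x| := by
    refine (le_abs_self _).trans ?_
    rw [abs_mul, abs_of_nonneg hcp]
    exact mul_le_of_le_one_left (abs_nonneg _) hcp1
  -- As |dc(∇u)| ≤ g/R, this term is at most (p/R) |u| (c g)^(p-1).
  have e2 : -(p / R * (|u x| ^ p + c ^ p * g ^ p))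
      ≤ g ^ (p - 2) * (u x * (p * c ^ (p - 1) * D)) := by
    refine (abs_le.1 (?_ : |g ^ (p - 2) * (u x * (p * c ^ (p - 1) * D))| ≤ _)).1
    have hcq : 0 ≤ c ^ (p - 1) := Real.rpow_nonneg hc0 _
    have hgq : 0 ≤ g ^ (p - 2) := Real.rpow_nonneg hg0 _
    rw [abs_mul, abs_mul, abs_mul, abs_mul, abs_of_nonneg hgq, abs_of_nonneg hcq,
      abs_of_nonneg (by linarith : 0 ≤ p)]
    have hY := mul_rpow_sub_one_le_add (abs_nonneg (u x)) (mul_nonneg hc0 hg0)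
      (by linarith : 1 ≤ p)
    rw [Real.mul_rpow hc0 hg0, Real.mul_rpow hc0 hg0] at hY
    calc g ^ (p - 2) * (|u x| * (p * c ^ (p - 1) * |D|))
        ≤ g ^ (p - 2) * (|u x| * (p * c ^ (p - 1) * (R⁻¹ * g))) := by gcongr
      _ = p / R * (|u x| * (c ^ (p - 1) * (g ^ (p - 2) * g))) := by
          rw [div_eq_mul_inv]
          ring
      _ ≤ _ := by
          rw [hg1]
          exact mul_le_mul_of_nonneg_left hY (by positivity)
  have e3 : g ^ (p - 2) * (c ^ p * g ^ 2) = c ^ p * g ^ p := by rw [← hg2]; ring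
  linear_combination e1 + e2 - e3

end Cutoff

/-! ### Integration, the limit R → ∞, and Hölder's inequality. -/

noncomputable section GradientEstimate

/-- Hölder's inequality for three functions. -/
theorem eLpNorm_mul_mul_le {α : Type*} [MeasurableSpace α] {μ : Measure α} {f g h : α → ℝ}
    (hf : AEStronglyMeasurable f μ) (hg : AEStronglyMeasurable g μ)
    (hh : AEStronglyMeasurable h μ) {a b c : ℝ≥0∞} (habc : a⁻¹ + c⁻¹ + b⁻¹ = 1) :
    eLpNorm (fun x ↦ f x * g x * h x) 1 μ ≤ eLpNorm f a μ * eLpNorm g b μ * eLpNorm h c μ := by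
  have h1 : ENNReal.HolderTriple a b (a⁻¹ + b⁻¹)⁻¹ := ⟨by rw [inv_inv]⟩
  have h2 : ENNReal.HolderTriple (a⁻¹ + b⁻¹)⁻¹ c 1 := ⟨by
    rw [inv_inv, inv_one, ← habc, add_right_comm]⟩
  calc eLpNorm ((f • g) • h) 1 μ
      ≤ eLpNorm (f • g) (a⁻¹ + b⁻¹)⁻¹ μ * eLpNorm h c μ :=
        eLpNorm_smul_le_mul_eLpNorm (f := h) (φ := f • g) hh (hf.smul hg)
    _ ≤ eLpNorm f a μ * eLpNorm g b μ * eLpNorm h c μ :=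
        mul_le_mul_left (eLpNorm_smul_le_mul_eLpNorm hg hf) _

variable {m : ℕ} {M : Type*} [TopologicalSpace M] [ChartedSpace (Model m) M]
  [IsManifold (𝓡 m) ∞ M] [RiemannianBundle (fun x : M ↦ Tan m x)]
  [IsContMDiffRiemannianBundle (𝓡 m) ∞ (Model m) (fun x : M ↦ Tan m x)]
  [ConnectedSpace M] [T2Space M] [SecondCountableTopology M] [MeasurableSpace M] [BorelSpace M]

theorem gradNorm_nonneg (u : M → ℝ) (x : M) : 0 ≤ gradNorm m u x := norm_nonneg _

theorem aemeasurable_pLaplacian {u : M → ℝ} (hu : ContMDiff (𝓡 m) 𝓘(ℝ, ℝ) ∞ u) {p : ℝ}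
    (hp : 2 ≤ p) : AEMeasurable (pLaplacian m p u) (vol m M) :=
  (locLipField_rpow_smul_grad hu hp).aemeasurable_divergence.neg

theorem aemeasurable_laplacian {u : M → ℝ} (hu : ContMDiff (𝓡 m) 𝓘(ℝ, ℝ) ∞ u) :
    AEMeasurable (laplacian m u) (vol m M) :=
  (locLipField_grad hu).aemeasurable_divergence.neg

/-- Integrates `divergence_cutoff_smul_ge`. Completeness makes the closed ball of radius 2R compact,
so the divergence integrates to zero. -/
theorem integral_rpow_cutoff_mul_gradNorm_le (hM : GeodesicallyComplete m M) {u : M → ℝ}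
    (hu : ContMDiff (𝓡 m) 𝓘(ℝ, ℝ) ∞ u) {p : ℝ} (hp : 2 ≤ p)
    (huLp : Integrable (fun x ↦ |u x| ^ p) (vol m M))
    (hB : Integrable (fun x ↦ u x * pLaplacian m p u x) (vol m M)) (o : M) {R : ℝ} (hR : 0 < R) :
    Integrable (fun x ↦ (cutoff m o R x * gradNorm m u x) ^ p) (vol m M) ∧
      (1 - p / R) * ∫ x, (cutoff m o R x * gradNorm m u x) ^ p ∂vol m M
        ≤ ∫ x, |u x * pLaplacian m p u x| ∂vol m M + p / R * ∫ x, |u x| ^ p ∂vol m M := by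
  have : LocallyCompactSpace M := ChartedSpace.locallyCompactSpace (Model m) M
  have hK := isCompact_setOf_rdist_le hM o (2 * R)
  have hzero : ∀ x ∉ {y | rdist m o y ≤ 2 * R}, cutoff m o R x = 0 := fun x hx ↦
    cutoff_eq_zero hR (not_le.1 hx)
  have hp0 : p ≠ 0 := by linarith
  have hint : Integrable (fun x ↦ (cutoff m o R x * gradNorm m u x) ^ p) (vol m M) := by
    refine Continuous.integrable_of_hasCompactSupport ?_ (.intro hK fun x hx ↦ ?_)
    · exact ((continuous_cutoff o R).mul (continuous_gradNorm hu)).rpow_const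
        fun _ ↦ Or.inr (by linarith)
    · rw [hzero x hx, zero_mul, Real.zero_rpow hp0]
  refine ⟨hint, ?_⟩
  have hY := locLipField_rpow_smul_grad hu hp
  have hX := (((locLip_cutoff (m := m) (o := o) hR).rpow (by linarith : 1 ≤ p)).mul
    (locLip_of_contMDiff hu)).smul hY
  obtain ⟨hdiv, hdiv0⟩ := hX.integral_divergence hK fun x hx ↦ by
    rw [hzero x hx, Real.zero_rpow hp0, zero_mul, zero_smul]
  have key := integral_mono_ae (hint.const_mul (1 - p / R))
    ((hdiv.add hB.abs).add (huLp.const_mul (p / R)))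
    (by
      filter_upwards [hY.ae_differentiableAt,
        (locLip_cutoff (m := m) (o := o) hR).ae_differentiableAt]
        with x h1 h2 using divergence_cutoff_smul_ge hu hp hR h2 h1)
  rw [integral_const_mul, integral_add' (hdiv.add hB.abs) (huLp.const_mul (p / R)),
    integral_add' hdiv hB.abs, hdiv0, zero_add, integral_const_mul] at key
  exact key

/-- The basic estimate `‖∇u‖ₚᵖ ≤ ‖u Δₚu‖₁`. -/
theorem eLpNorm_gradNorm_rpow_le (hM : GeodesicallyComplete m M) {u : M → ℝ}
    (hu : ContMDiff (𝓡 m) 𝓘(ℝ, ℝ) ∞ u) {p : ℝ} (hp : 2 ≤ p)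
    (huLp : MemLp u (ENNReal.ofReal p) (vol m M)) :
    eLpNorm (gradNorm m u) (ENNReal.ofReal p) (vol m M) ^ p
      ≤ eLpNorm (fun x ↦ u x * pLaplacian m p u x) 1 (vol m M) := by
  have hp0 : 0 < p := by linarith
  -- An infinite right-hand side leaves nothing to prove; otherwise u Δ_p u is integrable.
  rcases eq_or_ne (eLpNorm (fun x ↦ u x * pLaplacian m p u x) 1 (vol m M)) ∞ with htop | htop
  · rw [htop]
    exact le_top
  have hB : Integrable (fun x ↦ u x * pLaplacian m p u x) (vol m M) :=
    memLp_one_iff_integrable.1 ⟨(hu.continuous.aemeasurable.mul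
      (aemeasurable_pLaplacian hu hp)).aestronglyMeasurable, lt_top_iff_ne_top.2 htop⟩
  have hU : Integrable (fun x ↦ |u x| ^ p) (vol m M) := by
    have := huLp.integrable_norm_rpow (by simpa using hp0) ENNReal.ofReal_ne_top
    simpa [ENNReal.toReal_ofReal hp0.le] using this
  have hlhs : eLpNorm (gradNorm m u) (ENNReal.ofReal p) (vol m M) ^ p
      = ∫⁻ x, ENNReal.ofReal (gradNorm m u x ^ p) ∂vol m M := by
    rw [eLpNorm_eq_lintegral_rpow_enorm_toReal (by simpa using hp0) ENNReal.ofReal_ne_top,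
      ENNReal.toReal_ofReal hp0.le, one_div, ENNReal.rpow_inv_rpow hp0.ne']
    refine lintegral_congr fun x ↦ ?_
    rw [Real.enorm_eq_ofReal (gradNorm_nonneg u x),
      ENNReal.ofReal_rpow_of_nonneg (gradNorm_nonneg u x) hp0.le]
  have hrhs : eLpNorm (fun x ↦ u x * pLaplacian m p u x) 1 (vol m M)
      = ENNReal.ofReal (∫ x, |u x * pLaplacian m p u x| ∂vol m M) := by
    rw [eLpNorm_one_eq_lintegral_enorm, ofReal_integral_eq_lintegral_ofReal hB.abs
      (ae_of_all _ fun x ↦ abs_nonneg _)]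
    exact lintegral_congr fun x ↦ (ofReal_norm _).symm
  rw [hlhs, hrhs]
  set B := ∫ x, |u x * pLaplacian m p u x| ∂vol m M
  set U := ∫ x, |u x| ^ p ∂vol m M
  obtain ⟨o⟩ : Nonempty M := inferInstance
  set F : ℕ → M → ℝ≥0∞ := fun n x ↦
    ENNReal.ofReal ((cutoff m o n x * gradNorm m u x) ^ p) with hF
  -- At each point the cutoffs of radius n are eventually equal to 1.
  have hpt : ∀ x, ENNReal.ofReal (gradNorm m u x ^ p) = liminf (fun n ↦ F n x) atTop := by
    intro x
    refine (Tendsto.liminf_eq (tendsto_const_nhds.congr' ?_)).symm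
    filter_upwards [eventually_gt_atTop 0, tendsto_natCast_atTop_atTop.eventually_ge_atTop
      (rdist m o x)] with n hn hn'
    rw [hF]
    simp only
    rw [cutoff_eq_one (by exact_mod_cast hn) hn', one_mul]
  have hbound : ∀ᶠ n : ℕ in atTop, ∫⁻ x, F n x ∂vol m M
      ≤ ENNReal.ofReal ((B + p / n * U) / (1 - p / n)) := by
    -- For n > p the factor 1 - p/n is positive and can be divided out.
    filter_upwards [tendsto_natCast_atTop_atTop.eventually_gt_atTop p] with n hn
    have hn0 : (0 : ℝ) < n := hp0.trans hn
    obtain ⟨hint, hle⟩ := integral_rpow_cutoff_mul_gradNorm_le hM hu hp hU hB o hn0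
    rw [hF, ← ofReal_integral_eq_lintegral_ofReal hint (ae_of_all _ fun x ↦
      Real.rpow_nonneg (mul_nonneg (cutoff_nonneg _ _ _) (norm_nonneg _)) _)]
    refine ENNReal.ofReal_le_ofReal ((le_div_iff₀' ?_).2 hle)
    rw [sub_pos, div_lt_one hn0]
    exact hn
  have hlim : Tendsto (fun n : ℕ ↦ ENNReal.ofReal ((B + p / n * U) / (1 - p / n))) atTop
      (𝓝 (ENNReal.ofReal B)) := by
    refine ENNReal.tendsto_ofReal ?_
    have h0 : Tendsto (fun n : ℕ ↦ p / (n : ℝ)) atTop (𝓝 0) :=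
      tendsto_const_div_atTop_nhds_zero_nat p
    have := ((h0.mul_const U).const_add B).div (h0.const_sub 1) (by norm_num)
    rw [zero_mul, add_zero, sub_zero, div_one] at this
    exact this
  calc ∫⁻ x, ENNReal.ofReal (gradNorm m u x ^ p) ∂vol m M
      = ∫⁻ x, liminf (fun n ↦ F n x) atTop ∂vol m M := lintegral_congr hpt
    _ ≤ liminf (fun n ↦ ∫⁻ x, F n x ∂vol m M) atTop := by
        refine lintegral_liminf_le fun n ↦ ENNReal.measurable_ofReal.comp ?_
        exact (((continuous_cutoff o (n : ℝ)).mul (continuous_gradNorm hu)).rpow_const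
          fun _ ↦ Or.inr hp0.le).measurable
    _ ≤ liminf (fun n : ℕ ↦ ENNReal.ofReal ((B + p / n * U) / (1 - p / n))) atTop :=
        liminf_le_liminf hbound
    _ = ENNReal.ofReal B := hlim.liminf_eq

theorem gradFactor_eq (u : M → ℝ) {p : ℝ} (hp : 2 ≤ p) (a : ℝ≥0∞) :
    gradFactor m p a u = eLpNorm (fun x ↦ gradNorm m u x ^ (p - 2)) a (vol m M) := by
  rw [gradFactor]
  split_ifs with h
  · simp [h]
  · have hp' : 0 < p - 2 := sub_pos.2 (lt_of_le_of_ne hp (Ne.symm h))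
    rw [mul_comm, ← eLpNorm_norm_rpow _ hp']
    congr 1
    funext x
    rw [Real.norm_of_nonneg (gradNorm_nonneg u x)]

theorem eLpNorm_mul_pLaplacian_le {u : M → ℝ} (hu : ContMDiff (𝓡 m) 𝓘(ℝ, ℝ) ∞ u) {p : ℝ}
    (hp : 2 ≤ p) {a₁ a₂ a₃ b₁ b₂ b₃ : ℝ≥0∞} (ha : a₁⁻¹ + a₂⁻¹ + a₃⁻¹ = 1)
    (hb : b₁⁻¹ + b₂⁻¹ + b₃⁻¹ = 1) :
    eLpNorm (fun x ↦ u x * pLaplacian m p u x) 1 (vol m M)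
      ≤ eLpNorm u a₁ (vol m M) * gradFactor m p a₃ u * eLpNorm (laplacian m u) a₂ (vol m M)
        + ENNReal.ofReal (p - 2) * (eLpNorm u b₁ (vol m M) * gradFactor m p b₃ u
          * eLpNorm (hessianNorm m u) b₂ (vol m M)) := by
  set w : M → ℝ := fun x ↦ gradNorm m u x ^ (p - 2) with hw
  have hw0 : ∀ x, 0 ≤ w x := fun x ↦ Real.rpow_nonneg (norm_nonneg _) _
  have hp2 : 0 ≤ p - 2 := sub_nonneg.2 hp
  set K : M → ℝ := fun x ↦ pLaplacian m p u x - w x * laplacian m u x with hK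
  have hKle : ∀ x, |K x| ≤ (p - 2) * w x * hessianNorm m u x := fun x ↦ by
    rw [mul_assoc]
    exact abs_pLaplacian_sub_le hu hp x
  -- The three-function Hölder inequality needs measurable factors. H is almost everywhere
  -- measurable and dominated by the Hessian norm, so it stands in for `hessianNorm`, whose
  -- measurability is then not required.
  set H : M → ℝ := fun x ↦ K x / ((p - 2) * w x) with hH
  have hHle : ∀ x, ‖H x‖ ≤ hessianNorm m u x := fun x ↦ by
    have h0 : 0 ≤ (p - 2) * w x := mul_nonneg hp2 (hw0 x)
    rw [Real.norm_eq_abs, hH, abs_div, abs_of_nonneg h0]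
    exact div_le_of_le_mul₀ h0 (Real.sqrt_nonneg _) (by rw [mul_comm]; exact hKle x)
  -- Where the denominator vanishes, K vanishes too by `hKle`, so the value 0 of the quotient is
  -- right.
  have hKH : ∀ x, K x = (p - 2) * w x * H x := fun x ↦ by
    rcases eq_or_ne ((p - 2) * w x) 0 with h0 | h0
    · have := hKle x
      rw [h0, zero_mul] at this
      rw [h0, zero_mul, abs_nonpos_iff.1 this]
    · exact (mul_div_cancel₀ _ h0).symm
  have humeas : AEMeasurable u (vol m M) := hu.continuous.aemeasurable
  have hwmeas : AEMeasurable w (vol m M) :=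
    ((continuous_gradNorm hu).rpow_const fun _ ↦ Or.inr hp2).aemeasurable
  have hLmeas := aemeasurable_laplacian (m := m) hu
  have hHmeas : AEMeasurable H (vol m M) :=
    ((aemeasurable_pLaplacian hu hp).sub (hwmeas.mul hLmeas)).div (hwmeas.const_mul _)
  have hsplit : (fun x ↦ u x * pLaplacian m p u x)
      = (fun x ↦ u x * w x * laplacian m u x) + (p - 2) • fun x ↦ u x * w x * H x := by
    funext x
    have h1 := hKH x
    rw [hK] at h1
    simp only [Pi.add_apply, Pi.smul_apply, smul_eq_mul]
    linear_combination u x * h1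
  rw [hsplit, gradFactor_eq u hp, gradFactor_eq u hp]
  refine (eLpNorm_add_le ((humeas.mul hwmeas).mul hLmeas).aestronglyMeasurable
    (((humeas.mul hwmeas).mul hHmeas).aestronglyMeasurable.const_smul _) le_rfl).trans ?_
  rw [eLpNorm_const_smul, Real.enorm_eq_ofReal hp2]
  gcongr
  · exact eLpNorm_mul_mul_le humeas.aestronglyMeasurable hwmeas.aestronglyMeasurable
      hLmeas.aestronglyMeasurable ha
  · refine (eLpNorm_mul_mul_le humeas.aestronglyMeasurable hwmeas.aestronglyMeasurable
      hHmeas.aestronglyMeasurable hb).trans ?_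
    gcongr
    exact eLpNorm_mono_real hHle

end GradientEstimate

end Riem

theorem theorem1 {m : ℕ} {M : Type*} [TopologicalSpace M] [T2Space M]
    [SecondCountableTopology M] [ConnectedSpace M]
    [ChartedSpace (EuclideanSpace ℝ (Fin m)) M] [IsManifold (𝓡 m) ∞ M]
    [RiemannianBundle (fun x : M ↦ TangentSpace (𝓡 m) x)]
    [IsContMDiffRiemannianBundle (𝓡 m) ∞ (EuclideanSpace ℝ (Fin m))
      (fun x : M ↦ TangentSpace (𝓡 m) x)]
    [MeasurableSpace M] [BorelSpace M]
    (hM : Riem.GeodesicallyComplete m M) (p : ℝ) (hp : 2 ≤ p) (u : M → ℝ)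
    (hu : ContMDiff (𝓡 m) 𝓘(ℝ, ℝ) ∞ u) (huLp : MemLp u (ENNReal.ofReal p) (Riem.vol m M)) :
    eLpNorm (Riem.gradNorm m u) (ENNReal.ofReal p) (Riem.vol m M) ^ p
        ≤ eLpNorm (fun x ↦ u x * Riem.pLaplacian m p u x) 1 (Riem.vol m M) ∧
      ∀ a₁ a₂ a₃ b₁ b₂ b₃ : ℝ≥0∞,
        1 ≤ a₁ → 1 ≤ a₂ → 1 ≤ a₃ → 1 ≤ b₁ → 1 ≤ b₂ → 1 ≤ b₃ →
        a₁⁻¹ + a₂⁻¹ + a₃⁻¹ = 1 → b₁⁻¹ + b₂⁻¹ + b₃⁻¹ = 1 →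
        eLpNorm (Riem.gradNorm m u) (ENNReal.ofReal p) (Riem.vol m M) ^ p
          ≤ eLpNorm u a₁ (Riem.vol m M) * Riem.gradFactor m p a₃ u
                * eLpNorm (Riem.laplacian m u) a₂ (Riem.vol m M)
            + ENNReal.ofReal (p - 2) *
              (eLpNorm u b₁ (Riem.vol m M) * Riem.gradFactor m p b₃ u
                * eLpNorm (Riem.hessianNorm m u) b₂ (Riem.vol m M)) := by
  have h1 := Riem.eLpNorm_gradNorm_rpow_le hM hu hp huLp
  exact ⟨h1, fun a₁ a₂ a₃ b₁ b₂ b₃ _ _ _ _ _ _ ha hb ↦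
    h1.trans (Riem.eLpNorm_mul_pLaplacian_le hu hp ha hb)⟩
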